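/- **Definitions.** For $g\ge 0$, $v\ge 1$ the generalized Catalan numbers $C_{g,v}(\mu_1,\dots,\mu_v)$ ($\mu_i\in\mathbb Z_{\ge0}$) are defined by $C_{0,1}(0)=1$, $C_{g,v}(0,\mu_2,\dots,\mu_v)=0$ if $(g,v)\ne(0,1)$, and, for $\mu_1\ge1$, $$C_{g,v}(\mu_1,\dots,\mu_v)=\sum_{j=2}^v\mu_jC_{g,v-1}(\mu_1+\mu_j-2,\mu_2,\dots,\widehat{\mu_j},\dots,\mu_v)+\sum_{\alpha+\beta=\mu_1-2}\Big[C_{g-1,v+1}(\alpha,\beta,\mu_2,\dots,\mu_v)+\sum_{\substack{g_1+g_2=g\\ I\sqcup J=\{2,\dots,v\}}}C_{g_1,|I|+1}(\alpha,\mu_I)\,C_{g_2,|J|+1}(\beta,\mu_J)\Big],$$ where $\alpha,\beta\ge0$, a hat means omission, $\mu_I=(\mu_i)_{i\in I}$ in increasing order of $i$, and terms of genus $-1$ are $0$. For real $b\ge0$, $c>0$ the generalized $bc$-Motzkin numbers are $$\widetilde M_{g,v}(n_1,\dots,n_v;b,c)=\sum_{\mu_1=0}^{n_1}\cdots\sum_{\mu_v=0}^{n_v}\binom{n_1}{\mu_1}\cdots\binom{n_v}{\mu_v}C_{g,v}(\mu_1,\dots,\mu_v)\,b^{\sum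 n_i-\sum\mu_i}c^{\sum\mu_i},$$ and their discrete Laplace transforms are $$F_{g,v}(x_1,\dots,x_v)=\sum_{n_1,\dots,n_v\ge1}\frac{\widetilde M_{g,v}(n_1,\dots,n_v;b,c)}{n_1\cdots n_v}x_1^{-n_1}\cdots x_v^{-n_v},$$ except that for $(g,v)=(0,1)$ the term $-\widetilde M_{0,1}(0;b,c)\log x_1$ is added (for any local branch of the logarithm). Change variables by $$\frac{x_i-b}{c}=2+\frac4{t_i^2-1},$$ where $t_i$ ranges over the set $D$ of complex $t\ne-1$ with $\operatorname{Re}t<0$ whose corresponding $x$ satisfies $|x|>b+2c$, and write $F_{g,v}(t_1,\dots,t_v)$ for the resulting functions. **Theorem.** The series defining $F_{g,v}$ converge absolutely if all $|x_i|>b+2c$, and, for $(g,v)\ne(0,1)$, $F_{g,v}(t_1,\dots,t_v)$ is holomorphic on $D^v$. For $t_1,\dots,t_v\in D$ put $$\begin{aligned}R_{g,v}(t_1,\dots,t_v)=&-\frac1{16}\sum_{j=2}^v\frac{t_j}{t_1^2-t_j^2}\Big(\frac{(t_1^2-1)^3}{t_1^2}\frac{\partial}{\partial t_1}F_{g,v-1}(t_1,\dots,\widehat{t_j},\dots,t_v)-\frac{(t_j^2-1)^3}{t_j^2}\frac{\partial}{\partial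 t_j}F_{g,v-1}(t_2,\dots,t_v)\Big)\\&-\frac1{16}\sum_{j=2}^v\frac{(t_1^2-1)^2}{t_1^2}\frac{\partial}{\partial t_1}F_{g,v-1}(t_1,\dots,\widehat{t_j},\dots,t_v)\\&-\frac1{32}\frac{(t_1^2-1)^3}{t_1^2}\frac{\partial}{\partial u_1}\frac{\partial}{\partial u_2}F_{g-1,v+1}(u_1,u_2,t_2,\dots,t_v)\Big|_{u_1=u_2=t_1}\\&-\frac1{32}\frac{(t_1^2-1)^3}{t_1^2}\sum_{\substack{g_1+g_2=g,\ I\sqcup J=\{2,\dots,v\}\\2g_1+|I|-1>0,\ 2g_2+|J|-1>0}}\frac{\partial}{\partial t_1}F_{g_1,|I|+1}(t_1,t_I)\cdot\frac{\partial}{\partial t_1}F_{g_2,|J|+1}(t_1,t_J),\end{aligned}$$ where the $F_{g-1,v+1}$ term is absent for $g=0$. Then, whenever $t_1\ne t_j$ for all $j\ge2$, $$\frac{\partial}{\partial t_1}F_{g,v}(t_1,\dots,t_v)=R_{g,v}(t_1,\dots,t_v)\qquad\text{for every }(g,v)\ne(0,1),(0,2),(0,3),$$ $$\frac{\partial}{\partial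 t_1}F_{0,3}(t_1,t_2,t_3)=R_{0,3}(t_1,t_2,t_3)+\frac1{16}\frac{(t_1^2-1)^3}{t_1^2}\,\frac{\partial}{\partial t_1}F_{0,2}(t_1,t_2)\,\frac{\partial}{\partial t_1}F_{0,2}(t_1,t_3).$$ The initial data are, for all $t,t_1,t_2\in D$, $$\frac{\partial}{\partial t}F_{0,1}(t)=\frac{8t}{(t+1)(t-1)^3},\qquad\frac{\partial}{\partial t_1}F_{0,2}(t_1,t_2)=\frac{t_2+1}{(t_1-1)(t_1+t_2)}.$$ -/

import Mathlib

/-- The subsequence `x_I` of a finite sequence `x`, listing the entries with index in `I` in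
increasing order of the index. In particular `subseq {j}ᶜ x` is `x` with its `j`-th entry deleted. -/
def subseq {n : ℕ} {A : Type} (I : Finset (Fin n)) (x : Fin n → A) : Fin I.card → A :=
  fun i => x (I.orderEmbOfFin rfl i)

/-- Splitting a sum over a finite index set along a subset. -/
theorem sum_subseq {n : ℕ} (I : Finset (Fin n)) (x : Fin n → ℕ) :
    ∑ i, subseq I x i = ∑ i ∈ I, x i := by
  have h : (Finset.univ : Finset (Fin I.card)).map (I.orderEmbOfFin rfl).toEmbedding = I := by
    ext a
    have := Finset.range_orderEmbOfFin I rfl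
    simp only [Finset.mem_map, Finset.mem_univ, true_and]
    rw [← Finset.mem_coe, ← this]
    rfl
  conv_rhs => rw [← h, Finset.sum_map]
  rfl

theorem sum_subseq_le {n : ℕ} (I : Finset (Fin n)) (x : Fin n → ℕ) :
    ∑ i, subseq I x i ≤ ∑ i, x i := by
  rw [sum_subseq]
  exact Finset.sum_le_sum_of_subset (Finset.subset_univ I)

theorem sum_subseq_compl_singleton {n : ℕ} (j : Fin n) (x : Fin n → ℕ) :
    x j + ∑ i, subseq {j}ᶜ x i = ∑ i, x i := by
  rw [sum_subseq, ← Finset.sum_add_sum_compl {j} x, Finset.sum_singleton]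

/-- The generalized Catalan number `C_{g,n+1}(m, μ_1, …, μ_n)`, with its first argument `m`
separated. It is defined by recursion on the total degree:
`C_{0,1}(0) = 1`, `C_{g,v}(0, …) = 0` for all other `(g,v)`, and for `m = k + 1 ≥ 1`
`C_{g,v}(m, μ) = ∑_j μ_j C_{g,v-1}(m + μ_j - 2, μ without μ_j)`
`  + ∑_{α + β = m - 2} [C_{g-1,v+1}(α, β, μ) + ∑ C_{h,|I|+1}(α, μ_I) C_{g-h,|J|+1}(β, μ_J)]`,
the last sum being over `0 ≤ h ≤ g` and all `I ⊔ J` equal to the index set of `μ`. In the code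
`α` runs over `0, …, k - 1` and `β = k - 1 - α`, so the second sum is empty if `m = 1`. -/
def catalanRec (g : ℕ) (m : ℕ) {n : ℕ} (μ : Fin n → ℕ) : ℕ :=
  match m with
  | 0 => if g = 0 ∧ n = 0 then 1 else 0
  | k + 1 =>
    ∑ j : Fin n, μ j * catalanRec g (k + 1 + μ j - 2) (subseq {j}ᶜ μ)
    + ∑ α : Fin k,
      ((match g with
        | 0 => 0
        | g' + 1 => catalanRec g' α.val
            (Fin.cons (k - 1 - α.val) μ : Fin (n + 1) → ℕ))
      + ∑ h : Fin (g + 1), ∑ I : Finset (Fin n),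
          catalanRec h.val α.val (subseq I μ)
            * catalanRec (g - h.val) (k - 1 - α.val) (subseq Iᶜ μ))
termination_by m + ∑ i, μ i
decreasing_by
  · have := sum_subseq_compl_singleton j μ
    omega
  · have := α.isLt
    rw [Fin.sum_cons]
    omega
  · have := sum_subseq_le I μ
    have := α.isLt
    omega
  · have := sum_subseq_le Iᶜ μ
    have := α.isLt
    omega

/-- The generalized Catalan number `C_{g,v}(μ_1, …, μ_v)`, for `v ≥ 1`
(with the irrelevant value `0` for `v = 0`). -/
def generalizedCatalan (g : ℕ) : {v : ℕ} → (Fin v → ℕ) → ℕ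
  | 0, _ => 0
  | _ + 1, μ => catalanRec g (μ 0) (Fin.tail μ)

/-- The generalized `bc`-Motzkin number `M_{g,v}(n_1, …, n_v; b, c)`. -/
noncomputable def bcMotzkin (b c : ℝ) (g : ℕ) {v : ℕ} (n : Fin v → ℕ) : ℝ :=
  ∑ μ ∈ Fintype.piFinset (fun i => Finset.range (n i + 1)),
    (∏ i, ((n i).choose (μ i) : ℝ)) * (generalizedCatalan g μ : ℝ)
      * b ^ (∑ i, n i - ∑ i, μ i) * c ^ (∑ i, μ i)

/-- The general term of the discrete Laplace transform, for positive `n_1, …, n_v`. -/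
noncomputable def laplaceTerm (b c : ℝ) (g : ℕ) {v : ℕ} (x : Fin v → ℂ) (n : Fin v → ℕ+) : ℂ :=
  ((bcMotzkin b c g (fun i => (n i : ℕ)) : ℝ) : ℂ) / (∏ i, ((n i : ℕ) : ℂ))
    * ∏ i, ((x i) ^ (n i : ℕ))⁻¹

/-- The discrete Laplace transform `F_{g,v}(x_1, …, x_v)` of the generalized `bc`-Motzkin numbers,
as a function of the variables `x_i`. The function `ℓ` stands for the logarithm (it only occurs for
`(g,v) = (0,1)`, when `x` has the single entry `x_1`, and the sum of the `ℓ (x i)` is `ℓ (x_1)`). -/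
noncomputable def laplaceTransform (ℓ : ℂ → ℂ) (b c : ℝ) (g : ℕ) {v : ℕ} (x : Fin v → ℂ) : ℂ :=
  if g = 0 ∧ v = 1 then
    (∑' n : Fin v → ℕ+, laplaceTerm b c g x n)
      - ((bcMotzkin b c g (0 : Fin v → ℕ) : ℝ) : ℂ) * ∑ i, ℓ (x i)
  else
    ∑' n : Fin v → ℕ+, laplaceTerm b c g x n

/-- The change of variable: the `x` with `(x - b) / c = 2 + 4 / (t ^ 2 - 1)`. -/
noncomputable def xOf (b c : ℝ) (t : ℂ) : ℂ := b + c * (2 + 4 / (t ^ 2 - 1))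

/-- The discrete Laplace transform as a function of the variables `t_i`. -/
noncomputable def laplaceT (ℓ : ℂ → ℂ) (b c : ℝ) (g : ℕ) {v : ℕ} (t : Fin v → ℂ) : ℂ :=
  laplaceTransform ℓ b c g (fun i => xOf b c (t i))

/-- The domain of the variables `t_i`: the points of the left half-plane (the branch of `t`
for which `x = ∞` corresponds to `t = -1`) at which `|x| > b + 2 c`. The point `t = -1` is excluded,
because `xOf b c (-1) = b + 2 c` by the convention for division by zero. -/
def tDomain (b c : ℝ) : Set ℂ := {t | t.re < 0 ∧ b + 2 * c < ‖xOf b c t‖}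

/-- `ℓ` is a continuous branch of the logarithm near `z`. -/
def IsLogBranchNear (ℓ : ℂ → ℂ) (z : ℂ) : Prop :=
  ContinuousAt ℓ z ∧ ∀ᶠ w in nhds z, Complex.exp (ℓ w) = w

/-- The partial derivative of `f` with respect to its `i`-th variable at the point `t`. -/
noncomputable def partialDeriv {v : ℕ} (i : Fin v) (f : (Fin v → ℂ) → ℂ) (t : Fin v → ℂ) : ℂ :=
  deriv (fun s => f (Function.update t i s)) (t i)

/-- The right-hand side of the differential recursion for `F_{g,n+1}` at `t = (t_1, …, t_{n+1})`:
`t_1` is `t 0` and the other variables are the `t j.succ`. There is no `(g-1)`-term for `g = 0`. -/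
noncomputable def recursionRHS (ℓ : ℂ → ℂ) (b c : ℝ) (g : ℕ) {n : ℕ} (t : Fin (n + 1) → ℂ) : ℂ :=
  - (1 / 16) * ∑ j : Fin n,
      t j.succ / (t 0 ^ 2 - t j.succ ^ 2) *
        ((t 0 ^ 2 - 1) ^ 3 / t 0 ^ 2 *
            partialDeriv 0 (laplaceT ℓ b c g) (Fin.cons (t 0) (subseq {j}ᶜ (Fin.tail t)))
          - (t j.succ ^ 2 - 1) ^ 3 / t j.succ ^ 2 *
            partialDeriv j (laplaceT ℓ b c g) (Fin.tail t))
  - (1 / 16) * ∑ j : Fin n,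
      (t 0 ^ 2 - 1) ^ 2 / t 0 ^ 2 *
        partialDeriv 0 (laplaceT ℓ b c g) (Fin.cons (t 0) (subseq {j}ᶜ (Fin.tail t)))
  - (1 / 32) * ((t 0 ^ 2 - 1) ^ 3 / t 0 ^ 2) *
      (if g = 0 then 0 else
        partialDeriv 0 (partialDeriv 1 (laplaceT ℓ b c (g - 1)))
          (Fin.cons (t 0) t : Fin (n + 2) → ℂ))
  - (1 / 32) * ((t 0 ^ 2 - 1) ^ 3 / t 0 ^ 2) *
      ∑ p ∈ Finset.HasAntidiagonal.antidiagonal g, ∑ I : Finset (Fin n),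
        if 0 < 2 * (p.1 : ℤ) + (I.card : ℤ) - 1 ∧ 0 < 2 * (p.2 : ℤ) + (Iᶜ.card : ℤ) - 1 then
          partialDeriv 0 (laplaceT ℓ b c p.1) (Fin.cons (t 0) (subseq I (Fin.tail t)))
            * partialDeriv 0 (laplaceT ℓ b c p.2) (Fin.cons (t 0) (subseq Iᶜ (Fin.tail t)))
        else 0

/-! Put a_i = c/(x_i - b). For m ≥ 1, ∑_n binom(n,m) b^(n-m) c^m x^(-n)/n = a^m/m, so for (g,v) ≠
(0,1) the transform F_{g,v} is the power series ∑ C_{g,v}(μ) ∏ a_i^μ_i/μ_i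
(`tsum_laplaceTerm_eq_mps`), and b, c enter only through the a_i. Since C_{g,v}(μ) ≤ K ρ^(∑ μ_i) for
every ρ > 2 (`exists_catalanRec_le`), it converges for |a_i| < 1/2, hence for |x_i| > b + 2c; this
gives convergence and holomorphy.

The operator a_1 ∂/∂a_1 removes the division by μ_1, and the defining recursion becomes the loop
equation `catalanGF_eq` for W_{g,v} = a_1 ∂F_{g,v}/∂a_1. In the variable t one has a =
(t²-1)/(2(t²+1)) and ∂F/∂t_1 = κ W, where κ is `logDerivA`. The disc function W_{0,1}, with constant
term 1, is explicit: z = a W_{0,1} solves z = a(1 + z²), so z = (t+1)/(t-1), the root with |z| ≤ 1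
(`aOf_mul_catalanGF_zero`). The loop equation for the annulus function W_{0,2} is then linear and
gives the second initial datum (`logDerivA_mul_catalanGF_one`).

In general the quadratic sum contains W_{g,v} itself twice, multiplied by the disc function. Moved
to the left, these terms turn the coefficient of W_{g,v} into 1 - 2az = -2t/(t²+1). The terms with
an annulus factor merge with the j-sum of the loop equation into the first two lines of R
(`recursion_summand`); the remaining splittings are the stable ones. For (0,3) the splittings {2} ⊔
{3} are unstable on both sides and are counted twice in this separation (`sum_splittings`), whence
the extra term.

One term of R differentiates F_{g,v-1} in t_j, which need not be its first variable, so C_{g,v} must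
be symmetric in all arguments; the recursion does not show this. Collect the numbers with first
argument m into a series c_m in a genus variable H and variables p_j. Then c_{k+1} = ∑ j p_j
c_{k+j-1} + ∑_{α+β=k-1} (H ∂_β c_α + c_α c_β), and the symmetry reads ∂_n c_m = ∂_m c_n. It follows
by induction on the degree, applying the recursion twice (`IsCutJoin.pd_symm`). -/

/-- Functions on finite multisets of natural numbers, to be multiplied by convolution over all
ways of splitting a multiset (exponential generating series in infinitely many variables). -/
@[ext]
structure MultisetSeries (R : Type) : Type where
  /-- The value of the function on a multiset. -/
  coeff : Multiset ℕ → R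

/-! ### The ring of exponential generating series in variables p_0, p_1, … -/

namespace MultisetSeries

variable {R : Type}

instance : CoeFun (MultisetSeries R) fun _ => Multiset ℕ → R := ⟨coeff⟩

/-- Agreement on all multisets whose sum is less than `N - w`. -/
def EqBelow (N w : ℕ) (f g : MultisetSeries R) : Prop := ∀ s : Multiset ℕ, s.sum + w < N → f s = g s

namespace EqBelow

variable {N w w' : ℕ} {f g k : MultisetSeries R}

theorem refl (f : MultisetSeries R) : EqBelow N w f f := fun _ _ => rfl

theorem of_eq (h : f = g) : EqBelow N w f g := h ▸ refl f

theorem symm (h : EqBelow N w f g) : EqBelow N w g f := fun s hs => (h s hs).symm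

theorem trans (h : EqBelow N w f g) (h' : EqBelow N w g k) : EqBelow N w f k :=
  fun s hs => (h s hs).trans (h' s hs)

theorem weaken (h : EqBelow N w f g) (hw : w ≤ w') : EqBelow N w' f g :=
  fun s hs => h s (by omega)

end EqBelow

variable [CommRing R]

/-- A series is the family of its coefficients. -/
def coeffEquiv : MultisetSeries R ≃ (Multiset ℕ → R) := ⟨coeff, mk, fun _ => rfl, fun _ => rfl⟩

instance : AddCommGroup (MultisetSeries R) := coeffEquiv.addCommGroup

instance : Mul (MultisetSeries R) :=
  ⟨fun f g => ⟨fun s => (s.antidiagonal.map fun p => f p.1 * g p.2).sum⟩⟩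

instance : One (MultisetSeries R) := ⟨⟨fun s => if s = 0 then 1 else 0⟩⟩

theorem mul_apply (f g : MultisetSeries R) (s : Multiset ℕ) :
    (f * g) s = (s.antidiagonal.map fun p => f p.1 * g p.2).sum := rfl

theorem add_apply (f g : MultisetSeries R) (s : Multiset ℕ) : (f + g) s = f s + g s := rfl

theorem zero_apply (s : Multiset ℕ) : (0 : MultisetSeries R) s = 0 := rfl

theorem one_apply (s : Multiset ℕ) : (1 : MultisetSeries R) s = if s = 0 then 1 else 0 := rfl

theorem nsmul_apply (n : ℕ) (f : MultisetSeries R) (s : Multiset ℕ) : (n • f) s = n • f s := rfl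

theorem sum_apply {ι : Type*} (t : Finset ι) (f : ι → MultisetSeries R) (s : Multiset ℕ) :
    (∑ i ∈ t, f i) s = ∑ i ∈ t, f i s := by
  classical
  induction t using Finset.induction_on with
  | empty => rfl
  | insert a t ha ih => rw [Finset.sum_insert ha, Finset.sum_insert ha, add_apply, ih]

/-- The `n`-th partial derivative. -/
def pd (n : ℕ) : MultisetSeries R →+ MultisetSeries R where
  toFun f := ⟨fun s => f (n ::ₘ s)⟩
  map_zero' := rfl
  map_add' _ _ := rfl

theorem pd_apply (n : ℕ) (f : MultisetSeries R) (s : Multiset ℕ) : pd n f s = f (n ::ₘ s) := rfl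

theorem pd_comm (m n : ℕ) (f : MultisetSeries R) : pd m (pd n f) = pd n (pd m f) := by
  ext s
  rw [pd_apply, pd_apply, pd_apply, pd_apply, Multiset.cons_swap]

/-- Two series agree if they and all their partial derivatives agree at `0`, formulated for
families closed under the derivatives. -/
theorem eq_of_pd {ι : Type*} (F G : ι → MultisetSeries R) (h0 : ∀ i, F i 0 = G i 0)
    (h : ∀ i n s, (∀ j, F j s = G j s) → pd n (F i) s = pd n (G i) s) : F = G := by
  have key : ∀ s, ∀ i, F i s = G i s := by
    intro s
    induction s using Multiset.induction_on with
    | empty => exact h0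
    | cons a s ih => exact fun i => h i a s ih
  funext i
  ext s
  exact key s i

/-- The extra element `n` falls into one or the other part of a splitting. Splittings are counted
with multiplicity, so no binomial factors appear. -/
theorem pd_mul (n : ℕ) (f g : MultisetSeries R) : pd n (f * g) = pd n f * g + f * pd n g := by
  ext s
  simp only [pd_apply, add_apply, mul_apply, Multiset.antidiagonal_cons, Multiset.map_add,
    Multiset.map_map, Multiset.sum_add, Function.comp_def, Prod.map_fst, Prod.map_snd, id]
  rw [add_comm]

theorem mul_zero_apply (f g : MultisetSeries R) : (f * g) 0 = f 0 * g 0 := by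
  simp [mul_apply]

/-- Both sides agree at 0 and obey the same Leibniz rule, and the family of all pairs is closed
under derivatives, so `eq_of_pd` applies. Associativity, the unit law and the rules for `euler` are
obtained in the same way. -/
theorem mul_comm' (f g : MultisetSeries R) : f * g = g * f := by
  have := eq_of_pd (R := R) (fun p : MultisetSeries R × MultisetSeries R => p.1 * p.2)
    (fun p => p.2 * p.1) (fun p => by simp only [mul_zero_apply, mul_comm])
    (fun p n s h => by
      have h1 := h (pd n p.1, p.2)
      have h2 := h (p.1, pd n p.2)
      simp only [pd_mul, add_apply] at *
      rw [h1, h2, add_comm])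
  exact congrFun this (f, g)

theorem add_mul' (f g k : MultisetSeries R) : (f + g) * k = f * k + g * k := by
  ext s
  simp only [mul_apply, add_apply, add_mul, Multiset.sum_map_add]

theorem mul_add' (f g k : MultisetSeries R) : f * (g + k) = f * g + f * k := by
  rw [mul_comm', add_mul', mul_comm' g, mul_comm' k]

theorem mul_assoc' (f g k : MultisetSeries R) : f * g * k = f * (g * k) := by
  have := eq_of_pd (R := R)
    (fun p : MultisetSeries R × MultisetSeries R × MultisetSeries R => p.1 * p.2.1 * p.2.2)
    (fun p => p.1 * (p.2.1 * p.2.2)) (fun p => by simp only [mul_zero_apply, mul_assoc])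
    (fun p n s h => by
      have h1 := h (pd n p.1, p.2)
      have h2 := h (p.1, pd n p.2.1, p.2.2)
      have h3 := h (p.1, p.2.1, pd n p.2.2)
      simp only [pd_mul, add_apply, add_mul', mul_add'] at *
      rw [h1, h2, h3, add_assoc])
  exact congrFun this (f, g, k)

theorem pd_one (n : ℕ) : pd n (1 : MultisetSeries R) = 0 := by
  ext s
  simp [pd_apply, one_apply, zero_apply]

theorem zero_mul' (f : MultisetSeries R) : 0 * f = 0 := by
  ext s
  simp [mul_apply, zero_apply]

theorem one_mul' (f : MultisetSeries R) : 1 * f = f := by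
  have := eq_of_pd (R := R) (fun p : MultisetSeries R => 1 * p) (fun p => p)
    (fun p => by simp [mul_zero_apply, one_apply])
    (fun p n s h => by simp only [pd_mul, pd_one, zero_mul', zero_add, h])
  exact congrFun this f

instance : CommRing (MultisetSeries R) :=
  { (inferInstance : AddCommGroup (MultisetSeries R)) with
    mul := (· * ·)
    one := 1
    left_distrib := mul_add'
    right_distrib := add_mul'
    zero_mul := zero_mul'
    mul_zero := fun f => by rw [mul_comm', zero_mul']
    mul_assoc := mul_assoc'
    one_mul := one_mul'
    mul_one := fun f => by rw [mul_comm', one_mul']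
    mul_comm := mul_comm' }

/-- The Euler-type operator `∑ j p_j F_j`, with `p_j` the `j`-th variable. -/
def euler : (ℕ → MultisetSeries R) →+ MultisetSeries R where
  toFun F := ⟨fun s => (s.map fun j : ℕ => (j : R) * F j (s.erase j)).sum⟩
  map_zero' := by
    ext s
    simp [zero_apply]
  map_add' F G := by
    ext s
    simp only [Pi.add_apply, add_apply, mul_add, Multiset.sum_map_add]

theorem euler_apply (F : ℕ → MultisetSeries R) (s : Multiset ℕ) :
    euler F s = (s.map fun j : ℕ => (j : R) * F j (s.erase j)).sum := rfl

/-- The first term is the derivative of the variable p_n itself. -/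
theorem pd_euler (n : ℕ) (F : ℕ → MultisetSeries R) :
    pd n (euler F) = n • F n + euler fun j => pd n (F j) := by
  ext s
  simp only [pd_apply, add_apply, nsmul_apply, euler_apply, Multiset.map_cons, Multiset.sum_cons,
    Multiset.erase_cons_head]
  rw [nsmul_eq_mul]
  congr 2
  refine Multiset.map_congr rfl fun j hj => ?_
  rw [Multiset.erase_cons_tail_of_mem hj]

theorem euler_zero_apply (F : ℕ → MultisetSeries R) : euler F 0 = 0 := by
  simp [euler_apply]

theorem euler_fun_add (F G : ℕ → MultisetSeries R) :
    (euler fun j => F j + G j) = euler F + euler G := map_add euler F G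

theorem euler_nsmul (n : ℕ) (F : ℕ → MultisetSeries R) :
    (euler fun j => n • F j) = n • euler F := map_nsmul euler n F

theorem euler_sum {ι : Type*} (t : Finset ι) (F : ι → ℕ → MultisetSeries R) :
    (euler fun j => ∑ i ∈ t, F i j) = ∑ i ∈ t, euler (F i) := by
  rw [← map_sum]
  congr 1
  funext j
  rw [Finset.sum_apply]

theorem euler_mul (F : ℕ → MultisetSeries R) (g : MultisetSeries R) :
    euler F * g = euler fun j => F j * g := by
  have := eq_of_pd (R := R) (fun p : (ℕ → MultisetSeries R) × MultisetSeries R => euler p.1 * p.2)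
    (fun p => euler fun j => p.1 j * p.2)
    (fun p => by simp only [mul_zero_apply, euler_zero_apply, zero_mul])
    (fun p n s h => by
      have h1 := h (fun j => pd n (p.1 j), p.2)
      have h2 := h (p.1, pd n p.2)
      simp only [pd_mul, pd_euler, euler_fun_add, add_mul, add_apply, smul_mul_assoc] at *
      rw [h1, h2, add_assoc])
  exact congrFun this (F, g)

theorem mul_euler (F : ℕ → MultisetSeries R) (g : MultisetSeries R) :
    g * euler F = euler fun j => g * F j := by
  rw [mul_comm, euler_mul]
  simp only [mul_comm]

theorem euler_comm (F : ℕ → ℕ → MultisetSeries R) :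
    (euler fun j => euler fun k => F j k) = euler fun k => euler fun j => F j k := by
  have := eq_of_pd (R := R) (fun p : ℕ → ℕ → MultisetSeries R => euler fun j => euler fun k => p j k)
    (fun p => euler fun k => euler fun j => p j k)
    (fun p => by simp only [euler_zero_apply])
    (fun p n s h => by
      have h1 := h (fun j k => pd n (p j k))
      simp only [pd_euler, euler_fun_add, add_apply, euler_nsmul] at *
      rw [h1]
      abel)
  exact congrFun this F

namespace EqBelow

variable {N w : ℕ} {f f' g g' : MultisetSeries R}

theorem add (h : EqBelow N w f f') (h' : EqBelow N w g g') : EqBelow N w (f + g) (f' + g') :=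
  fun s hs => by rw [add_apply, add_apply, h s hs, h' s hs]

theorem sum {ι : Type*} {t : Finset ι} {F G : ι → MultisetSeries R}
    (h : ∀ i ∈ t, EqBelow N w (F i) (G i)) : EqBelow N w (∑ i ∈ t, F i) (∑ i ∈ t, G i) :=
  fun s hs => by
    rw [sum_apply, sum_apply]
    exact Finset.sum_congr rfl fun i hi => h i hi s hs

theorem mul (h : EqBelow N w f f') (h' : EqBelow N w g g') : EqBelow N w (f * g) (f' * g') := by
  intro s hs
  rw [mul_apply, mul_apply]
  congr 1
  refine Multiset.map_congr rfl fun p hp => ?_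
  rw [Multiset.mem_antidiagonal] at hp
  have : p.1.sum + p.2.sum = s.sum := by rw [← Multiset.sum_add, hp]
  rw [h _ (by omega), h' _ (by omega)]

theorem pd (n : ℕ) (h : EqBelow N w f g) : EqBelow N (w + n) (pd n f) (pd n g) := by
  intro s hs
  rw [pd_apply, pd_apply]
  exact h _ (by rw [Multiset.sum_cons]; omega)

/-- Multiplication by p_j uses up `j` of the degree, so agreement of the j-th entries is needed only
in degrees lower by `j`. The factor `j` makes the entry at 0 irrelevant. -/
theorem euler {F G : ℕ → MultisetSeries R} (h : ∀ j, 0 < j → EqBelow N (w + j) (F j) (G j)) :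
    EqBelow N w (euler F) (euler G) := by
  intro s hs
  rw [euler_apply, euler_apply]
  congr 1
  refine Multiset.map_congr rfl fun j hj => ?_
  rcases Nat.eq_zero_or_pos j with rfl | hj0
  · simp
  · have : j + (s.erase j).sum = s.sum := by rw [← Multiset.sum_cons, Multiset.cons_erase hj]
    rw [h j hj0 _ (by omega)]

end EqBelow

end MultisetSeries

/-! ### Sums over α + β = k - 1 -/

/-- The pairs of natural numbers with sum `k - 1`; there are none for `k = 0`. -/
def predAntidiagonal (k : ℕ) : Finset (ℕ × ℕ) :=
  (Finset.range k ×ˢ Finset.range k).filter fun p => p.1 + p.2 + 1 = k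

theorem mem_predAntidiagonal {k : ℕ} {p : ℕ × ℕ} :
    p ∈ predAntidiagonal k ↔ p.1 + p.2 + 1 = k := by
  simp only [predAntidiagonal, Finset.mem_filter, Finset.mem_product, Finset.mem_range]
  omega

theorem predAntidiagonal_zero : predAntidiagonal 0 = ∅ := rfl

theorem predAntidiagonal_succ (k : ℕ) :
    predAntidiagonal (k + 1) = Finset.HasAntidiagonal.antidiagonal k := by
  ext p
  rw [mem_predAntidiagonal, Finset.HasAntidiagonal.mem_antidiagonal]
  omega

theorem sum_predAntidiagonal_swap {M : Type*} [AddCommMonoid M] (k : ℕ) (f : ℕ → ℕ → M) :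
    ∑ p ∈ predAntidiagonal k, f p.2 p.1 = ∑ p ∈ predAntidiagonal k, f p.1 p.2 := by
  refine Finset.sum_bij' (fun p _ => p.swap) (fun p _ => p.swap) ?_ ?_ ?_ ?_ ?_ <;>
    simp [mem_predAntidiagonal, add_comm]

theorem sum_fin_eq_sum_predAntidiagonal {M : Type*} [AddCommMonoid M] (k : ℕ) (f : ℕ → ℕ → M) :
    ∑ α : Fin k, f α.val (k - 1 - α.val) = ∑ p ∈ predAntidiagonal k, f p.1 p.2 := by
  rw [Finset.sum_fin_eq_sum_range]
  cases k with
  | zero => simp [predAntidiagonal_zero]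
  | succ k =>
    rw [predAntidiagonal_succ, Finset.Nat.sum_antidiagonal_eq_sum_range_succ f]
    exact Finset.sum_congr rfl fun i hi => by
      rw [dif_pos (Finset.mem_range.1 hi), Nat.add_sub_cancel]

/-- Substitute `n + p.1 - 1` for `p.1`. Wherever a truncated subtraction spoils the bijection, the
integer coefficient is 0. -/
theorem sum_predAntidiagonal_shift {R : Type*} [CommRing R] (m n : ℕ) (f : ℕ → ℕ → R) :
    ∑ p ∈ predAntidiagonal m, p.1 • f (n + p.1 - 1) p.2
      = ∑ p ∈ predAntidiagonal (m + n - 1), (p.1 + 1 - n) • f p.1 p.2 := by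
  refine Finset.sum_bij_ne_zero (fun p _ _ => (n + p.1 - 1, p.2)) ?_ ?_ ?_ ?_
  · intro p hp h
    have : p.1 ≠ 0 := fun h0 => h (by rw [h0, zero_smul])
    rw [mem_predAntidiagonal] at *
    simp only
    omega
  · intro p hp h q hq h' e
    have : p.1 ≠ 0 := fun h0 => h (by rw [h0, zero_smul])
    have : q.1 ≠ 0 := fun h0 => h' (by rw [h0, zero_smul])
    rw [Prod.mk.injEq] at e
    ext <;> omega
  · intro p hp h
    have h1 : p.1 + 1 - n ≠ 0 := fun h0 => h (by rw [h0, zero_smul])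
    have h2 : n + (p.1 + 1 - n) - 1 = p.1 := by omega
    refine ⟨(p.1 + 1 - n, p.2), ?_, ?_, ?_⟩
    · rw [mem_predAntidiagonal] at *
      simp only
      omega
    · simpa only [h2] using h
    · ext
      · exact h2
      · rfl
  · intro p hp h
    have : p.1 ≠ 0 := fun h0 => h (by rw [h0, zero_smul])
    simp only
    congr 1
    omega

/-- After `sum_predAntidiagonal_shift`, the coefficient of f(p,q) in the difference of the two sides
is n - m + 2(p + 1 - n) = p - q, because p + q + 2 = m + n. This is antisymmetric while `f` is
symmetric. -/
theorem sum_predAntidiagonal_balance {R : Type*} [CommRing R] (m n : ℕ) (hmn : 0 < m + n)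
    (f : ℕ → ℕ → R) (hf : ∀ p ∈ predAntidiagonal (m + n - 1), f p.1 p.2 = f p.2 p.1) :
    (n + 1) • ∑ p ∈ predAntidiagonal (m + n - 1), f p.1 p.2
        + 2 • ∑ p ∈ predAntidiagonal m, p.1 • f (n + p.1 - 1) p.2
      = (m + 1) • ∑ p ∈ predAntidiagonal (m + n - 1), f p.1 p.2
        + 2 • ∑ p ∈ predAntidiagonal n, p.1 • f (m + p.1 - 1) p.2 := by
  have e1 := sum_predAntidiagonal_shift m n f
  have e2 := sum_predAntidiagonal_shift n m f
  rw [add_comm n m] at e2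
  have e3 := sum_predAntidiagonal_swap (m + n - 1) fun p q => (p + 1 - m) • f p q
  have e4 := sum_predAntidiagonal_swap (m + n - 1) fun p q => (p : R) * f p q
  rw [e1, e2, ← e3]
  have e5 : ∑ p ∈ predAntidiagonal (m + n - 1), (p.2 : R) * f p.1 p.2
      = ∑ p ∈ predAntidiagonal (m + n - 1), (p.1 : R) * f p.1 p.2 := by
    rw [← e4]
    exact Finset.sum_congr rfl fun p hp => by rw [hf p hp]
  simp only [nsmul_eq_mul, Finset.mul_sum]
  rw [← sub_eq_zero, ← Finset.sum_add_distrib, ← Finset.sum_add_distrib, ← Finset.sum_sub_distrib]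
  have e6 : ∑ p ∈ predAntidiagonal (m + n - 1), ((p.1 : R) * f p.1 p.2 - (p.2 : R) * f p.1 p.2) = 0 := by
    rw [Finset.sum_sub_distrib, e5, sub_self]
  rw [← e6]
  refine Finset.sum_congr rfl fun p hp => ?_
  rw [← hf p hp]
  rw [mem_predAntidiagonal] at hp
  -- The integers p.1 + 1 - n and p.2 + 1 - m are opposite, so the two truncated differences are the
  -- positive and the negative part of the first.
  have hc : ((p.1 + 1 - n : ℕ) : R) - ((p.2 + 1 - m : ℕ) : R) = (p.1 : R) + 1 - n := by
    rcases le_total n (p.1 + 1) with h | h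
    · have : p.2 + 1 - m = 0 := by omega
      rw [this, Nat.cast_sub h]
      push_cast
      ring
    · have h1 : p.1 + 1 - n = 0 := by omega
      have h2 : p.2 + 1 - m = n - (p.1 + 1) := by omega
      rw [h1, h2, Nat.cast_sub h]
      push_cast
      ring
  have hs : (m : R) + n = p.1 + p.2 + 2 := by
    have : m + n = p.1 + p.2 + 2 := by omega
    have := congrArg (Nat.cast (R := R)) this
    push_cast at this
    exact this
  push_cast
  linear_combination (2 * f p.1 p.2) * hc - (f p.1 p.2) * hs

/-! ### Symmetry of solutions of the cut-and-join recursion -/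

namespace MultisetSeries

variable {R : Type} [CommRing R] {H : MultisetSeries R} {c : ℕ → MultisetSeries R}

/-- The coefficients of the topological recursion: `c (k + 1)` is
`∑ j p_j c (k + j - 1) + ∑_{α + β = k - 1} (H ∂_β c α + c α * c β)`. -/
def IsCutJoin (H : MultisetSeries R) (c : ℕ → MultisetSeries R) : Prop :=
  ∀ k, c (k + 1) = euler (fun j => c (k + j - 1))
    + ∑ p ∈ predAntidiagonal k, (H * pd p.2 (c p.1) + c p.1 * c p.2)

theorem pd_const_mul (hH : ∀ n, pd n H = 0) (n : ℕ) (f : MultisetSeries R) :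
    pd n (H * f) = H * pd n f := by
  rw [pd_mul, hH, zero_mul, zero_add]

theorem IsCutJoin.pd_succ (hH : ∀ n, pd n H = 0) (hc : IsCutJoin H c) (p k : ℕ) :
    pd p (c (k + 1)) = p • c (k + p - 1) + euler (fun j => pd p (c (k + j - 1)))
      + ∑ q ∈ predAntidiagonal k, (H * pd p (pd q.2 (c q.1)) + 2 * (pd p (c q.1) * c q.2)) := by
  rw [hc k, map_add, pd_euler, map_sum]
  have := sum_predAntidiagonal_swap k fun x y => pd p (c x) * c y
  simp only [map_add, pd_const_mul hH, pd_mul, Finset.sum_add_distrib, two_mul]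
  rw [← this]
  simp only [mul_comm (c _)]

theorem IsCutJoin.pd_pd_succ (hH : ∀ n, pd n H = 0) (hc : IsCutJoin H c) (q p k : ℕ) :
    pd q (pd p (c (k + 1))) = p • pd q (c (k + p - 1)) + q • pd p (c (k + q - 1))
      + euler (fun j => pd q (pd p (c (k + j - 1))))
      + ∑ r ∈ predAntidiagonal k, (H * pd q (pd p (pd r.2 (c r.1)))
        + 2 * (pd q (pd p (c r.1)) * c r.2) + 2 * (pd p (c r.1) * pd q (c r.2))) := by
  have h2 : ∀ f : MultisetSeries R, pd q (2 * f) = 2 * pd q f := fun f => by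
    rw [two_mul, map_add, two_mul]
  rw [hc.pd_succ hH, map_add, map_add, pd_euler, map_nsmul, map_sum]
  simp only [map_add, pd_const_mul hH, pd_mul, h2, mul_add]
  simp only [add_assoc]

/-- One step of the expansion of `pd n (c (m + 1))`, with the derivatives moved to `c n`. -/
theorem IsCutJoin.pd_succ_eqBelow (hH : ∀ n, pd n H = 0) (hc : IsCutJoin H c) {N : ℕ}
    (ih : ∀ m n, EqBelow N (m + n) (pd n (c m)) (pd m (c n))) (m n : ℕ) :
    EqBelow N (m + n) (pd n (c (m + 1))) (n • c (m + n - 1)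
      + euler (fun j => pd (m + j - 1) (c n))
      + ∑ q ∈ predAntidiagonal m, (H * pd q.1 (pd q.2 (c n)) + 2 * (pd q.1 (c n) * c q.2))) := by
  rw [hc.pd_succ hH]
  refine ((EqBelow.refl _).add (EqBelow.euler fun j hj => (ih _ _).weaken (by omega))).add
    (EqBelow.sum fun q hq => ?_)
  rw [mem_predAntidiagonal] at hq
  refine ((EqBelow.refl _).mul ?_).add ((EqBelow.refl _).mul
    (((ih _ _).weaken (by omega)).mul (EqBelow.refl _)))
  rw [pd_comm n q.2, pd_comm q.1 q.2]
  exact ((ih _ _).pd _).weaken (by omega)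

/-- The coefficient of `H ∂_q c p + c p * c q` type in the double expansion of
`pd (n + 1) (c (m + 1))`. -/
def splitTerm (H : MultisetSeries R) (c : ℕ → MultisetSeries R) (p q : ℕ) : MultisetSeries R :=
  H * pd q (c p) + c p * c q

/-- The recursion is applied to `c (m + 1)`, the induction hypothesis moves the derivatives onto `c
(n + 1)`, and the recursion is applied again. The outcome is sorted into nine groups, each of which
is invariant under exchanging `m` and `n`, up to the induction hypothesis. -/
theorem IsCutJoin.pd_succ_expand (hH : ∀ n, pd n H = 0) (hc : IsCutJoin H c) {N : ℕ}
    (ih : ∀ m n, EqBelow N (m + n) (pd n (c m)) (pd m (c n))) (m n : ℕ) (hmn : 0 < m + n) :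
    EqBelow N (m + (n + 1)) (pd (n + 1) (c (m + 1)))
      ((euler (fun j => (n + 1) • c (m + n + j - 2) + (m + j - 1) • c (n + (m + j - 1) - 1))
      + ((n + 1) • ∑ p ∈ predAntidiagonal (m + n - 1), splitTerm H c p.1 p.2
        + 2 • ∑ p ∈ predAntidiagonal m, p.1 • splitTerm H c (n + p.1 - 1) p.2))
      + euler (fun j => euler fun k => pd (m + j - 1) (c (n + k - 1)))
      + (∑ q ∈ predAntidiagonal n, H * euler (fun j => pd (m + j - 1) (pd q.2 (c q.1)))
        + ∑ q ∈ predAntidiagonal m, H * euler (fun k => pd q.1 (pd q.2 (c (n + k - 1)))))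
      + 2 * (∑ q ∈ predAntidiagonal n, euler (fun j => pd (m + j - 1) (c q.1)) * c q.2
        + ∑ q ∈ predAntidiagonal m, euler (fun k => pd q.1 (c (n + k - 1))) * c q.2)
      + H * H * (∑ q ∈ predAntidiagonal m, ∑ r ∈ predAntidiagonal n,
          pd q.1 (pd q.2 (pd r.2 (c r.1))))
      + 2 * H * (∑ q ∈ predAntidiagonal m, ∑ r ∈ predAntidiagonal n,
            pd q.1 (pd q.2 (c r.1)) * c r.2
          + ∑ q ∈ predAntidiagonal m, ∑ r ∈ predAntidiagonal n, pd q.1 (pd r.2 (c r.1)) * c q.2)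
      + 2 * H * (∑ q ∈ predAntidiagonal m, ∑ r ∈ predAntidiagonal n,
            pd q.2 (c r.1) * pd q.1 (c r.2))
      + 4 * (∑ q ∈ predAntidiagonal m, ∑ r ∈ predAntidiagonal n,
            pd q.1 (c r.1) * c r.2 * c q.2)) := by
  refine (hc.pd_succ_eqBelow hH ih m (n + 1)).trans (EqBelow.of_eq ?_)
  -- As `0 < m + n`, this index is a successor and the recursion applies to it.
  have e0 : c (m + (n + 1) - 1) = euler (fun j => c (m + n + j - 2))
      + ∑ p ∈ predAntidiagonal (m + n - 1), splitTerm H c p.1 p.2 := by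
    have := hc (m + n - 1)
    rw [show m + n - 1 + 1 = m + (n + 1) - 1 by omega] at this
    rw [this]
    congr 3
    funext j
    congr 1
    omega
  have eA : euler (fun j => pd (m + j - 1) (c (n + 1)))
      = euler (fun j => (m + j - 1) • c (n + (m + j - 1) - 1))
      + euler (fun j => euler fun k => pd (m + j - 1) (c (n + k - 1)))
      + (∑ q ∈ predAntidiagonal n, H * euler (fun j => pd (m + j - 1) (pd q.2 (c q.1)))
      + 2 * ∑ q ∈ predAntidiagonal n, euler (fun j => pd (m + j - 1) (c q.1)) * c q.2) := by
    simp only [hc.pd_succ hH, euler_fun_add, euler_sum, Finset.mul_sum, Finset.sum_add_distrib,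
      mul_euler, euler_mul]
  have eB : ∀ q : ℕ × ℕ, H * pd q.1 (pd q.2 (c (n + 1))) + 2 * (pd q.1 (c (n + 1)) * c q.2)
      = (q.2 • (H * pd q.1 (c (n + q.2 - 1))) + q.1 • (H * pd q.2 (c (n + q.1 - 1))))
      + 2 * q.1 • (c (n + q.1 - 1) * c q.2)
      + H * euler (fun k => pd q.1 (pd q.2 (c (n + k - 1))))
      + 2 * (euler (fun k => pd q.1 (c (n + k - 1))) * c q.2)
      + H * H * (∑ r ∈ predAntidiagonal n, pd q.1 (pd q.2 (pd r.2 (c r.1))))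
      + 2 * H * (∑ r ∈ predAntidiagonal n, pd q.1 (pd q.2 (c r.1)) * c r.2
          + ∑ r ∈ predAntidiagonal n, pd q.1 (pd r.2 (c r.1)) * c q.2)
      + 2 * H * (∑ r ∈ predAntidiagonal n, pd q.2 (c r.1) * pd q.1 (c r.2))
      + 4 * (∑ r ∈ predAntidiagonal n, pd q.1 (c r.1) * c r.2 * c q.2) := by
    intro q
    rw [hc.pd_pd_succ hH, hc.pd_succ hH]
    simp only [Finset.sum_add_distrib, ← Finset.mul_sum, ← Finset.sum_mul, nsmul_eq_mul]
    ring
  rw [e0, eA, Finset.sum_congr rfl fun q _ => eB q]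
  have eC : ∑ q ∈ predAntidiagonal m,
        (q.2 • (H * pd q.1 (c (n + q.2 - 1))) + q.1 • (H * pd q.2 (c (n + q.1 - 1))))
      = 2 * ∑ q ∈ predAntidiagonal m, q.1 • (H * pd q.2 (c (n + q.1 - 1))) := by
    rw [Finset.sum_add_distrib, two_mul]
    congr 1
    exact sum_predAntidiagonal_swap m fun a b => a • (H * pd b (c (n + a - 1)))
  have eD : euler (fun j => (n + 1) • c (m + n + j - 2) + (m + j - 1) • c (n + (m + j - 1) - 1))
      = (n + 1) • euler (fun j => c (m + n + j - 2))
        + euler (fun j => (m + j - 1) • c (n + (m + j - 1) - 1)) := by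
    rw [euler_fun_add, euler_nsmul]
  have eE : 2 • ∑ p ∈ predAntidiagonal m, p.1 • splitTerm H c (n + p.1 - 1) p.2
      = 2 * ∑ q ∈ predAntidiagonal m, q.1 • (H * pd q.2 (c (n + q.1 - 1)))
        + ∑ q ∈ predAntidiagonal m, 2 * q.1 • (c (n + q.1 - 1) * c q.2) := by
    simp only [splitTerm, smul_add, Finset.sum_add_distrib, ← Finset.mul_sum, nsmul_eq_mul,
      Nat.cast_ofNat]
  rw [eD, eE, Finset.sum_add_distrib, Finset.sum_add_distrib, Finset.sum_add_distrib,
    Finset.sum_add_distrib, Finset.sum_add_distrib, Finset.sum_add_distrib, Finset.sum_add_distrib,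
    eC, smul_add]
  simp only [← Finset.mul_sum]
  rw [Finset.sum_add_distrib]
  ring

/-- The two expansions are compared group by group. Only the first two groups need a count of
coefficients; the others match after exchanging sums and moving derivatives by the induction
hypothesis. -/
theorem IsCutJoin.symm_step (hH : ∀ n, pd n H = 0) (hc : IsCutJoin H c) {N : ℕ}
    (ih : ∀ m n, EqBelow N (m + n) (pd n (c m)) (pd m (c n))) (m n : ℕ) (hmn : 0 < m + n) :
    EqBelow N (m + (n + 1)) (pd (n + 1) (c (m + 1))) (pd (m + 1) (c (n + 1))) := by
  refine (hc.pd_succ_expand hH ih m n hmn).trans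
    (EqBelow.trans ?_ ((hc.pd_succ_expand hH ih n m (by omega)).weaken (by omega)).symm)
  have hU : ∀ p ∈ predAntidiagonal (m + n - 1),
      EqBelow N (m + (n + 1)) (splitTerm H c p.1 p.2) (splitTerm H c p.2 p.1) := by
    intro p hp
    rw [mem_predAntidiagonal] at hp
    exact ((EqBelow.refl _).mul ((ih _ _).weaken (by omega))).add (EqBelow.of_eq (mul_comm _ _))
  refine EqBelow.add (EqBelow.add (EqBelow.add (EqBelow.add (EqBelow.add (EqBelow.add
    (EqBelow.add (EqBelow.add ?_ ?_) ?_) ?_) ?_) ?_) ?_) ?_) ?_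
  -- Both terms are multiples of `c (m + n + j - 2)`, with total coefficient m + n + j. If `a + j -
  -- 1` is 0, the index is truncated differently, but the coefficient vanishes.
  · refine EqBelow.euler fun j hj => EqBelow.of_eq ?_
    have e : ∀ a b : ℕ, (a + j - 1) • c (b + (a + j - 1) - 1) = (a + j - 1) • c (a + b + j - 2) := by
      intro a b
      rcases Nat.eq_zero_or_pos (a + j - 1) with h | h
      · rw [h, zero_smul, zero_smul]
      · congr 2
        omega
    rw [e, e, add_comm n m, ← add_smul, ← add_smul]
    congr 1
    omega
  · intro s hs
    have := sum_predAntidiagonal_balance m n hmn (fun p q => splitTerm H c p q s)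
      (fun p hp => hU p hp s hs)
    simp only [add_apply, nsmul_apply, sum_apply, add_comm n m]
    exact this
  · rw [euler_comm]
    refine EqBelow.euler fun j hj => EqBelow.euler fun k hk => (ih _ _).weaken (by omega)
  -- The two sums of this group trade places when `m` and `n` are exchanged.
  · refine EqBelow.trans (EqBelow.of_eq (add_comm _ _)) ?_
    have key : ∀ m n : ℕ, EqBelow N (m + (n + 1))
        (∑ q ∈ predAntidiagonal m, H * euler (fun k => pd q.1 (pd q.2 (c (n + k - 1)))))
        (∑ q ∈ predAntidiagonal m, H * euler (fun j => pd (n + j - 1) (pd q.2 (c q.1)))) := by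
      intro m n
      refine EqBelow.sum fun q hq => (EqBelow.refl _).mul (EqBelow.euler fun j hj => ?_)
      rw [mem_predAntidiagonal] at hq
      rw [pd_comm, pd_comm _ q.2]
      exact ((ih _ _).pd _).weaken (by omega)
    exact (key m n).add ((key n m).weaken (by omega)).symm
  · refine (EqBelow.refl _).mul (EqBelow.trans (EqBelow.of_eq (add_comm _ _)) ?_)
    have key : ∀ m n : ℕ, EqBelow N (m + (n + 1))
        (∑ q ∈ predAntidiagonal m, euler (fun k => pd q.1 (c (n + k - 1))) * c q.2)
        (∑ q ∈ predAntidiagonal m, euler (fun j => pd (n + j - 1) (c q.1)) * c q.2) := by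
      intro m n
      refine EqBelow.sum fun q hq => EqBelow.mul (EqBelow.euler fun j hj => ?_) (EqBelow.refl _)
      rw [mem_predAntidiagonal] at hq
      exact (ih _ _).weaken (by omega)
    exact (key m n).add ((key n m).weaken (by omega)).symm
  · refine (EqBelow.refl _).mul ?_
    rw [Finset.sum_comm]
    refine EqBelow.sum fun r hr => EqBelow.sum fun q hq => ?_
    rw [mem_predAntidiagonal] at hq hr
    rw [pd_comm q.1 q.2, pd_comm q.1 r.2, pd_comm r.1 r.2, pd_comm r.1 q.2, pd_comm r.2 q.2]
    exact (((ih _ _).pd _).pd _).weaken (by omega)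
  · refine (EqBelow.refl _).mul ?_
    have key : ∀ m n : ℕ, EqBelow N (m + (n + 1))
        (∑ q ∈ predAntidiagonal m, ∑ r ∈ predAntidiagonal n, pd q.1 (pd q.2 (c r.1)) * c r.2)
        (∑ q ∈ predAntidiagonal n, ∑ r ∈ predAntidiagonal m,
          pd q.1 (pd r.2 (c r.1)) * c q.2) := by
      intro m n
      rw [Finset.sum_comm]
      refine EqBelow.sum fun r hr => EqBelow.sum fun q hq => EqBelow.mul ?_ (EqBelow.refl _)
      rw [mem_predAntidiagonal] at hq hr
      rw [pd_comm q.1, pd_comm r.1]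
      exact ((ih _ _).pd _).weaken (by omega)
    refine EqBelow.trans (EqBelow.of_eq (add_comm _ _)) ?_
    exact ((key n m).weaken (by omega)).symm.add (key m n)
  · refine (EqBelow.refl _).mul ?_
    rw [Finset.sum_comm]
    refine EqBelow.sum fun r hr => EqBelow.sum fun q hq => ?_
    rw [mem_predAntidiagonal] at hq hr
    rw [mul_comm (pd r.2 _)]
    exact EqBelow.mul ((ih _ _).weaken (by omega)) ((ih _ _).weaken (by omega))
  · refine (EqBelow.refl _).mul ?_
    rw [Finset.sum_comm]
    refine EqBelow.sum fun r hr => EqBelow.sum fun q hq => ?_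
    rw [mem_predAntidiagonal] at hq hr
    rw [mul_assoc, mul_assoc, mul_comm (c r.2)]
    exact EqBelow.mul ((ih _ _).weaken (by omega)) (EqBelow.refl _)

/-- Induction on the degree bound `N`. In `symm_step` the indices m + 1 and n + 1 cost only m + n +
1, which gains the unit needed to pass from `N` to `N + 1`. The recursion says nothing about index
0; `h0` and `h0'` cover it. -/
theorem IsCutJoin.pd_symm (hH : ∀ n, pd n H = 0) (hc : IsCutJoin H c)
    (h0 : ∀ n, pd n (c 0) = 0) (h0' : ∀ n, pd 0 (c n) = 0) (m n : ℕ) :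
    pd n (c m) = pd m (c n) := by
  have key : ∀ N : ℕ, ∀ m n, EqBelow N (m + n) (pd n (c m)) (pd m (c n)) := by
    intro N
    induction N with
    | zero => exact fun m n s hs => absurd hs (Nat.not_lt_zero _)
    | succ N ih =>
      intro m n
      rcases m with _ | m
      · exact EqBelow.of_eq (by rw [h0, h0'])
      rcases n with _ | n
      · exact EqBelow.of_eq (by rw [h0, h0'])
      rcases Nat.eq_zero_or_pos (m + n) with h | h
      · obtain rfl : m = n := by omega
        exact EqBelow.refl _
      · exact fun s hs => hc.symm_step hH ih m n h s (by omega)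
  ext s
  exact key (s.sum + (m + n) + 1) m n s (by omega)

end MultisetSeries

/-! ### Symmetry and vanishing of the generalized Catalan numbers -/

/-- The generalized Catalan number `C_{g,v}(m, s)` as a function of its first argument and the
multiset of its other arguments. -/
def multisetCatalan (g : ℕ) (m : ℕ) (s : Multiset ℕ) : ℕ :=
  match m with
  | 0 => if g = 0 ∧ s = 0 then 1 else 0
  | k + 1 =>
    (s.attach.map fun j => j.val * multisetCatalan g (k + 1 + j.val - 2) (s.erase j.val)).sum
    + ∑ α : Fin k,
      ((match g with
        | 0 => 0
        | g' + 1 => multisetCatalan g' α.val ((k - 1 - α.val) ::ₘ s))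
      + ∑ h : Fin (g + 1), (s.antidiagonal.attach.map fun p =>
          multisetCatalan h.val α.val p.val.1
            * multisetCatalan (g - h.val) (k - 1 - α.val) p.val.2).sum)
termination_by m + s.sum
decreasing_by
  · have : j.val + (s.erase j.val).sum = s.sum := by
      rw [← Multiset.sum_cons, Multiset.cons_erase j.2]
    omega
  · have := α.isLt
    rw [Multiset.sum_cons]
    omega
  · have := α.isLt
    have : p.val.1.sum + p.val.2.sum = s.sum := by
      rw [← Multiset.sum_add, Multiset.mem_antidiagonal.1 p.2]
    omega
  · have := α.isLt
    have : p.val.1.sum + p.val.2.sum = s.sum := by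
      rw [← Multiset.sum_add, Multiset.mem_antidiagonal.1 p.2]
    omega

theorem multisetCatalan_zero (g : ℕ) (s : Multiset ℕ) :
    multisetCatalan g 0 s = if g = 0 ∧ s = 0 then 1 else 0 := by
  rw [multisetCatalan]

/-- The value `f (g - 1)`, or zero if `g = 0`. -/
def predOrZero {M : Type*} [Zero M] (g : ℕ) (f : ℕ → M) : M := if g = 0 then 0 else f (g - 1)

theorem multisetCatalan_succ (g k : ℕ) (s : Multiset ℕ) :
    multisetCatalan g (k + 1) s
      = (s.map fun j => j * multisetCatalan g (k + j - 1) (s.erase j)).sum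
      + ∑ p ∈ predAntidiagonal k,
        (predOrZero g (fun g' => multisetCatalan g' p.1 (p.2 ::ₘ s))
        + ∑ q ∈ Finset.HasAntidiagonal.antidiagonal g, (s.antidiagonal.map fun r =>
            multisetCatalan q.1 p.1 r.1 * multisetCatalan q.2 p.2 r.2).sum) := by
  rw [multisetCatalan, ← sum_fin_eq_sum_predAntidiagonal k fun a b =>
    predOrZero g (fun g' => multisetCatalan g' a (b ::ₘ s))
        + ∑ q ∈ Finset.HasAntidiagonal.antidiagonal g, (s.antidiagonal.map fun r =>
            multisetCatalan q.1 a r.1 * multisetCatalan q.2 b r.2).sum]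
  congr 1
  · rw [← Multiset.attach_map_val' s fun j => j * multisetCatalan g (k + j - 1) (s.erase j)]
    congr 2
    funext j
    congr 2
    omega
  · refine Finset.sum_congr rfl fun α _ => ?_
    congr 1
    · cases g <;> simp [predOrZero]
    · rw [Finset.Nat.sum_antidiagonal_eq_sum_range_succ fun a b => (s.antidiagonal.map fun r =>
            multisetCatalan a α r.1 * multisetCatalan b (k - 1 - α) r.2).sum,
        Finset.sum_range]
      refine Finset.sum_congr rfl fun h _ => ?_
      exact congrArg _ (Multiset.attach_map_val' _ fun r : Multiset ℕ × Multiset ℕ =>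
        multisetCatalan h α r.1 * multisetCatalan (g - h) (k - 1 - α) r.2)

/-- The generating series in the genus of the generalized Catalan numbers. -/
noncomputable def catalanSeries (m : ℕ) : MultisetSeries (PowerSeries ℤ) :=
  ⟨fun s => PowerSeries.mk fun g => (multisetCatalan g m s : ℤ)⟩

/-- The genus variable as a constant series. -/
noncomputable def genusVar : MultisetSeries (PowerSeries ℤ) :=
  ⟨fun s => if s = 0 then PowerSeries.X else 0⟩

theorem pd_genusVar (n : ℕ) : MultisetSeries.pd n genusVar = 0 := by
  ext1
  funext s
  rw [MultisetSeries.pd_apply, MultisetSeries.zero_apply, genusVar]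
  exact if_neg (Multiset.cons_ne_zero)

theorem genusVar_mul_apply (f : MultisetSeries (PowerSeries ℤ)) (s : Multiset ℕ) :
    (genusVar * f) s = PowerSeries.X * f s := by
  induction s using Multiset.induction_on generalizing f with
  | empty => rw [MultisetSeries.mul_zero_apply]; rfl
  | cons a s ih =>
    rw [← MultisetSeries.pd_apply, MultisetSeries.pd_const_mul pd_genusVar, ih]
    rfl

/-- The product of power series produces the sum over g_1 + g_2 = g, the product of multiset series
the sum over I ⊔ J, and `genusVar` the shift from g - 1 to g. -/
theorem isCutJoin_catalanSeries : MultisetSeries.IsCutJoin genusVar catalanSeries := by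
  intro k
  ext1
  funext s
  ext g
  rw [MultisetSeries.add_apply, MultisetSeries.sum_apply, MultisetSeries.euler_apply, map_add,
    map_sum, map_multiset_sum, Multiset.map_map]
  change PowerSeries.coeff g (PowerSeries.mk fun g => (multisetCatalan g (k + 1) s : ℤ)) = _
  rw [PowerSeries.coeff_mk, multisetCatalan_succ, Nat.cast_add, Nat.cast_multiset_sum,
    Multiset.map_map, Nat.cast_sum]
  congr 1
  · congr 2
    funext j
    rw [Function.comp_apply, Function.comp_apply, ← nsmul_eq_mul, map_nsmul, nsmul_eq_mul,
      Nat.cast_mul]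
    simp only [catalanSeries, PowerSeries.coeff_mk]
  · refine Finset.sum_congr rfl fun p _ => ?_
    rw [MultisetSeries.add_apply, genusVar_mul_apply, MultisetSeries.pd_apply,
      MultisetSeries.mul_apply, map_add, Nat.cast_add, map_multiset_sum, Multiset.map_map]
    congr 1
    · cases g with
      | zero => simp [predOrZero]
      | succ g => simp [predOrZero, PowerSeries.coeff_succ_X_mul, catalanSeries]
    · rw [Nat.cast_sum]
      simp only [Nat.cast_multiset_sum, Multiset.map_map, Function.comp_def, Nat.cast_mul,
        PowerSeries.coeff_mul, catalanSeries, PowerSeries.coeff_mk]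
      exact Multiset.sum_map_sum_map (Finset.HasAntidiagonal.antidiagonal g).val s.antidiagonal

/-- Each term of the recursion inherits the argument 0, except the one with `j = 0`, which has the
factor 0. A nonempty `s` excludes the only nonzero initial value. -/
theorem multisetCatalan_of_zero_mem (g m : ℕ) (s : Multiset ℕ) (h0 : 0 ∈ s) :
    multisetCatalan g m s = 0 := by
  have key : ∀ N g m s, m + s.sum < N → 0 ∈ s → multisetCatalan g m s = 0 := by
    intro N
    induction N with
    | zero => exact fun g m s h => absurd h (Nat.not_lt_zero _)
    | succ N ih =>
      intro g m s hN h0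
      rcases m with _ | k
      · rw [multisetCatalan_zero, if_neg]
        rintro ⟨-, rfl⟩
        exact absurd h0 (Multiset.notMem_zero 0)
      rw [multisetCatalan_succ]
      have h1 : (s.map fun j => j * multisetCatalan g (k + j - 1) (s.erase j)).sum = 0 := by
        refine Multiset.sum_eq_zero fun x hx => ?_
        obtain ⟨j, hj, rfl⟩ := Multiset.mem_map.1 hx
        rcases Nat.eq_zero_or_pos j with rfl | hj0
        · exact Nat.zero_mul _
        · have : j + (s.erase j).sum = s.sum := by
            rw [← Multiset.sum_cons, Multiset.cons_erase hj]
          rw [ih _ _ _ (by omega) ((Multiset.mem_erase_of_ne hj0.ne).2 h0), mul_zero]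
      rw [h1, zero_add]
      refine Finset.sum_eq_zero fun p hp => ?_
      rw [mem_predAntidiagonal] at hp
      have h2 : predOrZero g (fun g' => multisetCatalan g' p.1 (p.2 ::ₘ s)) = 0 := by
        rw [predOrZero]
        split_ifs
        · rfl
        · exact ih _ _ _ (by rw [Multiset.sum_cons]; omega) (Multiset.mem_cons_of_mem h0)
      rw [h2, zero_add]
      refine Finset.sum_eq_zero fun q _ => Multiset.sum_eq_zero fun x hx => ?_
      obtain ⟨r, hr, rfl⟩ := Multiset.mem_map.1 hx
      rw [Multiset.mem_antidiagonal] at hr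
      have hsum : r.1.sum + r.2.sum = s.sum := by rw [← Multiset.sum_add, hr]
      rw [← hr, Multiset.mem_add] at h0
      rcases h0 with h0 | h0
      · rw [ih _ _ _ (by omega) h0, zero_mul]
      · rw [ih _ _ _ (by omega) h0, mul_zero]
  exact key _ g m s (Nat.lt_succ_self _) h0

/-- `pd_symm` for the genus series. Its two conditions at index 0 are the initial values and
`multisetCatalan_of_zero_mem`. -/
theorem multisetCatalan_symm (g m n : ℕ) (s : Multiset ℕ) :
    multisetCatalan g m (n ::ₘ s) = multisetCatalan g n (m ::ₘ s) := by
  have := isCutJoin_catalanSeries.pd_symm pd_genusVar ?_ ?_ m n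
  · have := congrArg (fun f : MultisetSeries (PowerSeries ℤ) => PowerSeries.coeff g (f s)) this
    simpa [MultisetSeries.pd_apply, catalanSeries] using this
  · intro n
    ext1
    funext s
    ext g
    simp [MultisetSeries.pd_apply, catalanSeries, MultisetSeries.zero_apply, multisetCatalan_zero]
  · intro n
    ext1
    funext s
    ext g
    simp [MultisetSeries.pd_apply, catalanSeries, MultisetSeries.zero_apply,
      multisetCatalan_of_zero_mem]

/-! ### From sequences of arguments to multisets -/

section subseq

variable {n : ℕ} {A : Type} (I : Finset (Fin n)) (x : Fin n → A)

theorem univ_map_subseq : Finset.univ.val.map (subseq I x) = I.val.map x := by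
  have h : (Finset.univ : Finset (Fin I.card)).map (I.orderEmbOfFin rfl).toEmbedding = I := by
    ext a
    have := Finset.range_orderEmbOfFin I rfl
    simp only [Finset.mem_map, Finset.mem_univ, true_and]
    rw [← Finset.mem_coe, ← this]
    rfl
  conv_rhs => rw [← h, Finset.map_val, Multiset.map_map]
  rfl

theorem univ_map_cons (a : A) :
    Finset.univ.val.map (Fin.cons a x : Fin (n + 1) → A) = a ::ₘ Finset.univ.val.map x := by
  rw [Fin.univ_succ, Finset.cons_val, Multiset.map_cons, Finset.map_val, Multiset.map_map]
  rfl

theorem compl_singleton_map (μ : Fin n → ℕ) (j : Fin n) :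
    ({j}ᶜ : Finset (Fin n)).val.map μ = (Finset.univ.val.map μ).erase (μ j) := by
  rw [Finset.compl_eq_univ_sdiff, Finset.sdiff_singleton_eq_erase, Finset.erase_val]
  exact Multiset.map_erase_of_mem _ _ (Finset.mem_univ j)

/-- Splittings of a multiset counted with multiplicity correspond to subsets of the labels, even
when `y` repeats values. Induction decides the side of one label at a time. -/
theorem sum_antidiagonal_map {M : Type*} [AddCommMonoid M] {ι : Type*} [DecidableEq ι]
    (y : ι → A) (f : Multiset A → Multiset A → M) (s : Finset ι) :
    ((s.val.map y).antidiagonal.map fun r => f r.1 r.2).sum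
      = ∑ I ∈ s.powerset, f (I.val.map y) ((s \ I).val.map y) := by
  induction s using Finset.induction_on generalizing f with
  | empty => simp
  | insert a s ha ih =>
    have hv : (insert a s).val.map y = y a ::ₘ s.val.map y := by
      rw [Finset.insert_val_of_notMem ha, Multiset.map_cons]
    rw [hv, Multiset.antidiagonal_cons, Multiset.map_add, Multiset.sum_add, Multiset.map_map,
      Multiset.map_map, Finset.sum_powerset_insert ha]
    congr 1
    · refine (ih fun u v => f u (y a ::ₘ v)).trans (Finset.sum_congr rfl fun I hI => ?_)
      have hI := Finset.mem_powerset.1 hI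
      have haI : a ∉ I := fun h => ha (hI h)
      rw [Finset.insert_sdiff_of_notMem _ haI,
        Finset.insert_val_of_notMem (fun h => ha (Finset.mem_sdiff.1 h).1), Multiset.map_cons]
    · refine (ih fun u v => f (y a ::ₘ u) v).trans (Finset.sum_congr rfl fun I hI => ?_)
      have hI := Finset.mem_powerset.1 hI
      have haI : a ∉ I := fun h => ha (hI h)
      rw [Finset.insert_sdiff_insert, Finset.sdiff_insert_of_notMem ha,
        Finset.insert_val_of_notMem haI, Multiset.map_cons]

theorem sum_antidiagonal_univ_map {M : Type*} [AddCommMonoid M]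
    (f : Multiset A → Multiset A → M) :
    ((Finset.univ.val.map x).antidiagonal.map fun r => f r.1 r.2).sum
      = ∑ I : Finset (Fin n), f (Finset.univ.val.map (subseq I x))
          (Finset.univ.val.map (subseq Iᶜ x)) := by
  rw [sum_antidiagonal_map, Finset.powerset_univ]
  refine Finset.sum_congr rfl fun I _ => ?_
  rw [univ_map_subseq, univ_map_subseq, Finset.compl_eq_univ_sdiff]

end subseq

theorem catalanRec_eq_multisetCatalan (g m : ℕ) {n : ℕ} (μ : Fin n → ℕ) :
    catalanRec g m μ = multisetCatalan g m (Finset.univ.val.map μ) := by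
  have key : ∀ N g m, ∀ {n : ℕ} (μ : Fin n → ℕ), m + ∑ i, μ i < N →
      catalanRec g m μ = multisetCatalan g m (Finset.univ.val.map μ) := by
    intro N
    induction N with
    | zero => exact fun g m n μ h => absurd h (Nat.not_lt_zero _)
    | succ N ih =>
      intro g m n μ hN
      rcases m with _ | k
      · rw [multisetCatalan_zero, catalanRec]
        congr 2
        rw [← Multiset.card_eq_zero, Multiset.card_map, Finset.card_val, Finset.card_univ,
          Fintype.card_fin]
      rw [multisetCatalan_succ, catalanRec, Multiset.map_map,
        ← sum_fin_eq_sum_predAntidiagonal k fun a b =>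
          predOrZero g (fun g' => multisetCatalan g' a (b ::ₘ Finset.univ.val.map μ))
          + ∑ q ∈ Finset.HasAntidiagonal.antidiagonal g,
            ((Finset.univ.val.map μ).antidiagonal.map fun r =>
              multisetCatalan q.1 a r.1 * multisetCatalan q.2 b r.2).sum]
      congr 1
      · refine Finset.sum_congr rfl fun j _ => ?_
        have := sum_subseq_compl_singleton j μ
        rw [Function.comp_apply, ih _ _ _ (by omega), univ_map_subseq, compl_singleton_map]
        congr 2
        omega
      · refine Finset.sum_congr rfl fun α _ => ?_
        have hα := α.isLt
        congr 1
        · cases g with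
          | zero => rfl
          | succ g =>
            simp only [predOrZero, Nat.succ_ne_zero, if_false, Nat.add_sub_cancel]
            rw [ih _ _ _ (by rw [Fin.sum_cons]; omega), univ_map_cons]
        · rw [Finset.Nat.sum_antidiagonal_eq_sum_range_succ fun a b =>
            ((Finset.univ.val.map μ).antidiagonal.map fun r =>
              multisetCatalan a α r.1 * multisetCatalan b (k - 1 - α) r.2).sum, Finset.sum_range]
          refine Finset.sum_congr rfl fun h _ => ?_
          rw [sum_antidiagonal_univ_map μ fun u v =>
            multisetCatalan h α u * multisetCatalan (g - h) (k - 1 - α) v]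
          refine Finset.sum_congr rfl fun I _ => ?_
          have h1 := sum_subseq_le I μ
          have h2 := sum_subseq_le Iᶜ μ
          rw [ih _ _ _ (by omega), ih _ _ _ (by omega)]
  exact key _ g m μ (Nat.lt_succ_self _)

theorem catalanRec_succ (g k : ℕ) {n : ℕ} (μ : Fin n → ℕ) :
    catalanRec g (k + 1) μ
      = ∑ j : Fin n, μ j * catalanRec g (k + μ j - 1) (subseq {j}ᶜ μ)
      + ∑ p ∈ predAntidiagonal k,
        (predOrZero g (fun g' => catalanRec g' p.1 (Fin.cons p.2 μ : Fin (n + 1) → ℕ))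
        + ∑ q ∈ Finset.HasAntidiagonal.antidiagonal g, ∑ I : Finset (Fin n),
            catalanRec q.1 p.1 (subseq I μ) * catalanRec q.2 p.2 (subseq Iᶜ μ)) := by
  simp only [catalanRec_eq_multisetCatalan, univ_map_cons]
  rw [multisetCatalan_succ, Multiset.map_map]
  congr 1
  · refine Finset.sum_congr rfl fun j _ => ?_
    rw [Function.comp_apply, univ_map_subseq, compl_singleton_map]
  · refine Finset.sum_congr rfl fun p _ => ?_
    congr 1
    refine Finset.sum_congr rfl fun q _ => ?_
    rw [sum_antidiagonal_univ_map μ fun u v => multisetCatalan q.1 p.1 u * multisetCatalan q.2 p.2 v]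

theorem catalanRec_zero (g : ℕ) {n : ℕ} (μ : Fin n → ℕ) :
    catalanRec g 0 μ = if g = 0 ∧ n = 0 then 1 else 0 := by
  rw [catalanRec]

theorem generalizedCatalan_comp_perm (g : ℕ) {v : ℕ} (μ : Fin v → ℕ) (σ : Equiv.Perm (Fin v)) :
    generalizedCatalan g (μ ∘ σ) = generalizedCatalan g μ := by
  cases v with
  | zero => rfl
  | succ n =>
    simp only [generalizedCatalan, catalanRec_eq_multisetCatalan]
    have h1 : ∀ ν : Fin (n + 1) → ℕ,
        Finset.univ.val.map ν = ν 0 ::ₘ Finset.univ.val.map (Fin.tail ν) := fun ν => by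
      rw [← univ_map_cons, Fin.cons_self_tail]
    have h2 : Finset.univ.val.map (μ ∘ σ) = Finset.univ.val.map μ := by
      rw [← Multiset.map_map]
      congr 1
      exact congrArg Finset.val (Finset.map_univ_equiv σ)
    have h3 : (μ ∘ σ) 0 ::ₘ Finset.univ.val.map (Fin.tail (μ ∘ σ))
        = μ 0 ::ₘ Finset.univ.val.map (Fin.tail μ) := by rw [← h1, ← h1, h2]
    -- Either the first entries agree, or each of them occurs among the other arguments on the
    -- opposite side and the symmetry exchanges them.
    rcases Multiset.cons_eq_cons.1 h3 with ⟨e, e'⟩ | ⟨-, u, hu, hu'⟩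
    · rw [e, e']
    · rw [hu, hu', multisetCatalan_symm]

theorem generalizedCatalan_eq_zero (g : ℕ) {v : ℕ} (hgv : (g, v) ≠ (0, 1)) (μ : Fin v → ℕ)
    (i : Fin v) (hi : μ i = 0) : generalizedCatalan g μ = 0 := by
  cases v with
  | zero => rfl
  | succ n =>
    rw [generalizedCatalan]
    induction i using Fin.cases with
    | zero =>
      rw [hi, catalanRec_zero, if_neg]
      rintro ⟨rfl, rfl⟩
      exact hgv rfl
    | succ i =>
      rw [catalanRec_eq_multisetCatalan]
      exact multisetCatalan_of_zero_mem _ _ _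
        (Multiset.mem_map.2 ⟨i, Finset.mem_univ_val i, hi⟩)

/-! ### Exponential growth with every rate above 2 -/

theorem multisetCatalan_zero_succ (k : ℕ) : multisetCatalan 0 (k + 1) 0
    = ∑ p ∈ predAntidiagonal k, multisetCatalan 0 p.1 0 * multisetCatalan 0 p.2 0 := by
  simp [multisetCatalan_succ, predOrZero]

theorem sum_predAntidiagonal_fst {M : Type*} [AddCommMonoid M] (k : ℕ) (f : ℕ → M) :
    ∑ p ∈ predAntidiagonal k, f p.1 = ∑ i ∈ Finset.range k, f i := by
  rw [← sum_fin_eq_sum_predAntidiagonal k fun a _ => f a, Finset.sum_range]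

/-- The quadratic recursion gives S_{N+1} ≤ 1 + S_N²/4 for the partial sums, and 2 is the fixed
point of this map. -/
theorem sum_catalan_div_two_pow_le (N : ℕ) :
    ∑ m ∈ Finset.range N, (multisetCatalan 0 m 0 : ℝ) / 2 ^ m ≤ 2 := by
  induction N with
  | zero => simp
  | succ N ih =>
    set S := ∑ m ∈ Finset.range N, (multisetCatalan 0 m 0 : ℝ) / 2 ^ m with hS
    have hS0 : 0 ≤ S := Finset.sum_nonneg fun i _ => by positivity
    rw [Finset.sum_range_succ']
    have h1 : ∑ k ∈ Finset.range N, (multisetCatalan 0 (k + 1) 0 : ℝ) / 2 ^ (k + 1)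
        ≤ S * S / 4 := by
      have h2 : ∀ k, (multisetCatalan 0 (k + 1) 0 : ℝ) / 2 ^ (k + 1)
          = ∑ p ∈ predAntidiagonal k, (multisetCatalan 0 p.1 0 : ℝ) / 2 ^ p.1
              * ((multisetCatalan 0 p.2 0 : ℝ) / 2 ^ p.2) / 4 := by
        intro k
        rw [multisetCatalan_zero_succ, Nat.cast_sum, Finset.sum_div]
        refine Finset.sum_congr rfl fun p hp => ?_
        rw [mem_predAntidiagonal] at hp
        rw [← hp, pow_succ, pow_succ, pow_add]
        push_cast
        field_simp
        norm_num
      rw [Finset.sum_congr rfl fun k _ => h2 k, Finset.sum_sigma', hS, Finset.sum_mul_sum,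
        ← Finset.sum_product', Finset.sum_div]
      -- The sets `predAntidiagonal k` for k < N are disjoint and lie in the square [0,N)².
      rw [← Finset.sum_image (s := (Finset.range N).sigma fun k => predAntidiagonal k)
        (g := fun x => x.2) (f := fun p : ℕ × ℕ => (multisetCatalan 0 p.1 0 : ℝ) / 2 ^ p.1
              * ((multisetCatalan 0 p.2 0 : ℝ) / 2 ^ p.2) / 4)]
      · refine Finset.sum_le_sum_of_subset_of_nonneg ?_ fun p _ _ => by positivity
        intro p hp
        obtain ⟨⟨k, q⟩, hx, rfl⟩ := Finset.mem_image.1 hp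
        rw [Finset.mem_sigma, Finset.mem_range, mem_predAntidiagonal] at hx
        rw [Finset.mem_product, Finset.mem_range, Finset.mem_range]
        simp only at *
        omega
      · rintro ⟨k, q⟩ hx ⟨k', q'⟩ hx' e
        rw [Finset.mem_coe, Finset.mem_sigma, mem_predAntidiagonal] at hx hx'
        simp only at *
        obtain rfl := e
        obtain rfl : k = k' := by omega
        rfl
    have h3 : (multisetCatalan 0 0 0 : ℝ) / 2 ^ 0 = 1 := by simp [multisetCatalan_zero]
    rw [h3]
    nlinarith

theorem multisetCatalan_zero_zero_le (m : ℕ) : (multisetCatalan 0 m 0 : ℝ) ≤ 2 * 2 ^ m := by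
  have h := Finset.single_le_sum (f := fun m => (multisetCatalan 0 m 0 : ℝ) / 2 ^ m)
    (fun i _ => by positivity) (Finset.self_mem_range_succ m)
  have := h.trans (sum_catalan_div_two_pow_le (m + 1))
  rwa [div_le_iff₀ (by positivity)] at this

theorem exists_nat_mul_pow_le {r s : ℝ} (hr : 0 ≤ r) (hrs : r < s) :
    ∃ M, 0 ≤ M ∧ ∀ n : ℕ, n * r ^ n ≤ M * s ^ n := by
  have hs : 0 < s := hr.trans_lt hrs
  have h := tendsto_self_mul_const_pow_of_lt_one (div_nonneg hr hs.le) ((div_lt_one hs).2 hrs)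
  obtain ⟨M, hM⟩ := h.bddAbove_range
  have hM' : ∀ n : ℕ, n * (r / s) ^ n ≤ M := fun n => hM ⟨n, rfl⟩
  refine ⟨M, by simpa using hM' 0, fun n => ?_⟩
  have := hM' n
  rw [div_pow, ← mul_div_assoc, div_le_iff₀ (by positivity)] at this
  exact this

theorem catalanRec_subseq_univ (g m : ℕ) {n : ℕ} (μ : Fin n → ℕ) :
    catalanRec g m (subseq Finset.univ μ) = catalanRec g m μ := by
  rw [catalanRec_eq_multisetCatalan, catalanRec_eq_multisetCatalan, univ_map_subseq]

theorem catalanRec_subseq_empty (g m : ℕ) {n : ℕ} (μ : Fin n → ℕ) :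
    catalanRec g m (subseq ∅ μ) = multisetCatalan g m 0 := by
  rw [catalanRec_eq_multisetCatalan, univ_map_subseq]
  rfl

theorem sum_subseq_add_sum_subseq_compl {n : ℕ} (I : Finset (Fin n)) (μ : Fin n → ℕ) :
    ∑ i, subseq I μ i + ∑ i, subseq Iᶜ μ i = ∑ i, μ i := by
  rw [sum_subseq, sum_subseq, Finset.sum_add_sum_compl]

theorem card_predAntidiagonal (k : ℕ) : (predAntidiagonal k).card = k := by
  rw [Finset.card_eq_sum_ones, sum_predAntidiagonal_fst k fun _ => 1]
  simp

/-- The estimate behind the growth bound: the recursion bounds a generalized Catalan number by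
twice the convolution with the Catalan numbers, up to terms of lower complexity. -/
theorem catalanRec_succ_le {g n : ℕ} {L r : ℝ} (hL : 1 ≤ L) (hr : 1 ≤ r)
    (hb : ∀ g' n' : ℕ, g' ≤ g → n' ≤ n + 1 → 2 * g' + n' < 2 * g + n →
      ∀ m (μ : Fin n' → ℕ), (catalanRec g' m μ : ℝ) ≤ L * r ^ (m + ∑ i, μ i))
    (k : ℕ) (μ : Fin n → ℕ) :
    (catalanRec g (k + 1) μ : ℝ) ≤
      (2 * L + (g + 1) * 2 ^ n * L ^ 2) * (((k + 1 + ∑ i, μ i : ℕ) : ℝ) * r ^ (k + 1 + ∑ i, μ i))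
      + 2 * ∑ p ∈ predAntidiagonal k, (multisetCatalan 0 p.1 0 : ℝ) * catalanRec g p.2 μ := by
  set T := k + 1 + ∑ i, μ i with hT
  have hr0 : 0 ≤ r := zero_le_one.trans hr
  have hL0 : 0 ≤ L := zero_le_one.trans hL
  have h1 : ∑ j : Fin n, (μ j : ℝ) * catalanRec g (k + μ j - 1) (subseq {j}ᶜ μ)
      ≤ (∑ j, μ j : ℕ) * (L * r ^ T) := by
    rw [Nat.cast_sum, Finset.sum_mul]
    refine Finset.sum_le_sum fun j _ => mul_le_mul_of_nonneg_left ?_ (Nat.cast_nonneg _)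
    have hj := sum_subseq_compl_singleton j μ
    have hc : ({j}ᶜ : Finset (Fin n)).card = n - 1 := by
      rw [Finset.card_compl, Finset.card_singleton, Fintype.card_fin]
    have hn := j.pos
    refine (hb g _ le_rfl (by omega) (by omega) _ _).trans ?_
    gcongr
    omega
  have h2 : ∀ p ∈ predAntidiagonal k,
      (predOrZero g (fun g' => (catalanRec g' p.1 (Fin.cons p.2 μ : Fin (n + 1) → ℕ) : ℝ)))
      ≤ L * r ^ T := by
    intro p hp
    rw [mem_predAntidiagonal] at hp
    rw [predOrZero]
    split_ifs with hg
    · positivity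
    · refine (hb _ _ (by omega) le_rfl (by omega) _ _).trans ?_
      gcongr
      rw [Fin.sum_cons]
      omega
  have h3 : ∀ p ∈ predAntidiagonal k, ∑ q ∈ Finset.HasAntidiagonal.antidiagonal g,
      ∑ I : Finset (Fin n),
        (catalanRec q.1 p.1 (subseq I μ) : ℝ) * catalanRec q.2 p.2 (subseq Iᶜ μ)
      ≤ (multisetCatalan 0 p.1 0 : ℝ) * catalanRec g p.2 μ
        + catalanRec g p.1 μ * (multisetCatalan 0 p.2 0 : ℝ) + (g + 1) * 2 ^ n * (L ^ 2 * r ^ T) := by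
    intro p hp
    rw [mem_predAntidiagonal] at hp
    -- The splittings (0, ∅) and (g, all) reproduce the pair (g, n) and are kept explicitly. In all
    -- others both factors have smaller 2g' + n', so `hb` bounds them.
    have h4 : ∀ q ∈ Finset.HasAntidiagonal.antidiagonal g, ∀ I : Finset (Fin n),
        (catalanRec q.1 p.1 (subseq I μ) : ℝ) * catalanRec q.2 p.2 (subseq Iᶜ μ)
        ≤ (if q = (0, g) then if I = ∅ then
              (multisetCatalan 0 p.1 0 : ℝ) * catalanRec g p.2 μ else 0 else 0)
          + (if q = (g, 0) then if I = Finset.univ then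
              catalanRec g p.1 μ * (multisetCatalan 0 p.2 0 : ℝ) else 0 else 0)
          + L ^ 2 * r ^ T := by
      intro q hq I
      rw [Finset.HasAntidiagonal.mem_antidiagonal] at hq
      have p1 : (0 : ℝ) ≤ (if q = (0, g) then if I = ∅ then
              (multisetCatalan 0 p.1 0 : ℝ) * catalanRec g p.2 μ else 0 else 0) := by
        split_ifs <;> positivity
      have p2 : (0 : ℝ) ≤ (if q = (g, 0) then if I = Finset.univ then
              catalanRec g p.1 μ * (multisetCatalan 0 p.2 0 : ℝ) else 0 else 0) := by
        split_ifs <;> positivity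
      have p3 : 0 ≤ L ^ 2 * r ^ T := by positivity
      by_cases c1 : q = (0, g) ∧ I = ∅
      · obtain ⟨rfl, rfl⟩ := c1
        rw [if_pos rfl, if_pos rfl, Finset.compl_empty, catalanRec_subseq_univ,
          catalanRec_subseq_empty]
        linarith
      by_cases c2 : q = (g, 0) ∧ I = Finset.univ
      · obtain ⟨rfl, rfl⟩ := c2
        rw [if_pos rfl, if_pos rfl, Finset.compl_univ, catalanRec_subseq_univ,
          catalanRec_subseq_empty]
        linarith
      have hcard : I.card + Iᶜ.card = n := by rw [Finset.card_add_card_compl, Fintype.card_fin]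
      have hI : 2 * q.2 + Iᶜ.card ≠ 0 := by
        intro h
        refine c2 ⟨Prod.ext (by simp only; omega) (by simp only; omega), ?_⟩
        rw [← compl_compl I, Finset.card_eq_zero.1 (show Iᶜ.card = 0 by omega), Finset.compl_empty]
      have hI' : 2 * q.1 + I.card ≠ 0 := by
        intro h
        refine c1 ⟨Prod.ext (by simp only; omega) (by simp only; omega), ?_⟩
        exact Finset.card_eq_zero.1 (by omega)
      have e1 := hb q.1 I.card (by omega) (by omega) (by omega) p.1 (subseq I μ)
      have e2 := hb q.2 Iᶜ.card (by omega) (by omega) (by omega) p.2 (subseq Iᶜ μ)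
      have e3 : (catalanRec q.1 p.1 (subseq I μ) : ℝ) * catalanRec q.2 p.2 (subseq Iᶜ μ)
          ≤ L ^ 2 * r ^ T := by
        refine (mul_le_mul e1 e2 (Nat.cast_nonneg _) (by positivity)).trans ?_
        rw [mul_mul_mul_comm, ← pow_add, ← sq]
        gcongr
        have := sum_subseq_add_sum_subseq_compl I μ
        omega
      linarith
    refine (Finset.sum_le_sum fun q hq => Finset.sum_le_sum fun I _ => h4 q hq I).trans ?_
    have m1 : (0, g) ∈ Finset.HasAntidiagonal.antidiagonal g := by
      rw [Finset.HasAntidiagonal.mem_antidiagonal, zero_add]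
    have m2 : (g, 0) ∈ Finset.HasAntidiagonal.antidiagonal g := by
      rw [Finset.HasAntidiagonal.mem_antidiagonal, add_zero]
    simp only [Finset.sum_add_distrib, Finset.sum_ite_irrel, Finset.sum_const_zero,
      Finset.sum_ite_eq', Finset.mem_univ, if_true, m1, m2, Finset.sum_const,
      Finset.Nat.card_antidiagonal, Finset.card_univ, Fintype.card_finset, Fintype.card_fin,
      nsmul_eq_mul]
    push_cast
    linarith
  rw [catalanRec_succ]
  push_cast
  have h5 : ∀ p : ℕ × ℕ, ((predOrZero g
      (fun g' => catalanRec g' p.1 (Fin.cons p.2 μ : Fin (n + 1) → ℕ)) : ℕ) : ℝ)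
      = predOrZero g (fun g' => (catalanRec g' p.1 (Fin.cons p.2 μ : Fin (n + 1) → ℕ) : ℝ)) := by
    intro p
    rw [predOrZero, predOrZero]
    split_ifs <;> simp
  have h6 := Finset.sum_le_sum fun p hp => add_le_add (h2 p hp) (h3 p hp)
  simp only [Finset.sum_add_distrib, Finset.sum_const, card_predAntidiagonal, nsmul_eq_mul] at h6
  have h7 := sum_predAntidiagonal_swap k fun a b =>
    (multisetCatalan 0 a 0 : ℝ) * catalanRec g b μ
  simp only [mul_comm (multisetCatalan 0 _ 0 : ℝ)] at h6 h7 ⊢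
  simp only [h5, Finset.sum_add_distrib] at h6 ⊢
  rw [h7] at h6
  have hX : 0 ≤ L * r ^ T := by positivity
  have hY : 0 ≤ (g + 1) * 2 ^ n * (L ^ 2 * r ^ T) := by positivity
  have hk : (k : ℝ) ≤ T := by exact_mod_cast (by omega : k ≤ T)
  have hs : ((∑ j, μ j : ℕ) : ℝ) ≤ T := by exact_mod_cast (by omega : ∑ j, μ j ≤ T)
  have z1 := mul_le_mul_of_nonneg_right hk hX
  have z2 := mul_le_mul_of_nonneg_right hs hX
  have z3 := mul_le_mul_of_nonneg_right hk hY
  nlinarith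

/-- Outer induction on 2g + n, inner induction on `m`. By `sum_catalan_div_two_pow_le`, the
convolution in `catalanRec_succ_le` returns at most 4/ρ² < 1 times the bound to be proved, so the
induction closes when B M + 4K/ρ² = K, which determines `K`. The lower terms are bounded with a rate
`r` between 2 and ρ, which leaves room for the factor `T`. -/
theorem exists_catalanRec_le (g n : ℕ) {ρ : ℝ} (hρ : 2 < ρ) :
    ∃ K : ℝ, 0 ≤ K ∧ ∀ m (μ : Fin n → ℕ), (catalanRec g m μ : ℝ) ≤ K * ρ ^ (m + ∑ i, μ i) := by
  have key : ∀ N g n : ℕ, 2 * g + n < N → ∀ ρ : ℝ, 2 < ρ → ∃ K : ℝ, 0 ≤ K ∧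
      ∀ m (μ : Fin n → ℕ), (catalanRec g m μ : ℝ) ≤ K * ρ ^ (m + ∑ i, μ i) := by
    intro N
    induction N with
    | zero => exact fun g n h => absurd h (Nat.not_lt_zero _)
    | succ N ih =>
      intro g n hN ρ hρ
      by_cases h0 : g = 0 ∧ n = 0
      · obtain ⟨rfl, rfl⟩ := h0
        refine ⟨2, zero_le_two, fun m μ => ?_⟩
        rw [catalanRec_eq_multisetCatalan, show (Finset.univ.val.map μ) = 0 from rfl,
          Finset.univ_eq_empty, Finset.sum_empty, add_zero]
        refine (multisetCatalan_zero_zero_le m).trans ?_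
        gcongr
      set r := (2 + ρ) / 2 with hr
      have hr2 : 2 < r := by rw [hr]; linarith
      have hrρ : r < ρ := by rw [hr]; linarith
      obtain ⟨L, hL, hb⟩ : ∃ L : ℝ, 1 ≤ L ∧ ∀ g' n' : ℕ, g' ≤ g → n' ≤ n + 1 →
          2 * g' + n' < 2 * g + n →
          ∀ m (μ : Fin n' → ℕ), (catalanRec g' m μ : ℝ) ≤ L * r ^ (m + ∑ i, μ i) := by
        have : ∀ g' n' : ℕ, ∃ K : ℝ, 0 ≤ K ∧ (2 * g' + n' < 2 * g + n →
          ∀ m (μ : Fin n' → ℕ), (catalanRec g' m μ : ℝ) ≤ K * r ^ (m + ∑ i, μ i)) := by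
          intro g' n'
          by_cases h : 2 * g' + n' < 2 * g + n
          · obtain ⟨K, hK, hK'⟩ := ih g' n' (by omega) r hr2
            exact ⟨K, hK, fun _ => hK'⟩
          · exact ⟨0, le_rfl, fun h' => absurd h' h⟩
        choose K hK hK' using this
        have hs : ∀ g', 0 ≤ ∑ n' ∈ Finset.range (n + 2), K g' n' :=
          fun g' => Finset.sum_nonneg fun n' _ => hK g' n'
        refine ⟨1 + ∑ g' ∈ Finset.range (g + 1), ∑ n' ∈ Finset.range (n + 2), K g' n',
          le_add_of_nonneg_right (Finset.sum_nonneg fun g' _ => hs g'), ?_⟩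
        intro g' n' hg' hn' hlt m μ
        refine (hK' g' n' hlt m μ).trans ?_
        have e1 := Finset.single_le_sum (f := fun n' => K g' n') (fun n' _ => hK g' n')
          (Finset.mem_range.2 (show n' < n + 2 by omega))
        have e2 := Finset.single_le_sum
          (f := fun g' => ∑ n' ∈ Finset.range (n + 2), K g' n') (fun g' _ => hs g')
          (Finset.mem_range.2 (show g' < g + 1 by omega))
        gcongr
        linarith
      obtain ⟨M, hM, hM'⟩ := exists_nat_mul_pow_le (by linarith : 0 ≤ r) hrρ
      set B := 2 * L + (g + 1) * 2 ^ n * L ^ 2 with hB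
      have hB0 : 0 ≤ B := by positivity
      have hρ2 : 4 / ρ ^ 2 < 1 := by
        rw [div_lt_one (by positivity)]
        nlinarith
      refine ⟨B * M / (1 - 4 / ρ ^ 2), div_nonneg (by positivity) (by linarith), ?_⟩
      set K := B * M / (1 - 4 / ρ ^ 2) with hK
      have hK0 : 0 ≤ K := div_nonneg (by positivity) (by linarith)
      have hKB : B * M + K * (4 / ρ ^ 2) = K := by
        have : K * (1 - 4 / ρ ^ 2) = B * M := div_mul_cancel₀ _ (by linarith)
        linarith
      intro m
      induction m using Nat.strong_induction_on with
      | _ m ihm =>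
        intro μ
        rcases m with _ | k
        · rw [catalanRec_zero, if_neg h0, Nat.cast_zero]
          positivity
        refine (catalanRec_succ_le hL (by linarith) hb k μ).trans ?_
        set T := k + 1 + ∑ i, μ i with hT
        have e1 : B * ((T : ℝ) * r ^ T) ≤ B * M * ρ ^ T := by
          rw [mul_assoc]
          exact mul_le_mul_of_nonneg_left (hM' T) hB0
        have e2 : ∑ p ∈ predAntidiagonal k, (multisetCatalan 0 p.1 0 : ℝ) * catalanRec g p.2 μ
            ≤ K * ρ ^ T / ρ ^ 2 * 2 := by
          calc _ ≤ ∑ p ∈ predAntidiagonal k, K * ρ ^ T / ρ ^ 2 *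
                  ((multisetCatalan 0 p.1 0 : ℝ) / 2 ^ p.1) := by
                refine Finset.sum_le_sum fun p hp => ?_
                rw [mem_predAntidiagonal] at hp
                have h1 := ihm p.2 (by omega) μ
                have h2 : ρ ^ T / ρ ^ 2 = ρ ^ (p.2 + ∑ i, μ i) * ρ ^ p.1 := by
                  rw [div_eq_iff (by positivity), ← pow_add, ← pow_add]
                  congr 1
                  omega
                have h3 : (2 : ℝ) ^ p.1 ≤ ρ ^ p.1 := by gcongr
                calc _ ≤ (multisetCatalan 0 p.1 0 : ℝ) * (K * ρ ^ (p.2 + ∑ i, μ i)) := by gcongr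
                  _ = K * ρ ^ (p.2 + ∑ i, μ i) * 2 ^ p.1 *
                      ((multisetCatalan 0 p.1 0 : ℝ) / 2 ^ p.1) := by field_simp
                  _ ≤ K * ρ ^ (p.2 + ∑ i, μ i) * ρ ^ p.1 *
                      ((multisetCatalan 0 p.1 0 : ℝ) / 2 ^ p.1) := by gcongr
                  _ = _ := by rw [mul_div_assoc K, h2]; ring
            _ ≤ _ := by
                rw [← Finset.mul_sum, sum_predAntidiagonal_fst k fun i =>
                  (multisetCatalan 0 i 0 : ℝ) / 2 ^ i]
                exact mul_le_mul_of_nonneg_left (sum_catalan_div_two_pow_le k) (by positivity)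
        calc _ ≤ B * M * ρ ^ T + 2 * (K * ρ ^ T / ρ ^ 2 * 2) := by gcongr
          _ = (B * M + K * (4 / ρ ^ 2)) * ρ ^ T := by ring
          _ = _ := by rw [hKB]
  exact key _ g n (Nat.lt_succ_self _) ρ hρ

/-! ### Power series in several variables on the polydisc of radius 1/2 -/

theorem summable_norm_prod_pi {𝕜 : Type*} [NormedField 𝕜] {β : Type*} {n : ℕ} {f : Fin n → β → 𝕜} (hf : ∀ i, Summable fun b => ‖f i b‖) :
    Summable fun x : Fin n → β => ‖∏ i, f i (x i)‖ := by
  induction n with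
  | zero => exact (hasSum_unique _).summable
  | succ n ih =>
    rw [← (Fin.consEquiv fun _ => β).summable_iff]
    have := (hf 0).mul_norm (ih fun i => hf i.succ)
    refine this.congr fun p => ?_
    simp [Fin.consEquiv, Fin.prod_univ_succ]

theorem tsum_prod_pi {𝕜 : Type*} [NormedField 𝕜] [CompleteSpace 𝕜] {β : Type*} {n : ℕ} {f : Fin n → β → 𝕜} (hf : ∀ i, Summable fun b => ‖f i b‖) :
    ∑' x : Fin n → β, ∏ i, f i (x i) = ∏ i, ∑' b, f i b := by
  induction n with
  | zero => simp
  | succ n ih =>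
    rw [← (Fin.consEquiv fun _ => β).tsum_eq, Fin.prod_univ_succ, ← ih fun i => hf i.succ,
      tsum_mul_tsum_of_summable_norm (hf 0) (summable_norm_prod_pi fun i => hf i.succ)]
    refine tsum_congr fun p => ?_
    simp [Fin.consEquiv, Fin.prod_univ_succ]

/-- Coefficient families of power series converging on the polydisc of radius `1 / 2`. -/
def HasGrowth {n : ℕ} (φ : (Fin n → ℕ) → ℂ) : Prop :=
  ∀ ρ : ℝ, 2 < ρ → ∃ K : ℝ, 0 ≤ K ∧ ∀ μ, ‖φ μ‖ ≤ K * ρ ^ (∑ i, μ i)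

/-- The sum of the power series with coefficients `φ`. -/
noncomputable def mps {n : ℕ} (φ : (Fin n → ℕ) → ℂ) (a : Fin n → ℂ) : ℂ :=
  ∑' μ : Fin n → ℕ, φ μ * ∏ i, a i ^ μ i

/-- The coefficients of the `i`-th partial derivative. -/
noncomputable def pderivCoeff {n : ℕ} (i : Fin n) (φ : (Fin n → ℕ) → ℂ) (μ : Fin n → ℕ) : ℂ :=
  (μ i + 1) * φ (μ + Pi.single i 1)

section mps

variable {n : ℕ} {φ : (Fin n → ℕ) → ℂ} {a : Fin n → ℂ}

theorem sum_add_single (μ : Fin n → ℕ) (i : Fin n) :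
    ∑ j, (μ + Pi.single i 1 : Fin n → ℕ) j = ∑ j, μ j + 1 := by
  simp [Finset.sum_add_distrib]

theorem HasGrowth.pderiv (hφ : HasGrowth φ) (i : Fin n) : HasGrowth (pderivCoeff i φ) := by
  intro ρ hρ
  obtain ⟨K, hK, hK'⟩ := hφ ((2 + ρ) / 2) (by linarith)
  obtain ⟨M, hM, hM'⟩ := exists_nat_mul_pow_le (r := (2 + ρ) / 2) (s := ρ) (by linarith)
    (by linarith)
  refine ⟨K * M * ρ, by positivity, fun μ => ?_⟩
  have h1 := hK' (μ + Pi.single i 1)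
  have h2 := hM' (∑ j, μ j + 1)
  rw [sum_add_single] at h1
  have h3 : ‖((μ i : ℂ) + 1)‖ ≤ ((∑ j, μ j + 1 : ℕ) : ℝ) := by
    rw [← Nat.cast_succ, Complex.norm_natCast]
    exact_mod_cast Nat.succ_le_succ (Finset.single_le_sum (fun j _ => Nat.zero_le _)
      (Finset.mem_univ i))
  rw [pderivCoeff, norm_mul]
  calc _ ≤ ((∑ j, μ j + 1 : ℕ) : ℝ) * (K * ((2 + ρ) / 2) ^ (∑ j, μ j + 1)) := by gcongr
    _ = K * (((∑ j, μ j + 1 : ℕ) : ℝ) * ((2 + ρ) / 2) ^ (∑ j, μ j + 1)) := by ring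
    _ ≤ K * (M * ρ ^ (∑ j, μ j + 1)) := by gcongr
    _ = _ := by ring

theorem exists_ratio {r : ℝ} (hr : r < 1 / 2) : ∃ ρ : ℝ, 2 < ρ ∧ ρ * r < 1 :=
  -- The inequality (3 - 2r) r < 1 says (1 - 2r)(1 - r) > 0.
  ⟨3 - 2 * r, by linarith, by nlinarith⟩

theorem prod_norm_pow_le {r : ℝ} (ha : ‖a‖ ≤ r) (μ : Fin n → ℕ) :
    ‖∏ i, a i ^ μ i‖ ≤ r ^ (∑ i, μ i) := by
  rw [norm_prod, ← Finset.prod_pow_eq_pow_sum]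
  refine Finset.prod_le_prod (fun i _ => norm_nonneg _) fun i _ => ?_
  rw [norm_pow]
  exact pow_le_pow_left₀ (norm_nonneg _) ((norm_le_pi_norm a i).trans ha) _

theorem summable_pow_sum {q : ℝ} (hq0 : 0 ≤ q) (hq : q < 1) :
    Summable fun μ : Fin n → ℕ => q ^ (∑ i, μ i) := by
  have := summable_norm_prod_pi (𝕜 := ℝ) (n := n) (f := fun _ k => q ^ k) fun i => by
    simpa [abs_of_nonneg hq0] using summable_geometric_of_lt_one hq0 hq
  refine this.congr fun μ => ?_
  rw [Finset.prod_pow_eq_pow_sum, Real.norm_of_nonneg (by positivity)]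

theorem HasGrowth.summable (hφ : HasGrowth φ) (ha : ‖a‖ < 1 / 2) :
    Summable fun μ : Fin n → ℕ => ‖φ μ * ∏ i, a i ^ μ i‖ := by
  obtain ⟨ρ, hρ, hρa⟩ := exists_ratio ha
  obtain ⟨K, hK, hK'⟩ := hφ ρ hρ
  refine Summable.of_nonneg_of_le (fun _ => norm_nonneg _) (fun μ => ?_)
    ((summable_pow_sum (by positivity) hρa).mul_left K)
  rw [norm_mul, mul_pow, ← mul_assoc]
  exact mul_le_mul (hK' μ) (prod_norm_pow_le le_rfl μ) (norm_nonneg _) (by positivity)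

/-- The derivative of a monomial. -/
noncomputable def monomialFDeriv (μ : Fin n → ℕ) (a : Fin n → ℂ) : (Fin n → ℂ) →L[ℂ] ℂ :=
  ∑ i, ((∏ j ∈ Finset.univ.erase i, a j ^ μ j) * (μ i * a i ^ (μ i - 1))) •
    ContinuousLinearMap.proj (R := ℂ) (φ := fun _ : Fin n => ℂ) i

theorem hasFDerivAt_monomial (μ : Fin n → ℕ) (a : Fin n → ℂ) :
    HasFDerivAt (fun a : Fin n → ℂ => ∏ i, a i ^ μ i) (monomialFDeriv μ a) a := by
  have := HasFDerivAt.finsetProd (u := Finset.univ) (x := a)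
    (g := fun (i : Fin n) (a : Fin n → ℂ) => a i ^ μ i) fun i _ =>
    ((ContinuousLinearMap.proj (R := ℂ) (φ := fun _ : Fin n => ℂ) i).hasFDerivAt (x := a)).pow (μ i)
  refine this.congr_fderiv ?_
  refine Finset.sum_congr rfl fun i _ => ?_
  rw [mul_smul]
  congr 1
  ext
  simp

theorem norm_monomialFDeriv_le {r : ℝ} (hr : 0 < r) (ha : ‖a‖ ≤ r) (μ : Fin n → ℕ) :
    ‖monomialFDeriv μ a‖ ≤ (∑ i, μ i : ℕ) * r ^ (∑ i, μ i) / r := by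
  have hr' : ∀ i, ‖a i‖ ≤ r := fun i => (norm_le_pi_norm a i).trans ha
  rw [Nat.cast_sum, Finset.sum_mul, Finset.sum_div]
  refine (norm_sum_le _ _).trans (Finset.sum_le_sum fun i _ => ?_)
  rw [norm_smul]
  have hp : ‖ContinuousLinearMap.proj (R := ℂ) (φ := fun _ : Fin n => ℂ) i‖ ≤ 1 :=
    ContinuousLinearMap.opNorm_le_bound _ zero_le_one fun x => by
      rw [one_mul]
      exact norm_le_pi_norm x i
  have h1 : ‖∏ j ∈ Finset.univ.erase i, a j ^ μ j‖ ≤ ∏ j ∈ Finset.univ.erase i, r ^ μ j := by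
    rw [norm_prod]
    refine Finset.prod_le_prod (fun i _ => norm_nonneg _) fun i _ => ?_
    rw [norm_pow]
    exact pow_le_pow_left₀ (norm_nonneg _) (hr' i) _
  have h2 : ‖(μ i : ℂ) * a i ^ (μ i - 1)‖ ≤ μ i * r ^ μ i / r := by
    rw [norm_mul, Complex.norm_natCast, norm_pow]
    rcases Nat.eq_zero_or_pos (μ i) with h | h
    · simp [h]
    · rw [mul_div_assoc, show r ^ μ i / r = r ^ (μ i - 1) by
        rw [div_eq_iff hr.ne', ← pow_succ, Nat.sub_add_cancel h]]
      exact mul_le_mul_of_nonneg_left (pow_le_pow_left₀ (norm_nonneg _) (hr' i) _)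
        (Nat.cast_nonneg _)
  calc _ ≤ (∏ j ∈ Finset.univ.erase i, r ^ μ j) * (μ i * r ^ μ i / r) * 1 := by
        rw [norm_mul]
        gcongr
    _ = _ := by
        rw [← Finset.prod_pow_eq_pow_sum, ← Finset.mul_prod_erase _ _ (Finset.mem_univ i)]
        ring

/-- Termwise differentiation on the ball of a radius `r` strictly between ‖a‖ and 1/2. The linear
factor from differentiating is absorbed by enlarging the ratio ρr to (ρr + 1)/2 < 1. -/
theorem HasGrowth.hasFDerivAt (hφ : HasGrowth φ) (ha : ‖a‖ < 1 / 2) :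
    Summable (fun μ => φ μ • monomialFDeriv μ a) ∧
    HasFDerivAt (mps φ) (∑' μ, φ μ • monomialFDeriv μ a) a := by
  set r := (‖a‖ + 1 / 2) / 2 with hr
  have hr0 : 0 < r := by have := norm_nonneg a; linarith
  have hr2 : r < 1 / 2 := by linarith
  obtain ⟨ρ, hρ, hρr⟩ := exists_ratio hr2
  obtain ⟨K, hK, hK'⟩ := hφ ρ hρ
  obtain ⟨M, hM, hM'⟩ := exists_nat_mul_pow_le (r := ρ * r) (s := (ρ * r + 1) / 2) (by positivity)
    (by linarith)
  have hu : Summable fun μ : Fin n → ℕ => K * M / r * ((ρ * r + 1) / 2) ^ (∑ i, μ i) :=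
    (summable_pow_sum (by positivity) (by linarith)).mul_left _
  have hbd : ∀ (μ : Fin n → ℕ) (x : Fin n → ℂ), x ∈ Metric.ball (0 : Fin n → ℂ) r →
      ‖φ μ • monomialFDeriv μ x‖ ≤ K * M / r * ((ρ * r + 1) / 2) ^ (∑ i, μ i) := by
    intro μ x hx
    rw [mem_ball_zero_iff] at hx
    rw [norm_smul]
    calc _ ≤ K * ρ ^ (∑ i, μ i) * ((∑ i, μ i : ℕ) * r ^ (∑ i, μ i) / r) :=
          mul_le_mul (hK' μ) (norm_monomialFDeriv_le hr0 hx.le μ) (norm_nonneg _) (by positivity)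
      _ = K / r * ((∑ i, μ i : ℕ) * (ρ * r) ^ (∑ i, μ i)) := by rw [mul_pow]; ring
      _ ≤ K / r * (M * ((ρ * r + 1) / 2) ^ (∑ i, μ i)) := mul_le_mul_of_nonneg_left (hM' _) (by positivity)
      _ = _ := by ring
  have har : a ∈ Metric.ball (0 : Fin n → ℂ) r := by
    rw [mem_ball_zero_iff]
    linarith
  refine ⟨Summable.of_norm_bounded hu fun μ => hbd μ a har, ?_⟩
  exact hasFDerivAt_tsum_of_isPreconnected hu Metric.isOpen_ball
    (convex_ball _ _).isPreconnected
    (fun μ x _ => (hasFDerivAt_monomial μ x).const_mul (φ μ)) hbd har (hφ.summable ha).of_norm har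

theorem HasGrowth.hasDerivAt_update (hφ : HasGrowth φ) (ha : ‖a‖ < 1 / 2) (i : Fin n) :
    HasDerivAt (fun s => mps φ (Function.update a i s)) (mps (pderivCoeff i φ) a) (a i) := by
  obtain ⟨hs, hd⟩ := hφ.hasFDerivAt ha
  have h1 : HasFDerivAt (mps φ) (∑' μ, φ μ • monomialFDeriv μ a) (Function.update a i (a i)) := by
    rwa [Function.update_eq_self]
  refine (h1.comp_hasDerivAt (a i) (_root_.hasDerivAt_update a i (a i))).congr_deriv ?_
  have h2 : (∑' μ, φ μ • monomialFDeriv μ a) (Pi.single i 1)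
      = ∑' μ, φ μ * ((∏ j ∈ Finset.univ.erase i, a j ^ μ j) * (μ i * a i ^ (μ i - 1))) := by
    refine (ContinuousLinearMap.map_tsum
      (ContinuousLinearMap.apply ℂ ℂ (Pi.single i 1 : Fin n → ℂ)) hs).trans
      (tsum_congr fun μ => ?_)
    simp [monomialFDeriv, Pi.single_apply]
  rw [h2, mps]
  -- Reindexing by μ ↦ μ + e_i loses only monomials with `μ i = 0`, whose derivative vanishes.
  have hinj : Function.Injective fun μ : Fin n → ℕ => μ + Pi.single i 1 :=
    add_left_injective _
  rw [← hinj.tsum_eq]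
  · refine tsum_congr fun μ => ?_
    have h3 : ∏ j ∈ Finset.univ.erase i, a j ^ (μ + Pi.single i 1 : Fin n → ℕ) j
        = ∏ j ∈ Finset.univ.erase i, a j ^ μ j := Finset.prod_congr rfl fun j hj => by
      rw [Pi.add_apply, Pi.single_eq_of_ne (Finset.ne_of_mem_erase hj), add_zero]
    rw [h3, pderivCoeff, ← Finset.mul_prod_erase _ _ (Finset.mem_univ i)]
    simp only [Pi.add_apply, Pi.single_eq_same, Nat.add_sub_cancel]
    push_cast
    ring
  · intro μ hμ
    have : μ i ≠ 0 := fun h => hμ (by simp [h])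
    refine ⟨μ - Pi.single i 1, ?_⟩
    ext j
    rcases eq_or_ne j i with rfl | hj
    · simp only [Pi.add_apply, Pi.sub_apply, Pi.single_eq_same]
      omega
    · simp [Pi.single_eq_of_ne hj]

theorem HasGrowth.mul_norm_le {ψ : (Fin n → ℕ) → ℂ} (hφ : HasGrowth φ) (h : ∀ μ, ‖ψ μ‖ ≤ ‖φ μ‖) :
    HasGrowth ψ := fun ρ hρ => by
  obtain ⟨K, hK, hK'⟩ := hφ ρ hρ
  exact ⟨K, hK, fun μ => (h μ).trans (hK' μ)⟩

end mps

/-! ### The Laplace transform as a power series in c/(x - b) -/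

/-- The coefficient of `∏ i, (c / (x i - b)) ^ μ i` in the discrete Laplace transform. -/
noncomputable def laplaceCoeff (g : ℕ) {v : ℕ} (μ : Fin v → ℕ) : ℂ :=
  (generalizedCatalan g μ : ℂ) / ∏ i, (μ i : ℂ)

theorem hasGrowth_generalizedCatalan (g v : ℕ) :
    HasGrowth fun μ : Fin v → ℕ => (generalizedCatalan g μ : ℂ) := by
  intro ρ hρ
  cases v with
  | zero => exact ⟨0, le_rfl, fun μ => by simp [generalizedCatalan]⟩
  | succ n =>
    obtain ⟨K, hK, hK'⟩ := exists_catalanRec_le g n hρ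
    refine ⟨K, hK, fun μ => ?_⟩
    rw [Complex.norm_natCast, Fin.sum_univ_succ]
    exact hK' _ _

theorem norm_div_prod_natCast_le {v : ℕ} (z : ℂ) (μ : Fin v → ℕ) : ‖z / ∏ i, (μ i : ℂ)‖ ≤ ‖z‖ := by
  rw [norm_div, norm_prod]
  rcases eq_or_ne (∏ i, ‖(μ i : ℂ)‖) 0 with h | h
  · rw [h, div_zero]
    exact norm_nonneg z
  · refine div_le_self (norm_nonneg z) ?_
    simp only [Complex.norm_natCast] at *
    rw [← Nat.cast_prod] at *
    exact_mod_cast Nat.one_le_iff_ne_zero.2 (by exact_mod_cast h)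

theorem hasGrowth_laplaceCoeff (g v : ℕ) : HasGrowth (laplaceCoeff g : (Fin v → ℕ) → ℂ) :=
  (hasGrowth_generalizedCatalan g v).mul_norm_le fun μ => norm_div_prod_natCast_le _ μ

/-- One factor of the double series of the discrete Laplace transform. -/
noncomputable def binomialWeight (b c : ℝ) (x : ℂ) (n m : ℕ) : ℂ :=
  n.choose m * (b : ℂ) ^ (n - m) * (c : ℂ) ^ m / n * (x ^ n)⁻¹

/-- By the binomial theorem the sum over `z.2` is ((p + q)/r)^n, a geometric sequence in n = `z.1`.
-/
theorem summable_choose_mul {p q r : ℝ} (hp : 0 ≤ p) (hq : 0 ≤ q) (hr : p + q < r) :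
    Summable fun z : ℕ × ℕ => (z.1.choose z.2 : ℝ) * p ^ (z.1 - z.2) * q ^ z.2 / r ^ z.1 := by
  have hr0 : 0 < r := by linarith
  have hsum : ∀ n : ℕ, HasSum (fun m : ℕ => (n.choose m : ℝ) * p ^ (n - m) * q ^ m / r ^ n)
      (((p + q) / r) ^ n) := by
    intro n
    rw [div_pow, add_comm, add_pow, Finset.sum_div]
    have := hasSum_sum_of_ne_finset_zero (L := SummationFilter.unconditional ℕ)
      (s := Finset.range (n + 1))
      (f := fun m : ℕ => (n.choose m : ℝ) * p ^ (n - m) * q ^ m / r ^ n) fun m hm => by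
        rw [Finset.mem_range, not_lt] at hm
        simp [Nat.choose_eq_zero_of_lt (show n < m by omega)]
    convert this using 2
    ring
  rw [summable_prod_of_nonneg fun z => by simp only [Pi.zero_apply]; positivity]
  refine ⟨fun n => (hsum n).summable, ?_⟩
  simp only [fun n => (hsum n).tsum_eq]
  exact summable_geometric_of_lt_one (by positivity) ((div_lt_one hr0).2 hr)

theorem norm_binomialWeight_le {b c : ℝ} (hb : 0 ≤ b) (hc : 0 < c) (x : ℂ) (n : ℕ+) (m : ℕ) :
    ‖binomialWeight b c x n m‖
      ≤ ((n : ℕ).choose m : ℝ) * b ^ ((n : ℕ) - m) * c ^ m / ‖x‖ ^ (n : ℕ) := by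
  rw [binomialWeight, norm_mul, norm_div, norm_mul, norm_mul, norm_inv, norm_pow, norm_pow, norm_pow,
    Complex.norm_natCast, Complex.norm_natCast, Complex.norm_real, Complex.norm_real,
    Real.norm_of_nonneg hb, Real.norm_of_nonneg hc.le, div_eq_mul_inv _ (‖x‖ ^ (n : ℕ))]
  refine mul_le_mul_of_nonneg_right (div_le_self (by positivity) ?_) (by positivity)
  exact_mod_cast n.pos

variable {b c : ℝ}

theorem summable_binomialWeight_of_pos (hb : 0 ≤ b) (hc : 0 < c) {x : ℂ} (hx : b + 2 * c < ‖x‖)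
    (m : ℕ) : Summable fun n : ℕ+ => ‖binomialWeight b c x n m‖ := by
  have h := summable_choose_mul hb hc.le (show b + c < ‖x‖ by linarith)
  have h2 := h.comp_injective (i := fun n : ℕ+ => ((n : ℕ), m)) fun n n' e => by
    simpa using e
  exact Summable.of_nonneg_of_le (fun _ => norm_nonneg _)
    (fun n => norm_binomialWeight_le hb hc x n m) h2

theorem tsum_binomialWeight_eq (x : ℂ) (m : ℕ) :
    ∑' n : ℕ+, binomialWeight b c x n m = ∑' n : ℕ, binomialWeight b c x n m := by
  refine PNat.coe_injective.tsum_eq (f := fun n : ℕ => binomialWeight b c x n m) fun n hn => ?_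
  -- Division by n = 0 gives 0, so the term n = 0 can be added freely.
  have : n ≠ 0 := fun h => hn (by simp [binomialWeight, h])
  exact ⟨⟨n, Nat.pos_of_ne_zero this⟩, rfl⟩

/-- The logarithm series in b/x. It matters only for (g,v) = (0,1), since otherwise the Catalan
number vanishes as soon as some μ_i = 0. -/
theorem tsum_binomialWeight_zero (hb : 0 ≤ b) (hc : 0 < c) {x : ℂ} (hx : b + 2 * c < ‖x‖) :
    ∑' n : ℕ+, binomialWeight b c x n 0 = -Complex.log (1 - b / x) := by
  have hx0 : x ≠ 0 := fun h => by simp [h] at hx; linarith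
  have h1 : ‖(b : ℂ) / x‖ < 1 := by
    rw [norm_div, Complex.norm_real, Real.norm_of_nonneg hb, div_lt_one (norm_pos_iff.2 hx0)]
    linarith
  have := Complex.hasSum_taylorSeries_neg_log h1
  rw [← this.tsum_eq, tsum_binomialWeight_eq]
  refine tsum_congr fun n => ?_
  rw [binomialWeight, div_pow]
  simp
  ring

/-- Since binom(n,m)/n = binom(n-1,m-1)/m, this is a negative binomial series in b/x. -/
theorem tsum_binomialWeight_pos (hb : 0 ≤ b) (hc : 0 < c) {x : ℂ} (hx : b + 2 * c < ‖x‖) {m : ℕ}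
    (hm : 0 < m) : ∑' n : ℕ+, binomialWeight b c x n m = (c / (x - b)) ^ m / m := by
  obtain ⟨p, rfl⟩ : ∃ p, m = p + 1 := ⟨m - 1, by omega⟩
  have hx0 : x ≠ 0 := fun h => by simp [h] at hx; linarith
  have h1 : ‖(b : ℂ) / x‖ < 1 := by
    rw [norm_div, Complex.norm_real, Real.norm_of_nonneg hb, div_lt_one (norm_pos_iff.2 hx0)]
    linarith
  have hxb : x - b ≠ 0 := fun h => by
    rw [sub_eq_zero.1 h, div_self (sub_eq_zero.1 h ▸ hx0), norm_one] at h1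
    exact lt_irrefl _ h1
  have hinj : Function.Injective fun k : ℕ => k + (p + 1) := add_left_injective _
  rw [tsum_binomialWeight_eq, ← hinj.tsum_eq]
  · have h2 := (hasSum_choose_mul_geometric_of_norm_lt_one p h1).mul_left
      ((c / x : ℂ) ^ (p + 1) / (p + 1))
    have h3 : ∀ k : ℕ, binomialWeight b c x (k + (p + 1)) (p + 1)
        = (c / x : ℂ) ^ (p + 1) / (p + 1) * (((k + p).choose p : ℂ) * (b / x) ^ k) := by
      intro k
      have h4 : ((k + p : ℕ) + 1 : ℂ) * ((k + p).choose p : ℂ)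
          = ((k + (p + 1)).choose (p + 1) : ℂ) * (p + 1) := by
        exact_mod_cast Nat.add_one_mul_choose_eq (k + p) p
      have h5 : ((p : ℂ) + 1) ≠ 0 := by exact_mod_cast Nat.succ_ne_zero p
      have h6 : ((k : ℂ) + (p + 1)) ≠ 0 := by exact_mod_cast Nat.succ_ne_zero (k + p)
      rw [binomialWeight, Nat.add_sub_cancel, eq_div_of_mul_eq h5 h4.symm]
      push_cast
      rw [div_pow, div_pow, pow_add x k]
      field_simp
      ring
    rw [tsum_congr h3, h2.tsum_eq]
    push_cast
    have : (1 - b / x : ℂ) = (x - b) / x := by field_simp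
    rw [this, div_pow, div_pow, div_pow]
    field_simp
  · intro n hn
    have : p + 1 ≤ n := not_lt.1 fun h => hn (by
      simp [binomialWeight, Nat.choose_eq_zero_of_lt h])
    exact ⟨n - (p + 1), Nat.sub_add_cancel this⟩

theorem laplaceTerm_hasSum (g : ℕ) {v : ℕ} (x : Fin v → ℂ) (n : Fin v → ℕ+) :
    HasSum (fun μ : Fin v → ℕ => (generalizedCatalan g μ : ℂ)
      * ∏ i, binomialWeight b c (x i) (n i) (μ i)) (laplaceTerm b c g x n) := by
  have h0 : ∀ μ ∉ Fintype.piFinset (fun i => Finset.range ((n i : ℕ) + 1)),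
      (generalizedCatalan g μ : ℂ) * ∏ i, binomialWeight b c (x i) (n i) (μ i) = 0 := by
    intro μ hμ
    rw [Fintype.mem_piFinset, not_forall] at hμ
    obtain ⟨i, hi⟩ := hμ
    rw [Finset.mem_range, not_lt] at hi
    rw [Finset.prod_eq_zero (Finset.mem_univ i), mul_zero]
    simp [binomialWeight, Nat.choose_eq_zero_of_lt (show (n i : ℕ) < μ i by omega)]
  convert hasSum_sum_of_ne_finset_zero (L := SummationFilter.unconditional _) h0 using 1
  rw [laplaceTerm, bcMotzkin, Complex.ofReal_sum, Finset.sum_div, Finset.sum_mul]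
  refine Finset.sum_congr rfl fun μ hμ => ?_
  rw [Fintype.mem_piFinset] at hμ
  have hle : ∀ i, μ i ≤ n i := fun i => Nat.lt_succ_iff.1 (Finset.mem_range.1 (hμ i))
  have hsub : ∑ i, (n i : ℕ) - ∑ i, μ i = ∑ i, ((n i : ℕ) - μ i) :=
    (Finset.sum_tsub_distrib _ fun i _ => hle i).symm
  rw [hsub, ← Finset.prod_pow_eq_pow_sum, ← Finset.prod_pow_eq_pow_sum]
  simp only [binomialWeight, Finset.prod_mul_distrib, Finset.prod_div_distrib]
  push_cast
  ring

/-- A growth rate ρ slightly above 2 still satisfies b + cρ < ‖x_i‖. The Catalan numbers then cost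
no more than replacing c by cρ in the binomial weights, and the majorant is a product of
one-variable series. -/
theorem summable_norm_laplace_double (hb : 0 ≤ b) (hc : 0 < c) (g : ℕ) {v : ℕ} {x : Fin v → ℂ}
    (hx : ∀ i, b + 2 * c < ‖x i‖) :
    Summable fun z : (Fin v → ℕ+) × (Fin v → ℕ) => ‖(generalizedCatalan g z.2 : ℂ)
      * ∏ i, binomialWeight b c (x i) (z.1 i) (z.2 i)‖ := by
  obtain ⟨ρ, hρ, hρx⟩ : ∃ ρ : ℝ, 2 < ρ ∧ ∀ i, b + c * ρ < ‖x i‖ := by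
    have h1 : ∀ i, ∀ᶠ ρ : ℝ in nhdsWithin 2 (Set.Ioi 2), b + c * ρ < ‖x i‖ := by
      intro i
      have : Filter.Tendsto (fun ρ : ℝ => b + c * ρ) (nhds 2) (nhds (b + c * 2)) :=
        Continuous.tendsto (by fun_prop) 2
      exact (this.mono_left nhdsWithin_le_nhds).eventually_lt_const (by linarith [hx i])
    obtain ⟨ρ, h, h'⟩ := ((Filter.eventually_all.2 h1).and self_mem_nhdsWithin).exists
    exact ⟨ρ, h', h⟩
  obtain ⟨K, hK, hK'⟩ := hasGrowth_generalizedCatalan g v ρ hρ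
  rw [← (Equiv.arrowProdEquivProdArrow (Fin v) (fun _ => ℕ+) fun _ => ℕ).summable_iff]
  have h2 := summable_norm_prod_pi (𝕜 := ℝ) (β := ℕ+ × ℕ) (n := v) (f := fun i z =>
    ((z.1 : ℕ).choose z.2 : ℝ) * b ^ ((z.1 : ℕ) - z.2) * (c * ρ) ^ z.2 / ‖x i‖ ^ (z.1 : ℕ)) fun i =>
      ((summable_choose_mul hb (by positivity) (hρx i)).comp_injective
        (i := fun z : ℕ+ × ℕ => ((z.1 : ℕ), z.2)) fun z z' e => by
          simp only [Prod.mk.injEq, PNat.coe_inj] at e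
          exact Prod.ext e.1 e.2).norm
  refine Summable.of_nonneg_of_le (fun _ => norm_nonneg _) (fun z => ?_) (h2.mul_left K)
  simp only [Function.comp_apply, Equiv.arrowProdEquivProdArrow, Equiv.coe_fn_mk]
  rw [norm_mul, norm_prod, norm_prod]
  have h3 : ∀ i, ‖binomialWeight b c (x i) (z i).1 (z i).2‖ * ρ ^ (z i).2
      ≤ ‖(((z i).1 : ℕ).choose (z i).2 : ℝ) * b ^ (((z i).1 : ℕ) - (z i).2) * (c * ρ) ^ (z i).2
        / ‖x i‖ ^ ((z i).1 : ℕ)‖ := by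
    intro i
    have := mul_le_mul_of_nonneg_right (norm_binomialWeight_le hb hc (x i) (z i).1 (z i).2)
      (show 0 ≤ ρ ^ (z i).2 by positivity)
    refine this.trans (le_trans (le_of_eq ?_) (Real.le_norm_self _))
    rw [mul_pow]
    ring
  calc _ ≤ K * ρ ^ (∑ i, (z i).2) * ∏ i, ‖binomialWeight b c (x i) (z i).1 (z i).2‖ :=
        mul_le_mul_of_nonneg_right (hK' _) (Finset.prod_nonneg fun i _ => norm_nonneg _)
    _ = K * ∏ i, (‖binomialWeight b c (x i) (z i).1 (z i).2‖ * ρ ^ (z i).2) := by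
        rw [Finset.prod_mul_distrib, Finset.prod_pow_eq_pow_sum]
        ring
    _ ≤ _ := by
        refine mul_le_mul_of_nonneg_left (Finset.prod_le_prod (fun i _ => ?_) fun i _ => h3 i) hK
        have : 0 ≤ ρ := by linarith
        positivity

theorem summable_laplaceTerm (hb : 0 ≤ b) (hc : 0 < c) (g : ℕ) {v : ℕ} {x : Fin v → ℂ}
    (hx : ∀ i, b + 2 * c < ‖x i‖) : Summable fun n : Fin v → ℕ+ => laplaceTerm b c g x n := by
  have := (summable_norm_laplace_double hb hc g hx).of_norm.prod
  exact this.congr fun n => (laplaceTerm_hasSum g x n).tsum_eq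

theorem tsum_laplaceTerm (hb : 0 ≤ b) (hc : 0 < c) (g : ℕ) {v : ℕ} {x : Fin v → ℂ}
    (hx : ∀ i, b + 2 * c < ‖x i‖) : ∑' n : Fin v → ℕ+, laplaceTerm b c g x n
      = ∑' μ : Fin v → ℕ, (generalizedCatalan g μ : ℂ)
          * ∏ i, ∑' n : ℕ+, binomialWeight b c (x i) n (μ i) := by
  have h : Summable (Function.uncurry fun (n : Fin v → ℕ+) (μ : Fin v → ℕ) =>
      (generalizedCatalan g μ : ℂ) * ∏ i, binomialWeight b c (x i) (n i) (μ i)) :=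
    (summable_norm_laplace_double hb hc g hx).of_norm
  have h1 : ∑' n : Fin v → ℕ+, laplaceTerm b c g x n = ∑' n : Fin v → ℕ+, ∑' μ : Fin v → ℕ,
      (generalizedCatalan g μ : ℂ) * ∏ i, binomialWeight b c (x i) (n i) (μ i) :=
    tsum_congr fun n => ((laplaceTerm_hasSum g x n).tsum_eq).symm
  rw [h1, ← Summable.tsum_comm h]
  refine tsum_congr fun μ => ?_
  rw [tsum_mul_left]
  congr 1
  exact tsum_prod_pi (f := fun i (n : ℕ+) => binomialWeight b c (x i) n (μ i))
    fun i => summable_binomialWeight_of_pos hb hc (hx i) (μ i)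

/-- Away from `(g,v) = (0,1)`, the discrete Laplace transform is the power series with coefficients
`laplaceCoeff g`, in the variables `c / (x i - b)`. -/
theorem tsum_laplaceTerm_eq_mps (hb : 0 ≤ b) (hc : 0 < c) {g v : ℕ} (hgv : (g, v) ≠ (0, 1))
    {x : Fin v → ℂ} (hx : ∀ i, b + 2 * c < ‖x i‖) :
    ∑' n : Fin v → ℕ+, laplaceTerm b c g x n = mps (laplaceCoeff g) fun i => c / (x i - b) := by
  rw [tsum_laplaceTerm hb hc g hx, mps]
  refine tsum_congr fun μ => ?_
  by_cases h : ∃ i, μ i = 0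
  · obtain ⟨i, hi⟩ := h
    rw [laplaceCoeff, generalizedCatalan_eq_zero g hgv μ i hi]
    simp
  · rw [not_exists] at h
    rw [laplaceCoeff, Finset.prod_congr rfl fun i _ =>
      tsum_binomialWeight_pos hb hc (hx i) (Nat.pos_of_ne_zero (h i)), Finset.prod_div_distrib]
    ring

theorem norm_div_sub_lt_half (hb : 0 ≤ b) (hc : 0 < c) {x : ℂ} (hx : b + 2 * c < ‖x‖) :
    ‖(c : ℂ) / (x - b)‖ < 1 / 2 := by
  have h := norm_sub_norm_le x (b : ℂ)
  rw [Complex.norm_real, Real.norm_of_nonneg hb] at h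
  rw [norm_div, Complex.norm_real, Real.norm_of_nonneg hc.le,
    div_lt_div_iff₀ (by linarith) two_pos]
  linarith

/-- Here μ = 0 does contribute. As `laplaceCoeff 0 0` is 1/0 = 0, its contribution, the logarithm,
is added separately. -/
theorem tsum_laplaceTerm_zero_one (hb : 0 ≤ b) (hc : 0 < c) {x : Fin 1 → ℂ}
    (hx : b + 2 * c < ‖x 0‖) :
    ∑' n : Fin 1 → ℕ+, laplaceTerm b c 0 x n
      = mps (laplaceCoeff 0) (fun i => c / (x i - b)) - Complex.log (1 - b / x 0) := by
  have hx' : ∀ i, b + 2 * c < ‖x i‖ := fun i => by rwa [Subsingleton.elim i 0]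
  rw [tsum_laplaceTerm hb hc 0 hx', mps]
  have h1 : ∀ μ : Fin 1 → ℕ, (generalizedCatalan 0 μ : ℂ)
      * ∏ i, ∑' n : ℕ+, binomialWeight b c (x i) n (μ i)
      = laplaceCoeff 0 μ * ∏ i, (c / (x i - b)) ^ μ i
        + if μ = 0 then -Complex.log (1 - b / x 0) else 0 := by
    intro μ
    by_cases h : μ = 0
    · subst h
      simp [laplaceCoeff, tsum_binomialWeight_zero hb hc hx, generalizedCatalan, catalanRec_zero]
    · have h0 : μ 0 ≠ 0 := fun h0 => h (funext fun i => by rwa [Subsingleton.elim i 0])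
      rw [if_neg h, laplaceCoeff, Fin.prod_univ_one, Fin.prod_univ_one, Fin.prod_univ_one,
        tsum_binomialWeight_pos hb hc hx (Nat.pos_of_ne_zero h0)]
      ring
  have ha : ‖fun i : Fin 1 => (c : ℂ) / (x i - b)‖ < 1 / 2 := by
    rw [pi_norm_lt_iff (by norm_num)]
    intro i
    exact norm_div_sub_lt_half hb hc (hx' i)
  have hs := ((hasGrowth_laplaceCoeff 0 1).summable ha).of_norm
  have h2 : HasSum (fun μ : Fin 1 → ℕ => if μ = 0 then -Complex.log (1 - b / x 0) else 0)
      (-Complex.log (1 - b / x 0)) := hasSum_ite_eq 0 _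
  rw [tsum_congr h1, hs.tsum_add h2.summable, h2.tsum_eq]
  exact (sub_eq_add_neg _ _).symm

theorem bcMotzkin_zero_one : bcMotzkin b c 0 (0 : Fin 1 → ℕ) = 1 := by
  simp [bcMotzkin, generalizedCatalan, catalanRec_zero]

/-! ### Generating functions and the loop equation -/

/-- The weight of the variables `a` in the generating functions. -/
noncomputable def weight {n : ℕ} (a : Fin n → ℂ) (μ : Fin n → ℕ) : ℂ := ∏ i, a i ^ μ i / μ i

/-- The generating function of the generalized Catalan numbers in all arguments but the first. -/
noncomputable def catalanSum (g m : ℕ) {n : ℕ} (a : Fin n → ℂ) : ℂ :=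
  ∑' μ : Fin n → ℕ, (catalanRec g m μ : ℂ) * weight a μ

/-- The generating function of the generalized Catalan numbers in all arguments but the first two. -/
noncomputable def catalanSum₂ (g p q : ℕ) {n : ℕ} (a : Fin n → ℂ) : ℂ :=
  ∑' μ : Fin n → ℕ, (catalanRec g p (Fin.cons q μ : Fin (n + 1) → ℕ) : ℂ) * weight a μ

/-- The generating function of the generalized Catalan numbers, not weighted in the first
argument. -/
noncomputable def catalanGF (g : ℕ) (a₀ : ℂ) {n : ℕ} (a : Fin n → ℂ) : ℂ :=
  ∑' m : ℕ, catalanSum g m a * a₀ ^ m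

/-- The generating function of the generalized Catalan numbers, not weighted in the first two
arguments. -/
noncomputable def catalanGF₂ (g : ℕ) (a₀ a₁ : ℂ) {n : ℕ} (a : Fin n → ℂ) : ℂ :=
  ∑' p : ℕ × ℕ, catalanSum₂ g p.1 p.2 a * a₀ ^ p.1 * a₁ ^ p.2

section

variable {n : ℕ} {a : Fin n → ℂ}

theorem norm_weight_le (a : Fin n → ℂ) (μ : Fin n → ℕ) : ‖weight a μ‖ ≤ ‖a‖ ^ (∑ i, μ i) := by
  rw [weight, Finset.prod_div_distrib]
  exact (norm_div_prod_natCast_le _ μ).trans (prod_norm_pow_le le_rfl μ)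

theorem exists_small_ratio {r ρ : ℝ} (hr : r < 1 / 2) (hρ : 2 < ρ) :
    ∃ ρ' : ℝ, 2 < ρ' ∧ ρ' ≤ ρ ∧ ρ' * r < 1 := by
  obtain ⟨σ, hσ, hσr⟩ := exists_ratio hr
  rcases le_total σ ρ with h | h
  · exact ⟨σ, hσ, h, hσr⟩
  · refine ⟨ρ, hρ, le_rfl, ?_⟩
    rcases le_total 0 r with h0 | h0
    · nlinarith
    · nlinarith

/-- Summation of weighted coefficients of subexponential growth. -/
theorem norm_tsum_weight_le {ι : Type*} (ha : ‖a‖ < 1 / 2) (C : ι → (Fin n → ℕ) → ℂ) (d : ι → ℕ)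
    (hC : ∀ ρ : ℝ, 2 < ρ → ∃ K : ℝ, 0 ≤ K ∧ ∀ i μ, ‖C i μ‖ ≤ K * ρ ^ (d i + ∑ j, μ j)) :
    (∀ i, Summable fun μ => ‖C i μ * weight a μ‖) ∧
    ∀ ρ : ℝ, 2 < ρ → ∃ K : ℝ, 0 ≤ K ∧ ∀ i, ‖∑' μ, C i μ * weight a μ‖ ≤ K * ρ ^ d i := by
  have key : ∀ ρ : ℝ, 2 < ρ → ∃ (ρ' K : ℝ), 0 ≤ K ∧ 0 ≤ ρ' * ‖a‖ ∧ ρ' * ‖a‖ < 1 ∧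
      ∀ i μ, ‖C i μ * weight a μ‖ ≤ K * ρ ^ d i * (ρ' * ‖a‖) ^ (∑ j, μ j) := by
    intro ρ hρ
    obtain ⟨ρ', h2, hle, hlt⟩ := exists_small_ratio ha hρ
    obtain ⟨K, hK, hK'⟩ := hC ρ' h2
    refine ⟨ρ', K, hK, by positivity, hlt, fun i μ => ?_⟩
    rw [norm_mul]
    calc _ ≤ K * ρ' ^ (d i + ∑ j, μ j) * ‖a‖ ^ (∑ j, μ j) :=
          mul_le_mul (hK' i μ) (norm_weight_le a μ) (norm_nonneg _) (by positivity)
      _ = K * ρ' ^ d i * (ρ' * ‖a‖) ^ (∑ j, μ j) := by rw [pow_add, mul_pow]; ring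
      _ ≤ _ := by gcongr
  have hs : ∀ i, Summable fun μ => ‖C i μ * weight a μ‖ := by
    intro i
    obtain ⟨ρ', K, hK, h0, h1, hle⟩ := key 3 (by norm_num)
    exact Summable.of_nonneg_of_le (fun _ => norm_nonneg _) (hle i)
      ((summable_pow_sum h0 h1).mul_left _)
  refine ⟨hs, fun ρ hρ => ?_⟩
  obtain ⟨ρ', K, hK, h0, h1, hle⟩ := key ρ hρ
  refine ⟨K * ∑' μ : Fin n → ℕ, (ρ' * ‖a‖) ^ (∑ j, μ j),
    mul_nonneg hK (tsum_nonneg fun μ => by positivity), fun i => ?_⟩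
  refine (norm_tsum_le_tsum_norm (hs i)).trans (((hs i).tsum_le_tsum (hle i)
    ((summable_pow_sum h0 h1).mul_left _)).trans (le_of_eq ?_))
  rw [tsum_mul_left]
  ring

theorem summable_catalanSum (ha : ‖a‖ < 1 / 2) (g m : ℕ) :
    Summable fun μ : Fin n → ℕ => ‖(catalanRec g m μ : ℂ) * weight a μ‖ :=
  (norm_tsum_weight_le ha (fun m μ => (catalanRec g m μ : ℂ)) id fun ρ hρ => by
    obtain ⟨K, hK, hK'⟩ := exists_catalanRec_le g n hρ
    exact ⟨K, hK, fun m μ => by rw [Complex.norm_natCast]; exact hK' m μ⟩).1 m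

theorem norm_catalanSum_le (ha : ‖a‖ < 1 / 2) (g : ℕ) {ρ : ℝ} (hρ : 2 < ρ) :
    ∃ K : ℝ, 0 ≤ K ∧ ∀ m, ‖catalanSum g m a‖ ≤ K * ρ ^ m :=
  (norm_tsum_weight_le ha (fun m μ => (catalanRec g m μ : ℂ)) id fun ρ hρ => by
    obtain ⟨K, hK, hK'⟩ := exists_catalanRec_le g n hρ
    exact ⟨K, hK, fun m μ => by rw [Complex.norm_natCast]; exact hK' m μ⟩).2 ρ hρ

theorem norm_catalanSum₂_le (ha : ‖a‖ < 1 / 2) (g : ℕ) {ρ : ℝ} (hρ : 2 < ρ) :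
    ∃ K : ℝ, 0 ≤ K ∧ ∀ p : ℕ × ℕ, ‖catalanSum₂ g p.1 p.2 a‖ ≤ K * ρ ^ (p.1 + p.2) :=
  (norm_tsum_weight_le ha
    (fun (p : ℕ × ℕ) μ => (catalanRec g p.1 (Fin.cons p.2 μ : Fin (n + 1) → ℕ) : ℂ))
    (fun p => p.1 + p.2) fun ρ hρ => by
      obtain ⟨K, hK, hK'⟩ := exists_catalanRec_le g (n + 1) hρ
      refine ⟨K, hK, fun p μ => ?_⟩
      rw [Complex.norm_natCast]
      refine (hK' p.1 _).trans (le_of_eq ?_)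
      rw [Fin.sum_cons, add_assoc]).2 ρ hρ

theorem summable_mul_pow_mul_pow {G : ℕ × ℕ → ℂ} {x y : ℂ} (hx : ‖x‖ < 1 / 2) (hy : ‖y‖ < 1 / 2)
    (hG : ∀ ρ : ℝ, 2 < ρ → ∃ K : ℝ, 0 ≤ K ∧ ∀ p : ℕ × ℕ, ‖G p‖ ≤ K * ρ ^ (p.1 + p.2)) :
    Summable fun p : ℕ × ℕ => G p * x ^ p.1 * y ^ p.2 := by
  obtain ⟨ρ, hρ, hρx⟩ := exists_ratio hx
  obtain ⟨ρ', hρ', hle, hρy⟩ := exists_small_ratio hy hρ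
  obtain ⟨K, hK, hK'⟩ := hG ρ' hρ'
  have h1 : ρ' * ‖x‖ < 1 := (mul_le_mul_of_nonneg_right hle (norm_nonneg x)).trans_lt hρx
  have h2 : Summable fun p : ℕ × ℕ => (ρ' * ‖x‖) ^ p.1 * (ρ' * ‖y‖) ^ p.2 :=
    Summable.mul_of_nonneg (summable_geometric_of_lt_one (by positivity) h1)
      (summable_geometric_of_lt_one (by positivity) hρy) (fun _ => by positivity)
      (fun _ => by positivity)
  refine Summable.of_norm_bounded (h2.mul_left K) fun p => ?_
  rw [norm_mul, norm_mul, norm_pow, norm_pow]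
  calc _ ≤ K * ρ' ^ (p.1 + p.2) * ‖x‖ ^ p.1 * ‖y‖ ^ p.2 := by gcongr; exact hK' p
    _ = _ := by rw [pow_add, mul_pow, mul_pow]; ring

theorem summable_catalanGF (ha : ‖a‖ < 1 / 2) (g : ℕ) {a₀ : ℂ} (ha₀ : ‖a₀‖ < 1 / 2) :
    Summable fun m => ‖catalanSum g m a * a₀ ^ m‖ := by
  obtain ⟨ρ, hρ, hρr⟩ := exists_ratio ha₀
  obtain ⟨K, hK, hK'⟩ := norm_catalanSum_le ha g hρ
  refine Summable.of_nonneg_of_le (fun _ => norm_nonneg _) (fun m => ?_)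
    ((summable_geometric_of_lt_one (by positivity) hρr).mul_left K)
  rw [norm_mul, norm_pow, mul_pow, ← mul_assoc]
  exact mul_le_mul_of_nonneg_right (hK' m) (by positivity)

/-- Splitting a sequence along a set of indices. -/
def subseqEquiv (I : Finset (Fin n)) :
    (Fin n → ℕ) ≃ (Fin I.card → ℕ) × (Fin Iᶜ.card → ℕ) :=
  (Equiv.arrowCongr (finSumEquivOfFinset rfl rfl).symm (Equiv.refl ℕ)).trans
    (Equiv.sumArrowEquivProdArrow _ _ _)

theorem subseqEquiv_apply (I : Finset (Fin n)) (μ : Fin n → ℕ) :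
    subseqEquiv I μ = (subseq I μ, subseq Iᶜ μ) := by
  refine Prod.ext (funext fun i => ?_) (funext fun i => ?_)
  · simp [subseqEquiv, Equiv.sumArrowEquivProdArrow, subseq]
  · simp [subseqEquiv, Equiv.sumArrowEquivProdArrow, subseq]

theorem prod_subseq (I : Finset (Fin n)) (h : Fin n → ℂ) : ∏ i, subseq I h i = ∏ i ∈ I, h i := by
  have := congrArg Multiset.prod (univ_map_subseq I h)
  exact this

theorem norm_subseq_le (I : Finset (Fin n)) (a : Fin n → ℂ) : ‖subseq I a‖ ≤ ‖a‖ := by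
  rw [pi_norm_le_iff_of_nonneg (norm_nonneg a)]
  exact fun i => norm_le_pi_norm a _

theorem weight_subseq (I : Finset (Fin n)) (a : Fin n → ℂ) (μ : Fin n → ℕ) :
    weight a μ = weight (subseq I a) (subseq I μ) * weight (subseq Iᶜ a) (subseq Iᶜ μ) := by
  have h := fun I => prod_subseq I fun i => a i ^ μ i / μ i
  rw [weight, ← Finset.prod_mul_prod_compl I, ← h, ← h]
  rfl

theorem tsum_catalanRec_mul (ha : ‖a‖ < 1 / 2) (I : Finset (Fin n)) (g h p q : ℕ) :
    ∑' μ : Fin n → ℕ, (catalanRec g p (subseq I μ) : ℂ) * catalanRec h q (subseq Iᶜ μ) * weight a μ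
      = catalanSum g p (subseq I a) * catalanSum h q (subseq Iᶜ a) := by
  rw [catalanSum, catalanSum, tsum_mul_tsum_of_summable_norm
    (summable_catalanSum ((norm_subseq_le I a).trans_lt ha) g p)
    (summable_catalanSum ((norm_subseq_le Iᶜ a).trans_lt ha) h q), ← (subseqEquiv I).tsum_eq]
  refine tsum_congr fun μ => ?_
  rw [subseqEquiv_apply, weight_subseq I]
  ring

/-- The factor `μ j` of the recursion cancels the denominator in the weight of the j-th variable; it
also removes `μ j = 0`, and the sum runs over q = μ j - 1. -/
theorem tsum_mul_catalanRec_shift (j : Fin n) (g k : ℕ)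
    (hs : Summable fun μ : Fin n → ℕ =>
      (μ j : ℂ) * catalanRec g (k + μ j - 1) (subseq {j}ᶜ μ) * weight a μ) :
    ∑' μ : Fin n → ℕ, (μ j : ℂ) * catalanRec g (k + μ j - 1) (subseq {j}ᶜ μ) * weight a μ
      = ∑' q : ℕ, a j ^ (q + 1) * catalanSum g (k + q) (subseq {j}ᶜ a) := by
  let : Unique (Fin ({j} : Finset (Fin n)).card) := inferInstanceAs (Unique (Fin 1))
  let e := (Equiv.funUnique (Fin ({j} : Finset (Fin n)).card) ℕ).symm
  have hj : ∀ {A : Type} (x : Fin n → A) i, subseq {j} x i = x j := by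
    intro A x i
    have : ({j} : Finset (Fin n)).orderEmbOfFin rfl i = j :=
      Finset.mem_singleton.1 (Finset.orderEmbOfFin_mem _ _ _)
    rw [subseq, this]
  let F : ℕ × (Fin ({j}ᶜ : Finset (Fin n)).card → ℕ) → ℂ := fun z =>
    ((z.1 : ℂ) * (a j ^ z.1 / z.1)) * (catalanRec g (k + z.1 - 1) z.2 * weight (subseq {j}ᶜ a) z.2)
  let E := (subseqEquiv {j}).trans (Equiv.prodCongr e.symm (Equiv.refl _))
  have hE : ∀ μ, E μ = (μ j, subseq {j}ᶜ μ) := by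
    intro μ
    simp only [E, e, Equiv.trans_apply, subseqEquiv_apply, Equiv.symm_symm, Equiv.prodCongr_apply,
      Prod.map_apply, Equiv.refl_apply, Equiv.funUnique_apply, hj]
  have hF : ∀ μ : Fin n → ℕ,
      (μ j : ℂ) * catalanRec g (k + μ j - 1) (subseq {j}ᶜ μ) * weight a μ = F (E μ) := by
    intro μ
    have hw : weight (subseq {j} a) (subseq {j} μ) = a j ^ μ j / μ j := by
      rw [weight, Fintype.prod_unique, hj, hj]
    rw [hE, weight_subseq {j}, hw]
    simp only [F]
    ring
  have hsF : Summable F := by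
    rw [← E.summable_iff]
    exact hs.congr fun μ => (hF μ)
  rw [tsum_congr hF, E.tsum_eq F, hsF.tsum_prod]
  have hrow : ∀ q, ∑' y, F (q, y) = (q : ℂ) * (a j ^ q / q) * catalanSum g (k + q - 1) (subseq {j}ᶜ a) :=
    fun q => by rw [catalanSum, ← tsum_mul_left]
  simp only [hrow]
  have hsum : Summable fun q : ℕ => (q : ℂ) * (a j ^ q / q) * catalanSum g (k + q - 1) (subseq {j}ᶜ a) :=
    hsF.prod.congr hrow
  rw [hsum.tsum_eq_zero_add]
  simp only [Nat.cast_zero, zero_mul, zero_add]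
  refine tsum_congr fun q => ?_
  rw [mul_div_cancel₀ _ (Nat.cast_ne_zero.2 (Nat.succ_ne_zero q))]
  rfl

theorem catalanSum_zero (g : ℕ) (a : Fin n → ℂ) :
    catalanSum g 0 a = if g = 0 ∧ n = 0 then 1 else 0 := by
  rw [catalanSum]
  simp only [catalanRec_zero]
  split_ifs with h
  · obtain ⟨-, rfl⟩ := h
    simp [weight]
  · simp

theorem catalanSum_succ (ha : ‖a‖ < 1 / 2) (g k : ℕ) :
    catalanSum g (k + 1) a = ∑ j, ∑' q : ℕ, a j ^ (q + 1) * catalanSum g (k + q) (subseq {j}ᶜ a)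
      + ∑ p ∈ predAntidiagonal k, (predOrZero g (fun g' => catalanSum₂ g' p.1 p.2 a)
        + ∑ q ∈ Finset.HasAntidiagonal.antidiagonal g, ∑ I : Finset (Fin n),
            catalanSum q.1 p.1 (subseq I a) * catalanSum q.2 p.2 (subseq Iᶜ a)) := by
  have hs := summable_catalanSum ha g (k + 1)
  -- All terms of the recursion are natural numbers, so each is dominated by the left side and
  -- inherits its summability.
  have hdom : ∀ D : (Fin n → ℕ) → ℕ, (∀ μ, D μ ≤ catalanRec g (k + 1) μ) →
      Summable fun μ => (D μ : ℂ) * weight a μ := by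
    intro D hD
    refine Summable.of_norm_bounded hs fun μ => ?_
    rw [norm_mul, norm_mul, Complex.norm_natCast, Complex.norm_natCast]
    exact mul_le_mul_of_nonneg_right (by exact_mod_cast hD μ) (norm_nonneg _)
  have h1 : ∀ j : Fin n, HasSum (fun μ : Fin n → ℕ =>
      ((μ j * catalanRec g (k + μ j - 1) (subseq {j}ᶜ μ) : ℕ) : ℂ) * weight a μ)
      (∑' q : ℕ, a j ^ (q + 1) * catalanSum g (k + q) (subseq {j}ᶜ a)) := by
    intro j
    have hsj := hdom (fun μ => μ j * catalanRec g (k + μ j - 1) (subseq {j}ᶜ μ)) fun μ => by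
      rw [catalanRec_succ]
      exact (Finset.single_le_sum
        (f := fun j => μ j * catalanRec g (k + μ j - 1) (subseq {j}ᶜ μ))
        (fun _ _ => Nat.zero_le _) (Finset.mem_univ j)).trans (Nat.le_add_right _ _)
    have := hsj.hasSum
    simp only [Nat.cast_mul] at hsj this ⊢
    rwa [tsum_mul_catalanRec_shift j g k hsj] at this
  have hle : ∀ p ∈ predAntidiagonal k, ∀ μ : Fin n → ℕ,
      (predOrZero g (fun g' => catalanRec g' p.1 (Fin.cons p.2 μ : Fin (n + 1) → ℕ))
        + ∑ q ∈ Finset.HasAntidiagonal.antidiagonal g, ∑ I : Finset (Fin n),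
            catalanRec q.1 p.1 (subseq I μ) * catalanRec q.2 p.2 (subseq Iᶜ μ))
      ≤ catalanRec g (k + 1) μ := by
    intro p hp μ
    rw [catalanRec_succ]
    exact (Finset.single_le_sum (f := fun p : ℕ × ℕ =>
      (predOrZero g (fun g' => catalanRec g' p.1 (Fin.cons p.2 μ : Fin (n + 1) → ℕ))
        + ∑ q ∈ Finset.HasAntidiagonal.antidiagonal g, ∑ I : Finset (Fin n),
            catalanRec q.1 p.1 (subseq I μ) * catalanRec q.2 p.2 (subseq Iᶜ μ)))
      (fun _ _ => Nat.zero_le _) hp).trans (Nat.le_add_left _ _)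
  have h2 : ∀ p ∈ predAntidiagonal k, HasSum (fun μ : Fin n → ℕ =>
      ((predOrZero g (fun g' => catalanRec g' p.1 (Fin.cons p.2 μ : Fin (n + 1) → ℕ)) : ℕ) : ℂ)
        * weight a μ) (predOrZero g (fun g' => catalanSum₂ g' p.1 p.2 a)) := by
    intro p hp
    have := (hdom _ fun μ => (Nat.le_add_right _ _).trans (hle p hp μ)).hasSum
    by_cases hg : g = 0
    · simp [predOrZero, hg, hasSum_zero]
    · simp only [predOrZero, if_neg hg] at this ⊢
      exact this
  have h3 : ∀ p ∈ predAntidiagonal k, ∀ q ∈ Finset.HasAntidiagonal.antidiagonal g,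
      ∀ I ∈ (Finset.univ : Finset (Finset (Fin n))), HasSum (fun μ : Fin n → ℕ =>
      ((catalanRec q.1 p.1 (subseq I μ) * catalanRec q.2 p.2 (subseq Iᶜ μ) : ℕ) : ℂ) * weight a μ)
      (catalanSum q.1 p.1 (subseq I a) * catalanSum q.2 p.2 (subseq Iᶜ a)) := by
    intro p hp q hq I _
    rw [← tsum_catalanRec_mul ha]
    have := (hdom (fun μ => catalanRec q.1 p.1 (subseq I μ) * catalanRec q.2 p.2 (subseq Iᶜ μ))
      fun μ => ?_).hasSum
    · simpa only [Nat.cast_mul] using this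
    · refine le_trans ?_ ((Nat.le_add_left _ _).trans (hle p hp μ))
      refine le_trans ?_ (Finset.single_le_sum (f := fun q : ℕ × ℕ => ∑ I : Finset (Fin n),
        catalanRec q.1 p.1 (subseq I μ) * catalanRec q.2 p.2 (subseq Iᶜ μ))
        (fun _ _ => Nat.zero_le _) hq)
      exact Finset.single_le_sum (f := fun I : Finset (Fin n) =>
        catalanRec q.1 p.1 (subseq I μ) * catalanRec q.2 p.2 (subseq Iᶜ μ))
        (fun _ _ => Nat.zero_le _) (Finset.mem_univ I)
  have h4 := (hasSum_sum fun j (_ : j ∈ Finset.univ) => h1 j).add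
    (hasSum_sum fun p hp => (h2 p hp).add
      (hasSum_sum fun q hq => hasSum_sum fun I hI => h3 p hp q hq I hI))
  rw [← h4.tsum_eq, catalanSum]
  refine tsum_congr fun μ => ?_
  rw [catalanRec_succ]
  push_cast
  simp only [Finset.sum_mul, add_mul]

theorem hasSum_sum_antidiagonal {F : ℕ × ℕ → ℂ} (hF : Summable F) :
    HasSum (fun N => ∑ p ∈ Finset.HasAntidiagonal.antidiagonal N, F p) (∑' p, F p) := by
  have h := (Finset.HasAntidiagonal.sigmaAntidiagonalEquivProd.hasSum_iff.2 hF.hasSum).sigma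
    fun N => hasSum_fintype _
  convert h using 1
  funext N
  exact (Finset.sum_coe_sort _ F).symm

theorem HasSum.of_eq {ι : Type*} {f g : ι → ℂ} {s t : ℂ} (h : HasSum f s) (hfg : ∀ i, g i = f i)
    (hst : t = s) : HasSum g t := by
  rwa [funext hfg, hst]

theorem hasSum_sum_predAntidiagonal {G : ℕ × ℕ → ℂ} {x : ℂ}
    (hG : Summable fun p : ℕ × ℕ => G p * x ^ p.1 * x ^ p.2) :
    HasSum (fun k => (∑ p ∈ predAntidiagonal k, G p) * x ^ (k + 1))
      (x ^ 2 * ∑' p : ℕ × ℕ, G p * x ^ p.1 * x ^ p.2) := by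
  have h2 := (hasSum_sum_antidiagonal hG).mul_left (x ^ 2)
  rw [← hasSum_nat_add_iff' 1]
  simp only [Finset.range_one, Finset.sum_singleton, predAntidiagonal_zero, Finset.sum_empty,
    zero_mul, sub_zero, predAntidiagonal_succ]
  refine h2.of_eq (fun N => ?_) rfl
  rw [Finset.sum_mul, Finset.mul_sum]
  refine Finset.sum_congr rfl fun p hp => ?_
  rw [← Finset.HasAntidiagonal.mem_antidiagonal.1 hp]
  ring

/-- Group the double series by N = k + q. The identity ∑_{i+j=N} x^i y^j = (x^(N+1) - y^(N+1))/(x -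
y) turns it into a divided difference. -/
theorem hasSum_tsum_shift (ha : ‖a‖ < 1 / 2) (g : ℕ) {x y : ℂ} (hx : ‖x‖ < 1 / 2)
    (hy : ‖y‖ < 1 / 2) (hxy : x ≠ y) :
    HasSum (fun k => (∑' q : ℕ, y ^ (q + 1) * catalanSum g (k + q) a) * x ^ (k + 1))
      (x * y / (x - y) * (x * catalanGF g x a - y * catalanGF g y a)) := by
  have hF := summable_mul_pow_mul_pow (G := fun p => catalanSum g (p.1 + p.2) a) hx hy fun ρ hρ => by
    obtain ⟨K, hK, hK'⟩ := norm_catalanSum_le ha g hρ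
    exact ⟨K, hK, fun p => hK' _⟩
  have h1 := (hF.hasSum.prod_fiberwise fun k => (hF.prod_factor k).hasSum).mul_left (x * y)
  have hxy' : x - y ≠ 0 := sub_ne_zero.2 hxy
  have h2 : ∑' p : ℕ × ℕ, catalanSum g (p.1 + p.2) a * x ^ p.1 * y ^ p.2
      = (x * catalanGF g x a - y * catalanGF g y a) / (x - y) := by
    have h3 := ((summable_catalanGF ha g hx).of_norm.hasSum.mul_left x).sub
      ((summable_catalanGF ha g hy).of_norm.hasSum.mul_left y)
    refine (hasSum_sum_antidiagonal hF).unique ?_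
    refine (h3.div_const (x - y)).of_eq (fun N => ?_) rfl
    have h4 := geom_sum₂_mul x y (N + 1)
    rw [Nat.add_sub_cancel,
      ← Finset.Nat.sum_antidiagonal_eq_sum_range_succ fun i j => x ^ i * y ^ j] at h4
    rw [eq_div_iff hxy']
    have h5 : ∑ p ∈ Finset.HasAntidiagonal.antidiagonal N,
        catalanSum g (p.1 + p.2) a * x ^ p.1 * y ^ p.2
        = catalanSum g N a * ∑ p ∈ Finset.HasAntidiagonal.antidiagonal N, x ^ p.1 * y ^ p.2 := by
      rw [Finset.mul_sum]
      refine Finset.sum_congr rfl fun p hp => ?_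
      rw [Finset.HasAntidiagonal.mem_antidiagonal.1 hp, mul_assoc]
    rw [h5, mul_assoc, h4]
    ring
  rw [h2] at h1
  refine h1.of_eq (fun k => ?_) (by ring)
  · rw [← tsum_mul_right, ← tsum_mul_left]
    exact tsum_congr fun q => by ring

/-- The loop equation for the generating functions of the generalized Catalan numbers. -/
theorem catalanGF_eq (ha : ‖a‖ < 1 / 2) (g : ℕ) {x : ℂ} (hx : ‖x‖ < 1 / 2) (hxa : ∀ j, x ≠ a j) :
    catalanGF g x a = (if g = 0 ∧ n = 0 then 1 else 0)
      + ∑ j, x * a j / (x - a j) * (x * catalanGF g x (subseq {j}ᶜ a)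
          - a j * catalanGF g (a j) (subseq {j}ᶜ a))
      + x ^ 2 * predOrZero g (fun g' => catalanGF₂ g' x x a)
      + x ^ 2 * ∑ q ∈ Finset.HasAntidiagonal.antidiagonal g, ∑ I : Finset (Fin n),
          catalanGF q.1 x (subseq I a) * catalanGF q.2 x (subseq Iᶜ a) := by
  have hsub : ∀ I : Finset (Fin n), ‖subseq I a‖ < 1 / 2 :=
    fun I => (norm_subseq_le I a).trans_lt ha
  have h1 := hasSum_sum fun (j : Fin n) (_ : j ∈ Finset.univ) => hasSum_tsum_shift (hsub {j}ᶜ) g hx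
    ((norm_le_pi_norm a j).trans_lt ha) (hxa j)
  have h2 : HasSum (fun k => (∑ p ∈ predAntidiagonal k,
      predOrZero g (fun g' => catalanSum₂ g' p.1 p.2 a)) * x ^ (k + 1))
      (x ^ 2 * predOrZero g (fun g' => catalanGF₂ g' x x a)) := by
    by_cases hg : g = 0
    · simp [predOrZero, hg, hasSum_zero]
    · simp only [predOrZero, if_neg hg]
      exact hasSum_sum_predAntidiagonal (summable_mul_pow_mul_pow hx hx fun ρ hρ =>
        norm_catalanSum₂_le ha (g - 1) hρ)
  have h3 : ∀ q ∈ Finset.HasAntidiagonal.antidiagonal g, ∀ I ∈ (Finset.univ : Finset (Finset (Fin n))),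
      HasSum (fun k => (∑ p ∈ predAntidiagonal k,
        catalanSum q.1 p.1 (subseq I a) * catalanSum q.2 p.2 (subseq Iᶜ a)) * x ^ (k + 1))
      (x ^ 2 * (catalanGF q.1 x (subseq I a) * catalanGF q.2 x (subseq Iᶜ a))) := by
    intro q _ I _
    have e1 := summable_catalanGF (hsub I) q.1 hx
    have e2 := summable_catalanGF (hsub Iᶜ) q.2 hx
    have e3 : ∀ p : ℕ × ℕ, catalanSum q.1 p.1 (subseq I a) * x ^ p.1
        * (catalanSum q.2 p.2 (subseq Iᶜ a) * x ^ p.2)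
        = catalanSum q.1 p.1 (subseq I a) * catalanSum q.2 p.2 (subseq Iᶜ a)
          * x ^ p.1 * x ^ p.2 := fun p => by ring
    have e4 := (e1.mul_norm e2).of_norm
    simp only [e3] at e4
    rw [catalanGF, catalanGF, tsum_mul_tsum_of_summable_norm e1 e2, tsum_congr e3]
    exact hasSum_sum_predAntidiagonal e4
  have h4 := (h1.add h2).add (hasSum_sum fun q hq => hasSum_sum fun I hI => h3 q hq I hI)
  -- The term m = 0 is the initial value; the recursion is summed over m = k + 1.
  rw [catalanGF, (summable_catalanGF ha g hx).of_norm.tsum_eq_zero_add, catalanSum_zero, pow_zero,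
    mul_one]
  have h5 : ∑' k, catalanSum g (k + 1) a * x ^ (k + 1) = _ := Eq.trans (tsum_congr fun k => by
    rw [catalanSum_succ ha, Finset.sum_add_distrib, Finset.sum_comm (s := predAntidiagonal k),
      Finset.sum_congr rfl fun q _ => Finset.sum_comm (s := predAntidiagonal k)]
    simp only [add_mul, Finset.sum_mul, add_assoc]) h4.tsum_eq
  rw [h5]
  simp only [Finset.mul_sum, add_assoc]

end

/-! ### The change of variable t -/

/-- The variable `c / (x - b)` in terms of `t`. -/
noncomputable def aOf (t : ℂ) : ℂ := (t ^ 2 - 1) / (2 * (t ^ 2 + 1))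

/-- The logarithmic derivative of `aOf`. -/
noncomputable def logDerivA (t : ℂ) : ℂ := 4 * t / ((t ^ 2 + 1) * (t ^ 2 - 1))

section tDomain

variable {b c : ℝ} {t : ℂ}

theorem ne_zero_of_mem_tDomain (ht : t ∈ tDomain b c) : t ≠ 0 := by
  rintro rfl
  exact lt_irrefl _ ht.1

theorem sub_one_ne_zero_of_mem_tDomain (ht : t ∈ tDomain b c) : t - 1 ≠ 0 := by
  intro h
  have h1 := ht.1
  rw [sub_eq_zero.1 h, Complex.one_re] at h1
  linarith

theorem add_one_ne_zero_of_mem_tDomain (hb : 0 ≤ b) (hc : 0 < c) (ht : t ∈ tDomain b c) :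
    t + 1 ≠ 0 := by
  intro h
  have h1 := ht.2
  have h2 : xOf b c t = ((b + 2 * c : ℝ) : ℂ) := by
    rw [xOf, eq_neg_of_add_eq_zero_left h]
    push_cast
    norm_num
    ring
  rw [h2, Complex.norm_real, Real.norm_of_nonneg (by positivity)] at h1
  exact lt_irrefl _ h1

theorem add_ne_zero_of_mem_tDomain {t' : ℂ} (ht : t ∈ tDomain b c) (ht' : t' ∈ tDomain b c) :
    t + t' ≠ 0 := by
  intro h
  have h1 := ht.1
  have h2 := ht'.1
  have h3 := congrArg Complex.re h
  rw [Complex.add_re, Complex.zero_re] at h3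
  linarith

theorem sq_sub_one_ne_zero_of_mem_tDomain (hb : 0 ≤ b) (hc : 0 < c) (ht : t ∈ tDomain b c) :
    t ^ 2 - 1 ≠ 0 := by
  rw [show t ^ 2 - 1 = (t - 1) * (t + 1) by ring]
  exact mul_ne_zero (sub_one_ne_zero_of_mem_tDomain ht) (add_one_ne_zero_of_mem_tDomain hb hc ht)

theorem sq_add_one_ne_zero_of_mem_tDomain (hb : 0 ≤ b) (hc : 0 < c) (ht : t ∈ tDomain b c) :
    t ^ 2 + 1 ≠ 0 := by
  intro h
  have h1 := ht.2
  have h2 : xOf b c t = (b : ℂ) := by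
    rw [xOf, eq_neg_of_add_eq_zero_left h]
    norm_num
  rw [h2, Complex.norm_real, Real.norm_of_nonneg hb] at h1
  linarith

theorem xOf_sub (hb : 0 ≤ b) (hc : 0 < c) (ht : t ∈ tDomain b c) :
    xOf b c t - b = c / aOf t := by
  have h1 := sq_sub_one_ne_zero_of_mem_tDomain hb hc ht
  have h2 := sq_add_one_ne_zero_of_mem_tDomain hb hc ht
  rw [xOf, aOf]
  field_simp
  ring

theorem aOf_ne_zero (hb : 0 ≤ b) (hc : 0 < c) (ht : t ∈ tDomain b c) : aOf t ≠ 0 :=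
  div_ne_zero (sq_sub_one_ne_zero_of_mem_tDomain hb hc ht)
    (mul_ne_zero two_ne_zero (sq_add_one_ne_zero_of_mem_tDomain hb hc ht))

theorem div_xOf_sub (hb : 0 ≤ b) (hc : 0 < c) (ht : t ∈ tDomain b c) :
    (c : ℂ) / (xOf b c t - b) = aOf t := by
  have hc' : (c : ℂ) ≠ 0 := Complex.ofReal_ne_zero.2 hc.ne'
  rw [xOf_sub hb hc ht, div_div_cancel₀ hc']

theorem norm_aOf_lt (hb : 0 ≤ b) (hc : 0 < c) (ht : t ∈ tDomain b c) : ‖aOf t‖ < 1 / 2 := by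
  rw [← div_xOf_sub hb hc ht]
  exact norm_div_sub_lt_half hb hc ht.2

theorem norm_aOf_comp_lt (hb : 0 ≤ b) (hc : 0 < c) {v : ℕ} {t : Fin v → ℂ}
    (ht : ∀ i, t i ∈ tDomain b c) : ‖aOf ∘ t‖ < 1 / 2 := by
  rw [pi_norm_lt_iff (by norm_num)]
  exact fun i => norm_aOf_lt hb hc (ht i)

theorem hasDerivAt_aOf (hb : 0 ≤ b) (hc : 0 < c) (ht : t ∈ tDomain b c) :
    HasDerivAt aOf (logDerivA t * aOf t) t := by
  have h1 := sq_sub_one_ne_zero_of_mem_tDomain hb hc ht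
  have h2 := sq_add_one_ne_zero_of_mem_tDomain hb hc ht
  have h3 := (((hasDerivAt_id t).pow 2).sub_const 1).div
    ((((hasDerivAt_id t).pow 2).add_const 1).const_mul 2) (mul_ne_zero two_ne_zero h2)
  refine h3.congr_deriv ?_
  simp only [logDerivA, aOf, Pi.pow_apply, id]
  push_cast
  field_simp
  ring

theorem differentiableAt_xOf (hb : 0 ≤ b) (hc : 0 < c) (ht : t ∈ tDomain b c) :
    DifferentiableAt ℂ (xOf b c) t := by
  have h1 := sq_sub_one_ne_zero_of_mem_tDomain hb hc ht
  unfold xOf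
  fun_prop (disch := exact h1)

theorem isOpen_tDomain (hb : 0 ≤ b) (hc : 0 < c) : IsOpen (tDomain b c) := by
  rw [isOpen_iff_mem_nhds]
  intro t ht
  have h1 : ∀ᶠ s in nhds t, s.re < 0 :=
    Complex.continuous_re.continuousAt.eventually_lt_const ht.1
  have h2 : ∀ᶠ s in nhds t, b + 2 * c < ‖xOf b c s‖ :=
    (differentiableAt_xOf hb hc ht).continuousAt.norm.eventually_const_lt ht.2
  filter_upwards [h1, h2] with s hs hs' using ⟨hs, hs'⟩

/-- `aOf` is an injective function of t², and t, -t are not both in the left half-plane. Hence t_1 ≠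
t_j yields the distinctness required by the loop equation. -/
theorem eq_of_aOf_eq (hb : 0 ≤ b) (hc : 0 < c) {t' : ℂ} (ht : t ∈ tDomain b c)
    (ht' : t' ∈ tDomain b c) (h : aOf t = aOf t') : t = t' := by
  have h1 := sq_add_one_ne_zero_of_mem_tDomain hb hc ht
  have h2 := sq_add_one_ne_zero_of_mem_tDomain hb hc ht'
  rw [aOf, aOf, div_eq_div_iff (mul_ne_zero two_ne_zero h1) (mul_ne_zero two_ne_zero h2)] at h
  have h3 : (t + t') * (t - t') = 0 := by linear_combination h / 4
  exact sub_eq_zero.1 ((mul_eq_zero.1 h3).resolve_left (add_ne_zero_of_mem_tDomain ht ht'))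

end tDomain

/-! ### Holomorphy and derivatives in t -/

section laplaceT

variable {b c : ℝ} {v : ℕ}

theorem laplaceT_eq_mps (hb : 0 ≤ b) (hc : 0 < c) (ℓ : ℂ → ℂ) {g : ℕ} (hgv : (g, v) ≠ (0, 1))
    {t : Fin v → ℂ} (ht : ∀ i, t i ∈ tDomain b c) :
    laplaceT ℓ b c g t = mps (laplaceCoeff g) (aOf ∘ t) := by
  have hif : ¬(g = 0 ∧ v = 1) := fun h => hgv (Prod.ext h.1 h.2)
  rw [laplaceT, laplaceTransform, if_neg hif, tsum_laplaceTerm_eq_mps hb hc hgv fun i => (ht i).2]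
  congr 1
  funext i
  exact div_xOf_sub hb hc (ht i)

theorem hasDerivAt_mps_aOf (hb : 0 ≤ b) (hc : 0 < c) {φ : (Fin v → ℕ) → ℂ} (hφ : HasGrowth φ)
    {t : Fin v → ℂ} (ht : ∀ i, t i ∈ tDomain b c) (i : Fin v) :
    HasDerivAt (fun s => mps φ (aOf ∘ Function.update t i s))
      (logDerivA (t i) * (aOf (t i) * mps (pderivCoeff i φ) (aOf ∘ t))) (t i) := by
  have h1 : HasDerivAt (fun s => mps φ (Function.update (aOf ∘ t) i s))
      (mps (pderivCoeff i φ) (aOf ∘ t)) (aOf (t i)) :=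
    hφ.hasDerivAt_update (norm_aOf_comp_lt hb hc ht) i
  have h2 := h1.comp (t i) (hasDerivAt_aOf hb hc (ht i))
  refine (h2.congr_deriv (by ring)).congr_of_eventuallyEq (Filter.Eventually.of_forall fun s => ?_)
  simp only [Function.comp_apply]
  congr 1
  exact Function.comp_update aOf t i s

theorem eventually_update_mem (hb : 0 ≤ b) (hc : 0 < c) {t : Fin v → ℂ}
    (ht : ∀ i, t i ∈ tDomain b c) (i : Fin v) :
    ∀ᶠ s in nhds (t i), ∀ j, Function.update t i s j ∈ tDomain b c := by
  filter_upwards [(isOpen_tDomain hb hc).mem_nhds (ht i)] with s hs j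
  rcases eq_or_ne j i with rfl | hj
  · rwa [Function.update_self]
  · rw [Function.update_of_ne hj]
    exact ht j

theorem hasDerivAt_laplaceT (hb : 0 ≤ b) (hc : 0 < c) (ℓ : ℂ → ℂ) {g : ℕ} (hgv : (g, v) ≠ (0, 1))
    {t : Fin v → ℂ} (ht : ∀ i, t i ∈ tDomain b c) (i : Fin v) :
    HasDerivAt (fun s => laplaceT ℓ b c g (Function.update t i s))
      (logDerivA (t i) * (aOf (t i) * mps (pderivCoeff i (laplaceCoeff g)) (aOf ∘ t))) (t i) := by
  refine (hasDerivAt_mps_aOf hb hc (hasGrowth_laplaceCoeff g v) ht i).congr_of_eventuallyEq ?_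
  filter_upwards [eventually_update_mem hb hc ht i] with s hs
  exact laplaceT_eq_mps hb hc ℓ hgv hs

theorem partialDeriv_laplaceT (hb : 0 ≤ b) (hc : 0 < c) (ℓ : ℂ → ℂ) {g : ℕ}
    (hgv : (g, v) ≠ (0, 1)) {t : Fin v → ℂ} (ht : ∀ i, t i ∈ tDomain b c) (i : Fin v) :
    partialDeriv i (laplaceT ℓ b c g) t
      = logDerivA (t i) * (aOf (t i) * mps (pderivCoeff i (laplaceCoeff g)) (aOf ∘ t)) :=
  (hasDerivAt_laplaceT hb hc ℓ hgv ht i).deriv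

theorem partialDeriv_partialDeriv_laplaceT (hb : 0 ≤ b) (hc : 0 < c) (ℓ : ℂ → ℂ) {g : ℕ}
    (hgv : (g, v) ≠ (0, 1)) {t : Fin v → ℂ} (ht : ∀ i, t i ∈ tDomain b c) {i j : Fin v}
    (hij : i ≠ j) :
    partialDeriv i (partialDeriv j (laplaceT ℓ b c g)) t
      = logDerivA (t i) * logDerivA (t j) * (aOf (t i) * aOf (t j) *
        mps (pderivCoeff i (pderivCoeff j (laplaceCoeff g))) (aOf ∘ t)) := by
  have h1 := ((hasDerivAt_mps_aOf hb hc ((hasGrowth_laplaceCoeff g v).pderiv j) ht i).const_mul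
    (logDerivA (t j) * aOf (t j)))
  -- The inner derivative is known on the domain, which is open, so the formula holds near `t i`;
  -- its factors in `t j` are constant there because `i ≠ j`.
  have h2 : (fun s => partialDeriv j (laplaceT ℓ b c g) (Function.update t i s)) =ᶠ[nhds (t i)]
      fun s => logDerivA (t j) * aOf (t j) *
        mps (pderivCoeff j (laplaceCoeff g)) (aOf ∘ Function.update t i s) := by
    filter_upwards [eventually_update_mem hb hc ht i] with s hs
    rw [partialDeriv_laplaceT hb hc ℓ hgv hs, Function.update_of_ne hij.symm, mul_assoc]
  rw [partialDeriv, (h1.congr_of_eventuallyEq h2).deriv]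
  ring

theorem differentiableOn_laplaceT (hb : 0 ≤ b) (hc : 0 < c) (ℓ : ℂ → ℂ) {g : ℕ}
    (hgv : (g, v) ≠ (0, 1)) :
    DifferentiableOn ℂ (fun t : Fin v → ℂ => laplaceT ℓ b c g t) {t | ∀ i, t i ∈ tDomain b c} := by
  have h : DifferentiableOn ℂ (fun t : Fin v → ℂ => mps (laplaceCoeff g) (aOf ∘ t))
      {t | ∀ i, t i ∈ tDomain b c} := by
    intro t ht
    have h1 := ((hasGrowth_laplaceCoeff g v).hasFDerivAt
      (norm_aOf_comp_lt hb hc ht)).2.differentiableAt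
    have h2 : DifferentiableAt ℂ (fun t : Fin v → ℂ => aOf ∘ t) t :=
      differentiableAt_pi.2 fun i => (hasDerivAt_aOf hb hc (ht i)).differentiableAt.comp t
        (differentiableAt_apply i t)
    exact (h1.comp t h2).differentiableWithinAt
  exact h.congr fun t ht => laplaceT_eq_mps hb hc ℓ hgv ht

end laplaceT

/-! ### Derivatives of the transform as Catalan generating functions -/

section catalanGF

variable {n : ℕ} {a : Fin n → ℂ}

theorem laplaceCoeff_cons (g m : ℕ) (μ : Fin n → ℕ) (a : Fin n → ℂ) :
    laplaceCoeff g (Fin.cons m μ : Fin (n + 1) → ℕ) * ∏ i, a i ^ μ i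
      = catalanRec g m μ * weight a μ / m := by
  rw [laplaceCoeff, Fin.prod_univ_succ, weight, Finset.prod_div_distrib, generalizedCatalan]
  simp only [Fin.cons_zero, Fin.cons_succ, Fin.tail_cons]
  rw [mul_comm (m : ℂ), ← div_div]
  ring

theorem norm_cons_lt {r : ℝ} {a₀ : ℂ} (ha₀ : ‖a₀‖ < r) (ha : ‖a‖ < r) :
    ‖(Fin.cons a₀ a : Fin (n + 1) → ℂ)‖ < r := by
  rw [pi_norm_lt_iff ((norm_nonneg _).trans_lt ha₀)]
  intro i
  induction i using Fin.cases with
  | zero => exact ha₀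
  | succ i => exact (norm_le_pi_norm a i).trans_lt ha

theorem cons_add_single_zero (m : ℕ) (μ : Fin n → ℕ) :
    (Fin.cons m μ + Pi.single 0 1 : Fin (n + 1) → ℕ) = Fin.cons (m + 1) μ := by
  funext i
  induction i using Fin.cases with
  | zero => simp
  | succ i => simp

theorem cons_add_single_succ (m : ℕ) (μ : Fin n → ℕ) (j : Fin n) :
    (Fin.cons m μ + Pi.single j.succ 1 : Fin (n + 1) → ℕ)
      = Fin.cons m (μ + Pi.single j 1 : Fin n → ℕ) := by
  funext i
  induction i using Fin.cases with
  | zero => simp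
  | succ i =>
    simp only [Pi.add_apply, Fin.cons_succ, Pi.single_apply, Fin.succ_inj]

theorem mps_cons {φ : (Fin (n + 1) → ℕ) → ℂ} (hφ : HasGrowth φ) {a₀ : ℂ} (ha₀ : ‖a₀‖ < 1 / 2)
    (ha : ‖a‖ < 1 / 2) :
    HasSum (fun m : ℕ => (∑' μ : Fin n → ℕ, φ (Fin.cons m μ) * ∏ i, a i ^ μ i) * a₀ ^ m)
      (mps φ (Fin.cons a₀ a)) := by
  have hs := (hφ.summable (norm_cons_lt ha₀ ha)).of_norm
  rw [← (Fin.consEquiv fun _ => ℕ).summable_iff] at hs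
  have h1 := hs.hasSum.prod_fiberwise fun m => (hs.prod_factor m).hasSum
  refine h1.of_eq (fun m => ?_) ?_
  · rw [← tsum_mul_right]
    refine tsum_congr fun μ => ?_
    simp only [Function.comp_apply, Fin.consEquiv, Equiv.coe_fn_mk, Fin.prod_univ_succ,
      Fin.cons_zero, Fin.cons_succ]
    ring
  · rw [mps, ← (Fin.consEquiv fun _ => ℕ).tsum_eq]
    rfl

/-- The operator a₀ ∂/∂a₀ cancels the division by the first argument but loses its value 0, which
contributes only for (0,1). -/
theorem catalanGF_eq_mps (g : ℕ) {a₀ : ℂ} (ha₀ : ‖a₀‖ < 1 / 2) (ha : ‖a‖ < 1 / 2) :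
    catalanGF g a₀ a = (if g = 0 ∧ n = 0 then 1 else 0)
      + a₀ * mps (pderivCoeff 0 (laplaceCoeff g)) (Fin.cons a₀ a) := by
  have h1 := (mps_cons ((hasGrowth_laplaceCoeff g (n + 1)).pderiv 0) ha₀ ha).mul_left a₀
  rw [catalanGF, (summable_catalanGF ha g ha₀).of_norm.tsum_eq_zero_add, catalanSum_zero, pow_zero,
    mul_one, ← h1.tsum_eq]
  congr 1
  refine tsum_congr fun m => ?_
  rw [pow_succ', ← mul_assoc, mul_comm _ a₀, mul_assoc]
  congr 2
  refine tsum_congr fun μ => ?_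
  rw [pderivCoeff, cons_add_single_zero, mul_assoc, laplaceCoeff_cons, Fin.cons_zero,
    Nat.cast_succ, mul_div_cancel₀ _ (Nat.cast_add_one_ne_zero m)]

theorem catalanGF₂_eq_mps (g : ℕ) {a₀ a₁ : ℂ} (ha₀ : ‖a₀‖ < 1 / 2) (ha₁ : ‖a₁‖ < 1 / 2)
    (ha : ‖a‖ < 1 / 2) :
    catalanGF₂ g a₀ a₁ a = a₀ * a₁ * mps (pderivCoeff 0 (pderivCoeff 1 (laplaceCoeff g)))
      (Fin.cons a₀ (Fin.cons a₁ a : Fin (n + 1) → ℂ) : Fin (n + 2) → ℂ) := by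
  have hψ := ((hasGrowth_laplaceCoeff g (n + 2)).pderiv 1).pderiv 0
  have hs := (hψ.summable (norm_cons_lt ha₀ (norm_cons_lt ha₁ ha))).of_norm
  let e : (ℕ × ℕ) × (Fin n → ℕ) ≃ (Fin (n + 2) → ℕ) := (Equiv.prodAssoc ℕ ℕ (Fin n → ℕ)).trans
    ((Equiv.prodCongr (Equiv.refl ℕ) (Fin.consEquiv fun _ => ℕ)).trans (Fin.consEquiv fun _ => ℕ))
  have he : ∀ p μ, e (p, μ) = Fin.cons p.1 (Fin.cons p.2 μ : Fin (n + 1) → ℕ) := fun _ _ => rfl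
  rw [← e.summable_iff] at hs
  rw [mps, ← e.tsum_eq]
  refine Eq.trans ?_ (congrArg (a₀ * a₁ * ·) hs.tsum_prod.symm)
  have hinj : Function.Injective fun p : ℕ × ℕ => (p.1 + 1, p.2 + 1) := by
    rintro ⟨p, q⟩ ⟨p', q'⟩ h
    simpa using h
  rw [catalanGF₂, ← hinj.tsum_eq]
  · simp only
    rw [← tsum_mul_left]
    refine tsum_congr fun p => ?_
    have hrow : ∀ μ : Fin n → ℕ,
        pderivCoeff 0 (pderivCoeff 1 (laplaceCoeff g)) (e (p, μ)) * ∏ i,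
          (Fin.cons a₀ (Fin.cons a₁ a : Fin (n + 1) → ℂ) : Fin (n + 2) → ℂ) i ^ e (p, μ) i
        = (catalanRec g (p.1 + 1) (Fin.cons (p.2 + 1) μ : Fin (n + 1) → ℕ) : ℂ) * weight a μ
          * (a₀ ^ p.1 * a₁ ^ p.2) := by
      intro μ
      have h1 := Nat.cast_add_one_ne_zero (R := ℂ) p.1
      have h2 := Nat.cast_add_one_ne_zero (R := ℂ) p.2
      have h3 := cons_add_single_succ (p.1 + 1) (Fin.cons p.2 μ : Fin (n + 1) → ℕ) 0
      rw [Fin.succ_zero_eq_one] at h3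
      rw [he, pderivCoeff, cons_add_single_zero, pderivCoeff, h3, cons_add_single_zero,
        laplaceCoeff, generalizedCatalan, weight]
      simp only [Fin.prod_univ_succ, Fin.cons_zero, Fin.cons_succ, Fin.tail_cons, Nat.cast_succ,
        Finset.prod_div_distrib]
      rw [← Fin.succ_zero_eq_one, Fin.cons_succ, Fin.cons_zero]
      rw [div_eq_mul_inv, div_eq_mul_inv, mul_inv, mul_inv]
      field_simp
    simp only [Function.comp_apply]
    rw [tsum_congr hrow, tsum_mul_right, catalanSum₂, pow_succ, pow_succ]
    ring
  -- Catalan numbers with p = 0 or q = 0 vanish, as there are at least two arguments; so all nonzero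
  -- terms have both exponents positive.
  · rintro ⟨p, q⟩ hp
    have h1 : p ≠ 0 := by
      rintro rfl
      refine hp ?_
      simp [catalanSum₂, catalanRec_zero]
    have h2 : q ≠ 0 := by
      rintro rfl
      refine hp ?_
      have h3 : ∀ μ : Fin n → ℕ, catalanRec g p (Fin.cons 0 μ : Fin (n + 1) → ℕ) = 0 := fun μ => by
        rw [catalanRec_eq_multisetCatalan, univ_map_cons]
        exact multisetCatalan_of_zero_mem _ _ _ (Multiset.mem_cons_self _ _)
      simp [catalanSum₂, h3]
    exact ⟨(p - 1, q - 1), Prod.ext (Nat.sub_add_cancel (Nat.pos_of_ne_zero h1))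
      (Nat.sub_add_cancel (Nat.pos_of_ne_zero h2))⟩

theorem laplaceCoeff_comp_equiv (g : ℕ) {m n : ℕ} (σ : Fin m ≃ Fin n) (μ : Fin n → ℕ) :
    laplaceCoeff g (μ ∘ σ) = laplaceCoeff g μ := by
  obtain rfl : m = n := by simpa using Fintype.card_congr σ
  rw [laplaceCoeff, laplaceCoeff, generalizedCatalan_comp_perm]
  congr 1
  exact Equiv.prod_comp σ fun i => (μ i : ℂ)

/-- Here the symmetry of the Catalan numbers enters the analysis: a derivative in any variable can
be moved to the first one. -/
theorem mps_pderivCoeff_comp_equiv (g : ℕ) {m n : ℕ} (σ : Fin m ≃ Fin n) (i : Fin m)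
    (a : Fin n → ℂ) : mps (pderivCoeff i (laplaceCoeff g)) (a ∘ σ)
      = mps (pderivCoeff (σ i) (laplaceCoeff g)) a := by
  rw [mps, mps, ← (Equiv.arrowCongr σ.symm (Equiv.refl ℕ)).tsum_eq]
  refine tsum_congr fun μ => ?_
  have h1 : (Equiv.arrowCongr σ.symm (Equiv.refl ℕ)) μ = μ ∘ σ := rfl
  have h2 : (μ ∘ σ + Pi.single i 1 : Fin m → ℕ) = (μ + Pi.single (σ i) 1 : Fin n → ℕ) ∘ σ := by
    funext k
    simp [Pi.single_apply]
  rw [h1, pderivCoeff, pderivCoeff, h2, laplaceCoeff_comp_equiv,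
    ← Equiv.prod_comp σ fun i => a i ^ μ i]
  rfl

/-- The enumeration of `Fin n` starting with `j` and continuing in increasing order. -/
noncomputable def consComplEquiv (j : Fin n) : Fin (({j}ᶜ : Finset (Fin n)).card + 1) ≃ Fin n :=
  Equiv.ofBijective (Fin.cons j (({j}ᶜ : Finset (Fin n)).orderEmbOfFin rfl)) <| by
    rw [Fintype.bijective_iff_injective_and_card, Fin.cons_injective_iff]
    refine ⟨⟨?_, ({j}ᶜ : Finset (Fin n)).orderEmbOfFin rfl |>.injective⟩, ?_⟩
    · rintro ⟨i, hi⟩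
      have := Finset.orderEmbOfFin_mem ({j}ᶜ : Finset (Fin n)) rfl i
      rw [hi] at this
      simp at this
    · rw [Fintype.card_fin, Fintype.card_fin, Finset.card_compl, Finset.card_singleton,
        Fintype.card_fin, Nat.sub_add_cancel j.pos]

theorem comp_consComplEquiv {A : Type} (j : Fin n) (x : Fin n → A) :
    x ∘ consComplEquiv j = Fin.cons (x j) (subseq {j}ᶜ x) := by
  funext i
  induction i using Fin.cases with
  | zero => rfl
  | succ i => rfl

end catalanGF

section partialDeriv

variable {b c : ℝ} {n : ℕ}

theorem partialDeriv_laplaceT_eq (hb : 0 ≤ b) (hc : 0 < c) (ℓ : ℂ → ℂ) {g : ℕ}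
    (hgv : (g, n) ≠ (0, 1)) {t : Fin n → ℂ} (ht : ∀ i, t i ∈ tDomain b c) (j : Fin n) :
    partialDeriv j (laplaceT ℓ b c g) t
      = logDerivA (t j) * catalanGF g (aOf (t j)) (aOf ∘ subseq {j}ᶜ t) := by
  have h1 : ‖aOf ∘ subseq {j}ᶜ t‖ < 1 / 2 := norm_aOf_comp_lt hb hc fun i => ht _
  have h2 : ¬(g = 0 ∧ ({j}ᶜ : Finset (Fin n)).card = 0) := by
    rw [Finset.card_compl, Finset.card_singleton, Fintype.card_fin]
    rintro ⟨rfl, h⟩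
    have := j.pos
    exact hgv (Prod.ext rfl (by simp only; omega))
  rw [partialDeriv_laplaceT hb hc ℓ hgv ht, catalanGF_eq_mps g (norm_aOf_lt hb hc (ht j)) h1,
    if_neg h2, zero_add]
  have h3 := mps_pderivCoeff_comp_equiv g (consComplEquiv j) 0 (aOf ∘ t)
  rw [comp_consComplEquiv] at h3
  congr 2
  exact h3.symm

theorem partialDeriv_laplaceT_cons (hb : 0 ≤ b) (hc : 0 < c) (ℓ : ℂ → ℂ) {g : ℕ}
    (hgn : ¬(g = 0 ∧ n = 0)) {t₀ : ℂ} (ht₀ : t₀ ∈ tDomain b c) {t : Fin n → ℂ}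
    (ht : ∀ i, t i ∈ tDomain b c) :
    partialDeriv 0 (laplaceT ℓ b c g) (Fin.cons t₀ t)
      = logDerivA t₀ * catalanGF g (aOf t₀) (aOf ∘ t) := by
  have hgv : (g, n + 1) ≠ (0, 1) := fun h => by
    rw [Prod.mk.injEq] at h
    exact hgn ⟨h.1, by omega⟩
  have ht' : ∀ i, (Fin.cons t₀ t : Fin (n + 1) → ℂ) i ∈ tDomain b c :=
    fun i => Fin.cases ht₀ ht i
  rw [partialDeriv_laplaceT hb hc ℓ hgv ht', catalanGF_eq_mps g (norm_aOf_lt hb hc ht₀)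
    (norm_aOf_comp_lt hb hc ht), if_neg hgn, zero_add, Fin.cons_zero]
  congr 3
  funext i
  induction i using Fin.cases with
  | zero => rfl
  | succ i => rfl

theorem partialDeriv_partialDeriv_laplaceT_cons (hb : 0 ≤ b) (hc : 0 < c) (ℓ : ℂ → ℂ) (g : ℕ)
    {t₀ t₁ : ℂ} (ht₀ : t₀ ∈ tDomain b c) (ht₁ : t₁ ∈ tDomain b c) {t : Fin n → ℂ}
    (ht : ∀ i, t i ∈ tDomain b c) :
    partialDeriv 0 (partialDeriv 1 (laplaceT ℓ b c g))
        (Fin.cons t₀ (Fin.cons t₁ t : Fin (n + 1) → ℂ) : Fin (n + 2) → ℂ)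
      = logDerivA t₀ * logDerivA t₁ * catalanGF₂ g (aOf t₀) (aOf t₁) (aOf ∘ t) := by
  have hgv : (g, n + 2) ≠ (0, 1) := fun h => by
    rw [Prod.mk.injEq] at h
    omega
  have ht' : ∀ i, (Fin.cons t₀ (Fin.cons t₁ t : Fin (n + 1) → ℂ) : Fin (n + 2) → ℂ) i
      ∈ tDomain b c := fun i => Fin.cases ht₀ (fun i => Fin.cases ht₁ ht i) i
  rw [partialDeriv_partialDeriv_laplaceT hb hc ℓ hgv ht' (by simp), catalanGF₂_eq_mps g
    (norm_aOf_lt hb hc ht₀) (norm_aOf_lt hb hc ht₁) (norm_aOf_comp_lt hb hc ht)]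
  congr 3
  funext i
  induction i using Fin.cases with
  | zero => rfl
  | succ i =>
    induction i using Fin.cases with
    | zero => rfl
    | succ i => rfl

end partialDeriv

/-! ### Splittings and their unstable terms -/

section subseq

variable {A B : Type} {n : ℕ}

/-- The lengths agree only propositionally, so `F` takes the length as an argument and the proof
generalizes it. The only increasing enumeration of `Fin n` is the identity. -/
theorem apply_subseq_univ (F : ∀ m, (Fin m → A) → B) (x : Fin n → A) :
    F _ (subseq Finset.univ x) = F n x := by
  have key : ∀ (k : ℕ) (h : (Finset.univ : Finset (Fin n)).card = k),
      F k (fun i => x (Finset.univ.orderEmbOfFin h i)) = F n x := by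
    intro k h
    obtain rfl : n = k := by rw [← h, Finset.card_univ, Fintype.card_fin]
    have h1 := Finset.orderEmbOfFin_unique h (f := id) (fun i => Finset.mem_univ _) strictMono_id
    rw [← h1]
    rfl
  exact key _ rfl

theorem apply_subseq_singleton (F : ∀ m, (Fin m → A) → B) (x : Fin n → A) (j : Fin n) :
    F _ (subseq {j} x) = F 1 (fun _ => x j) := by
  have h : subseq {j} x = fun _ => x j := funext fun i =>
    congrArg x (Finset.mem_singleton.1 (Finset.orderEmbOfFin_mem _ _ _))
  rw [h]
  exact congrArg (fun k => F k fun _ => x j) (Finset.card_singleton j)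

theorem sum_finset_card_le_one {M : Type*} [AddCommMonoid M] (F : Finset (Fin n) → M) :
    (∑ I : Finset (Fin n), if I.card ≤ 1 then F I else 0) = F ∅ + ∑ j, F {j} := by
  have h : (Finset.univ.filter fun I : Finset (Fin n) => I.card ≤ 1)
      = insert ∅ (Finset.univ.image fun j : Fin n => ({j} : Finset (Fin n))) := by
    ext I
    simp only [Finset.mem_filter, Finset.mem_univ, true_and, Finset.mem_insert, Finset.mem_image]
    rw [Nat.le_one_iff_eq_zero_or_eq_one, Finset.card_eq_zero, Finset.card_eq_one]
    simp only [eq_comm]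
  rw [← Finset.sum_filter, h, Finset.sum_insert, Finset.sum_image]
  · exact fun i _ j _ hij => Finset.singleton_injective hij
  · simp

/-- Separation of the unstable terms `(0, ∅)` and `(0, {j})` from a sum over all splittings. -/
theorem sum_splittings (g : ℕ) (A : ℕ → Finset (Fin n) → ℂ) :
    ∑ p ∈ Finset.HasAntidiagonal.antidiagonal g, ∑ I : Finset (Fin n), A p.1 I * A p.2 Iᶜ
      = (∑ p ∈ Finset.HasAntidiagonal.antidiagonal g, ∑ I : Finset (Fin n),
          if 0 < 2 * (p.1 : ℤ) + (I.card : ℤ) - 1 ∧ 0 < 2 * (p.2 : ℤ) + (Iᶜ.card : ℤ) - 1 then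
            A p.1 I * A p.2 Iᶜ else 0)
        + 2 * (A 0 ∅ * A g Finset.univ + ∑ j, A 0 {j} * A g {j}ᶜ)
        - if g = 0 then ∑ I : Finset (Fin n),
            if I.card ≤ 1 ∧ Iᶜ.card ≤ 1 then A 0 I * A 0 Iᶜ else 0 else 0 := by
  have hA : ∑ p ∈ Finset.HasAntidiagonal.antidiagonal g, ∑ I : Finset (Fin n),
      (if p.1 = 0 ∧ I.card ≤ 1 then A p.1 I * A p.2 Iᶜ else 0)
      = A 0 ∅ * A g Finset.univ + ∑ j, A 0 {j} * A g {j}ᶜ := by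
    rw [Finset.sum_eq_single (0, g)]
    · simp only [true_and]
      rw [sum_finset_card_le_one fun I => A 0 I * A g Iᶜ, Finset.compl_empty]
    · intro p hp hne
      refine Finset.sum_eq_zero fun I _ => if_neg ?_
      rw [Finset.HasAntidiagonal.mem_antidiagonal] at hp
      rintro ⟨h, -⟩
      exact hne (Prod.ext h (by simp only; omega))
    · intro h
      exact absurd (Finset.HasAntidiagonal.mem_antidiagonal.2 (zero_add g)) h
  have hB : ∑ p ∈ Finset.HasAntidiagonal.antidiagonal g, ∑ I : Finset (Fin n),
      (if p.2 = 0 ∧ Iᶜ.card ≤ 1 then A p.1 I * A p.2 Iᶜ else 0)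
      = A 0 ∅ * A g Finset.univ + ∑ j, A 0 {j} * A g {j}ᶜ := by
    rw [← hA, ← Finset.Nat.sum_antidiagonal_swap]
    refine Finset.sum_congr rfl fun p _ => ?_
    rw [← Equiv.sum_comp (Function.Involutive.toPerm compl (compl_involutive (α := Finset (Fin n))))]
    refine Finset.sum_congr rfl fun I _ => ?_
    simp only [Function.Involutive.coe_toPerm, compl_compl, Prod.fst_swap, Prod.snd_swap, mul_comm]
  have hAB : ∑ p ∈ Finset.HasAntidiagonal.antidiagonal g, ∑ I : Finset (Fin n),
      (if (p.1 = 0 ∧ I.card ≤ 1) ∧ (p.2 = 0 ∧ Iᶜ.card ≤ 1) then A p.1 I * A p.2 Iᶜ else 0)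
      = if g = 0 then ∑ I : Finset (Fin n),
            if I.card ≤ 1 ∧ Iᶜ.card ≤ 1 then A 0 I * A 0 Iᶜ else 0 else 0 := by
    split_ifs with hg
    · subst hg
      simp
    · refine Finset.sum_eq_zero fun p hp => Finset.sum_eq_zero fun I _ => if_neg ?_
      rw [Finset.HasAntidiagonal.mem_antidiagonal] at hp
      rintro ⟨⟨h, -⟩, h', -⟩
      omega
  -- Inclusion and exclusion: `hA` collects the splittings with unstable left factor, `hB` those
  -- with unstable right factor, `hAB` those with both.
  rw [← hAB, two_mul]
  nth_rw 1 [← hA]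
  rw [← hB, ← Finset.sum_add_distrib, ← Finset.sum_add_distrib, ← Finset.sum_sub_distrib]
  refine Finset.sum_congr rfl fun p _ => ?_
  rw [← Finset.sum_add_distrib, ← Finset.sum_add_distrib, ← Finset.sum_sub_distrib]
  refine Finset.sum_congr rfl fun I _ => ?_
  have h1 : (0 < 2 * (p.1 : ℤ) + (I.card : ℤ) - 1) ↔ ¬(p.1 = 0 ∧ I.card ≤ 1) := by omega
  have h2 : (0 < 2 * (p.2 : ℤ) + (Iᶜ.card : ℤ) - 1) ↔ ¬(p.2 = 0 ∧ Iᶜ.card ≤ 1) := by omega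
  simp only [h1, h2]
  by_cases c1 : p.1 = 0 ∧ I.card ≤ 1 <;> by_cases c2 : p.2 = 0 ∧ Iᶜ.card ≤ 1 <;>
    simp [c1, c2]

end subseq

/-! ### The disc and annulus functions -/

section unstable

variable {b c : ℝ}

theorem norm_add_one_lt {t : ℂ} (ht : t.re < 0) : ‖t + 1‖ < ‖t - 1‖ := by
  rw [← sq_lt_sq₀ (norm_nonneg _) (norm_nonneg _), Complex.sq_norm, Complex.sq_norm,
    Complex.normSq_apply, Complex.normSq_apply]
  simp only [Complex.add_re, Complex.add_im, Complex.sub_re, Complex.sub_im, Complex.one_re,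
    Complex.one_im]
  nlinarith

/-- On |x| < 1/2 the series is dominated by its terms at 1/2, whose sum is at most 2. The bound
selects the root of the quadratic equation for the disc function. -/
theorem norm_catalanGF_zero_le {x : ℂ} (hx : ‖x‖ < 1 / 2) (a : Fin 0 → ℂ) :
    ‖x * catalanGF 0 x a‖ ≤ 1 := by
  have h1 : ∀ m, catalanSum 0 m a = (multisetCatalan 0 m 0 : ℂ) := by
    intro m
    rw [catalanSum, (hasSum_unique _).tsum_eq, catalanRec_eq_multisetCatalan]
    simp [weight]
  have h2 : ∀ m : ℕ, ‖catalanSum 0 m a * x ^ m‖ ≤ (multisetCatalan 0 m 0 : ℝ) / 2 ^ m := by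
    intro m
    rw [h1, norm_mul, Complex.norm_natCast, norm_pow, div_eq_mul_one_div, ← one_div_pow]
    gcongr
  have h3 : Summable fun m : ℕ => (multisetCatalan 0 m 0 : ℝ) / 2 ^ m :=
    summable_of_sum_range_le (fun m => by positivity) sum_catalan_div_two_pow_le
  have h4 : ‖catalanGF 0 x a‖ ≤ 2 := (tsum_of_norm_bounded h3.hasSum h2).trans
    (Real.tsum_le_of_sum_range_le (fun m => by positivity) sum_catalan_div_two_pow_le)
  rw [norm_mul]
  nlinarith [norm_nonneg x, norm_nonneg (catalanGF 0 x a)]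

/-- The generating function of the Catalan numbers. -/
theorem aOf_mul_catalanGF_zero (hb : 0 ≤ b) (hc : 0 < c) {t : ℂ} (ht : t ∈ tDomain b c) {k : ℕ}
    (hk : k = 0) (a : Fin k → ℂ) : aOf t * catalanGF 0 (aOf t) a = (t + 1) / (t - 1) := by
  subst hk
  have hx := norm_aOf_lt hb hc ht
  have h0 := sub_one_ne_zero_of_mem_tDomain ht
  have h1 : t ^ 2 + 1 ≠ 0 := sq_add_one_ne_zero_of_mem_tDomain hb hc ht
  have hn := norm_catalanGF_zero_le hx a
  have ha : ‖a‖ < 1 / 2 := by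
    rw [pi_norm_lt_iff (by norm_num)]
    exact fun i => i.elim0
  have h2 := catalanGF_eq ha 0 hx fun j => j.elim0
  have h3 : ∀ I : Finset (Fin 0), catalanGF 0 (aOf t) (subseq I a) = catalanGF 0 (aOf t) a := by
    intro I
    rw [Subsingleton.elim I Finset.univ]
    exact apply_subseq_univ (fun _ x => catalanGF 0 (aOf t) x) a
  simp only [and_self, if_true, Finset.univ_eq_empty, Finset.sum_empty, predOrZero,
    Finset.Nat.antidiagonal_zero, Finset.sum_singleton, h3, Finset.sum_const, Finset.card_univ,
    Fintype.card_finset, Fintype.card_fin] at h2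
  set w := aOf t * catalanGF 0 (aOf t) a with hw
  have h4 : w = aOf t + aOf t * w ^ 2 := by
    rw [hw]
    linear_combination (aOf t) * h2
  rw [aOf] at h4
  field_simp at h4
  -- The roots of w = a(1 + w²) are (t+1)/(t-1) and its inverse. The inverse has norm greater than 1
  -- in the left half-plane, against `hn`.
  have h5 : ((t - 1) * w - (t + 1)) * ((t + 1) * w - (t - 1)) = 0 := by linear_combination -h4
  rcases mul_eq_zero.1 h5 with h | h
  · rw [eq_div_iff h0]
    linear_combination h
  · exfalso
    have h6 := congrArg norm (sub_eq_zero.1 h)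
    rw [norm_mul] at h6
    have h7 := norm_add_one_lt ht.1
    nlinarith [norm_nonneg (t + 1)]

/-- With one further variable, both splittings pair the unknown with the disc function, so the loop
equation is linear in the unknown and is solved by division. -/
theorem logDerivA_mul_catalanGF_one (hb : 0 ≤ b) (hc : 0 < c) {t t' : ℂ} (ht : t ∈ tDomain b c)
    (ht' : t' ∈ tDomain b c) (hne : t ≠ t') :
    logDerivA t * catalanGF 0 (aOf t) (fun _ : Fin 1 => aOf t')
      = (t' + 1) / ((t - 1) * (t + t')) := by
  have ha : ‖fun _ : Fin 1 => aOf t'‖ < 1 / 2 := norm_aOf_comp_lt hb hc fun _ : Fin 1 => ht'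
  have h1 := catalanGF_eq ha 0 (norm_aOf_lt hb hc ht) fun j h => hne (eq_of_aOf_eq hb hc ht ht' h)
  have hu : (Finset.univ : Finset (Finset (Fin 1))) = {∅, Finset.univ} := by decide
  have hne' : (∅ : Finset (Fin 1)) ≠ Finset.univ := by decide
  have e1 := aOf_mul_catalanGF_zero hb hc ht (Finset.card_empty (α := Fin 1))
    (subseq ∅ fun _ : Fin 1 => aOf t')
  have e2 := aOf_mul_catalanGF_zero hb hc ht (show ({0}ᶜ : Finset (Fin 1)).card = 0 by decide)
    (subseq {0}ᶜ fun _ : Fin 1 => aOf t')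
  have e3 := aOf_mul_catalanGF_zero hb hc ht' (show ({0}ᶜ : Finset (Fin 1)).card = 0 by decide)
    (subseq {0}ᶜ fun _ : Fin 1 => aOf t')
  have e4 : catalanGF 0 (aOf t) (subseq ∅ᶜ fun _ : Fin 1 => aOf t')
      = catalanGF 0 (aOf t) fun _ : Fin 1 => aOf t' := by
    rw [Finset.compl_empty]
    exact apply_subseq_univ (fun _ x => catalanGF 0 (aOf t) x) fun _ : Fin 1 => aOf t'
  have e5 := aOf_mul_catalanGF_zero hb hc ht (show (Finset.univᶜ : Finset (Fin 1)).card = 0 by simp)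
    (subseq Finset.univᶜ fun _ : Fin 1 => aOf t')
  have e6 := apply_subseq_univ (fun _ x => catalanGF 0 (aOf t) x) fun _ : Fin 1 => aOf t'
  rw [hu, Fin.sum_univ_one, e2, e3] at h1
  simp only [one_ne_zero, and_false, if_false, predOrZero, if_true,
    Finset.Nat.antidiagonal_zero, Finset.sum_singleton, Finset.sum_pair hne', e4, e6] at h1
  set U := catalanGF 0 (aOf t) fun _ : Fin 1 => aOf t'
  have h2 : U * (1 - 2 * aOf t * ((t + 1) / (t - 1)))
      = aOf t * aOf t' / (aOf t - aOf t') * ((t + 1) / (t - 1) - (t' + 1) / (t' - 1)) := by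
    linear_combination h1 + aOf t * U * e5
      + aOf t * U * e1
  have n0 := ne_zero_of_mem_tDomain ht
  have n1 := sub_one_ne_zero_of_mem_tDomain ht
  have n2 := add_one_ne_zero_of_mem_tDomain hb hc ht
  have n3 := sq_add_one_ne_zero_of_mem_tDomain hb hc ht
  have n1' := sub_one_ne_zero_of_mem_tDomain ht'
  have n3' := sq_add_one_ne_zero_of_mem_tDomain hb hc ht'
  have n4 := add_ne_zero_of_mem_tDomain ht ht'
  have n5 : t - t' ≠ 0 := sub_ne_zero.2 hne
  have d1 : 1 - 2 * aOf t * ((t + 1) / (t - 1)) = -2 * t / (t ^ 2 + 1) := by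
    rw [aOf]
    field_simp
    ring
  have d2 : aOf t - aOf t' = (t - t') * (t + t') / ((t ^ 2 + 1) * (t' ^ 2 + 1)) := by
    rw [aOf, aOf]
    field_simp
    ring
  have d3 : logDerivA t = 4 * t / ((t ^ 2 + 1) * ((t - 1) * (t + 1))) := by
    rw [logDerivA]
    congr 2
    ring
  rw [d1, d2] at h2
  have h3 : U = (aOf t * aOf t' / ((t - t') * (t + t') / ((t ^ 2 + 1) * (t' ^ 2 + 1))) *
      ((t + 1) / (t - 1) - (t' + 1) / (t' - 1))) / (-2 * t / (t ^ 2 + 1)) := by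
    rw [eq_div_iff, h2]
    exact div_ne_zero (mul_ne_zero (by norm_num) n0) n3
  rw [h3, d3, aOf, aOf]
  field_simp
  ring

end unstable

/-! ### The initial data -/

section initial

variable {b c : ℝ}

/-- The loop equation yields the formula off the diagonal only. The derivative `ψ` and the formula
are both continuous at t₁, so they also agree when t₁ = t₂. -/
theorem hasDerivAt_laplaceT_zero_two (hb : 0 ≤ b) (hc : 0 < c) (ℓ : ℂ → ℂ) {t₁ t₂ : ℂ}
    (ht₁ : t₁ ∈ tDomain b c) (ht₂ : t₂ ∈ tDomain b c) :
    HasDerivAt (fun s => laplaceT ℓ b c 0 ![s, t₂])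
      ((t₂ + 1) / ((t₁ - 1) * (t₁ + t₂))) t₁ := by
  let ψ : ℂ → ℂ := fun s => logDerivA s * (aOf s *
    mps (pderivCoeff 0 (laplaceCoeff 0)) (aOf ∘ Function.update ![t₁, t₂] 0 s))
  have hu : ∀ s u : ℂ, Function.update ![s, t₂] 0 u = ![u, t₂] := fun s u => by
    funext i
    fin_cases i <;> rfl
  have hmem : ∀ s ∈ tDomain b c, ∀ i, (![s, t₂] : Fin 2 → ℂ) i ∈ tDomain b c := by
    intro s hs i
    fin_cases i
    · exact hs
    · exact ht₂
  have h1 : ∀ s ∈ tDomain b c, HasDerivAt (fun s => laplaceT ℓ b c 0 ![s, t₂]) (ψ s) s := by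
    intro s hs
    have h := hasDerivAt_laplaceT hb hc ℓ (g := 0) (by simp) (hmem s hs) 0
    simp only [hu] at h
    simp only [ψ, hu]
    exact h
  have h2 : ∀ s ∈ tDomain b c, s ≠ t₂ → ψ s = (t₂ + 1) / ((s - 1) * (s + t₂)) := by
    intro s hs hne
    have ha : ‖fun _ : Fin 1 => aOf t₂‖ < 1 / 2 := norm_aOf_comp_lt hb hc fun _ : Fin 1 => ht₂
    rw [← logDerivA_mul_catalanGF_one hb hc hs ht₂ hne, catalanGF_eq_mps 0
      (norm_aOf_lt hb hc hs) ha, if_neg (by simp), zero_add]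
    simp only [ψ, hu]
    congr 3
    funext i
    fin_cases i <;> rfl
  have n1 := sub_one_ne_zero_of_mem_tDomain ht₁
  have n2 := add_ne_zero_of_mem_tDomain ht₁ ht₂
  have c1 : ContinuousAt (fun s : ℂ => (t₂ + 1) / ((s - 1) * (s + t₂))) t₁ := by
    fun_prop (disch := exact mul_ne_zero n1 n2)
  have c2 : ContinuousAt ψ t₁ := by
    have d1 := (hasDerivAt_mps_aOf hb hc ((hasGrowth_laplaceCoeff 0 2).pderiv 0) (hmem t₁ ht₁)
      0).continuousAt
    have d2 : ContinuousAt logDerivA t₁ := by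
      have m1 := sq_add_one_ne_zero_of_mem_tDomain hb hc ht₁
      have m2 := sq_sub_one_ne_zero_of_mem_tDomain hb hc ht₁
      unfold logDerivA
      fun_prop (disch := exact mul_ne_zero m1 m2)
    exact d2.mul ((hasDerivAt_aOf hb hc ht₁).continuousAt.mul d1)
  have h3 : ψ t₁ = (t₂ + 1) / ((t₁ - 1) * (t₁ + t₂)) := by
    refine tendsto_nhds_unique (c2.tendsto.mono_left (nhdsWithin_le_nhds (s := {t₁}ᶜ)))
      (Filter.Tendsto.congr' ?_ (c1.tendsto.mono_left nhdsWithin_le_nhds))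
    have e1 : ∀ᶠ s in nhdsWithin t₁ {t₁}ᶜ, s ∈ tDomain b c :=
      nhdsWithin_le_nhds ((isOpen_tDomain hb hc).mem_nhds ht₁)
    have e2 : ∀ᶠ s in nhdsWithin t₁ {t₁}ᶜ, s ≠ t₂ := by
      rcases eq_or_ne t₁ t₂ with rfl | hne
      · exact self_mem_nhdsWithin
      · exact nhdsWithin_le_nhds (isOpen_ne.mem_nhds hne)
    filter_upwards [e1, e2] with s hs hs'
    exact (h2 s hs hs').symm
  rw [← h3]
  exact h1 t₁ ht₁

theorem IsLogBranchNear.hasDerivAt {ℓ : ℂ → ℂ} {z : ℂ} (h : IsLogBranchNear ℓ z) :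
    HasDerivAt ℓ z⁻¹ z := by
  have h1 : Complex.exp (ℓ z) = z := h.2.self_of_nhds
  have h2 := Complex.hasDerivAt_exp (ℓ z)
  have h3 := h2.of_local_left_inverse h.1 (Complex.exp_ne_zero _) h.2
  rwa [h1] at h3

/-- The derivatives of ℓ(x) and log(1 - b/x) add up to that of log(x - b), that is, of -log a. This
supplies the constant term 1 of the disc function, absent from the power series, so the derivative
is κ W_{0,1} = κ z/a. -/
theorem hasDerivAt_laplaceT_zero_one (hb : 0 ≤ b) (hc : 0 < c) {ℓ : ℂ → ℂ} {t : ℂ}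
    (ht : t ∈ tDomain b c) (hℓ : IsLogBranchNear ℓ (xOf b c t)) :
    HasDerivAt (fun s => laplaceT ℓ b c 0 ![s]) (8 * t / ((t + 1) * (t - 1) ^ 3)) t := by
  have hu : ∀ u : ℂ, Function.update (fun _ : Fin 1 => t) 0 u = fun _ => u := fun u => by
    funext i
    fin_cases i
    rfl
  have h1 : ∀ s ∈ tDomain b c, laplaceT ℓ b c 0 ![s] = mps (laplaceCoeff 0)
      (aOf ∘ Function.update (fun _ : Fin 1 => t) 0 s) - Complex.log (1 - b / xOf b c s)
        - ℓ (xOf b c s) := by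
    intro s hs
    have hx : b + 2 * c < ‖(fun i : Fin 1 => xOf b c (![s] i)) 0‖ := hs.2
    have hm : (fun i : Fin 1 => (c : ℂ) / (xOf b c (![s] i) - b)) = aOf ∘ fun _ : Fin 1 => s := by
      funext i
      fin_cases i
      exact div_xOf_sub hb hc hs
    rw [laplaceT, laplaceTransform, if_pos ⟨rfl, rfl⟩, tsum_laplaceTerm_zero_one hb hc hx,
      bcMotzkin_zero_one, hm, hu]
    simp
  have hmem : ∀ i : Fin 1, (fun _ : Fin 1 => t) i ∈ tDomain b c := fun _ => ht
  have d1 := hasDerivAt_mps_aOf hb hc (hasGrowth_laplaceCoeff 0 1) hmem 0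
  have m1 := sq_sub_one_ne_zero_of_mem_tDomain hb hc ht
  have m2 := sq_add_one_ne_zero_of_mem_tDomain hb hc ht
  have hxb : xOf b c t - b ≠ 0 := by
    rw [xOf_sub hb hc ht]
    exact div_ne_zero (Complex.ofReal_ne_zero.2 hc.ne') (aOf_ne_zero hb hc ht)
  have hx0 : xOf b c t ≠ 0 := by
    rw [← norm_pos_iff]
    linarith [ht.2]
  have d2 : HasDerivAt (xOf b c) (-logDerivA t * (xOf b c t - b)) t := by
    have h := ((((((hasDerivAt_id t).pow 2).sub_const 1).inv m1).const_mul 4).const_add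
      2).const_mul (c : ℂ) |>.const_add (b : ℂ)
    refine (h.congr_of_eventuallyEq (Filter.Eventually.of_forall fun s => ?_)).congr_deriv ?_
    · simp [xOf, div_eq_mul_inv]
    · rw [xOf_sub hb hc ht, logDerivA, aOf]
      simp only [Pi.pow_apply, id]
      push_cast
      field_simp
  have hslit : 1 - (b : ℂ) / xOf b c t ∈ Complex.slitPlane := by
    refine Complex.mem_slitPlane_of_norm_lt_one (z := -(b / xOf b c t)) ?_
    rw [norm_neg, norm_div, Complex.norm_real, Real.norm_of_nonneg hb,
      div_lt_one (norm_pos_iff.2 hx0)]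
    linarith [ht.2]
  have d3 : HasDerivAt (fun s => Complex.log (1 - b / xOf b c s))
      (-logDerivA t * (xOf b c t - b) * (b / xOf b c t ^ 2) / (1 - b / xOf b c t)) t := by
    have h := ((d2.inv hx0).const_mul (b : ℂ)).const_sub 1
    refine HasDerivAt.clog (h.congr_of_eventuallyEq
      (Filter.Eventually.of_forall fun s => ?_)|>.congr_deriv ?_) hslit
    · simp [div_eq_mul_inv]
    · ring
  have d4 : HasDerivAt (fun s => ℓ (xOf b c s))
      ((xOf b c t)⁻¹ * (-logDerivA t * (xOf b c t - b))) t := hℓ.hasDerivAt.comp t d2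
  have h2 := ((d1.sub d3).sub d4).congr_of_eventuallyEq
    (f₁ := fun s => laplaceT ℓ b c 0 ![s]) <| by
      filter_upwards [(isOpen_tDomain hb hc).mem_nhds ht] with s hs
      exact h1 s hs
  refine h2.congr_deriv ?_
  have e1 := catalanGF_eq_mps 0 (norm_aOf_lt hb hc ht) (a := Fin.elim0)
    (norm_aOf_comp_lt hb hc (t := Fin.elim0) fun i => i.elim0)
  have e2 := aOf_mul_catalanGF_zero hb hc ht rfl Fin.elim0
  have e3 : (Fin.cons (aOf t) Fin.elim0 : Fin 1 → ℂ) = aOf ∘ fun _ : Fin 1 => t := by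
    funext i
    fin_cases i
    rfl
  rw [if_pos ⟨rfl, rfl⟩, e3] at e1
  have e4 : aOf t * mps (pderivCoeff 0 (laplaceCoeff 0)) (aOf ∘ fun _ : Fin 1 => t)
      = (t + 1) / (t - 1) / aOf t - 1 := by
    rw [eq_sub_iff_add_eq, eq_div_iff (aOf_ne_zero hb hc ht)]
    linear_combination e2 - aOf t * e1
  have e5 : -logDerivA t * (xOf b c t - b) * (b / xOf b c t ^ 2) / (1 - b / xOf b c t)
      = -logDerivA t * (b / xOf b c t) := by
    rw [one_sub_div hx0]
    field_simp
  have e6 : (xOf b c t)⁻¹ * (-logDerivA t * (xOf b c t - b))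
      = -logDerivA t * (1 - b / xOf b c t) := by
    field_simp
  have n0 := sub_one_ne_zero_of_mem_tDomain ht
  have n1 := add_one_ne_zero_of_mem_tDomain hb hc ht
  have e7 : logDerivA t * ((t + 1) / (t - 1) / aOf t) = 8 * t / ((t + 1) * (t - 1) ^ 3) := by
    rw [logDerivA, aOf, show t ^ 2 - 1 = (t - 1) * (t + 1) by ring]
    field_simp
    ring
  rw [e4, e5, e6, ← e7]
  ring

end initial

/-! ### The differential recursion -/

section recursion

variable {b c : ℝ}

theorem one_sub_mul_aOf (hb : 0 ≤ b) (hc : 0 < c) {t : ℂ} (ht : t ∈ tDomain b c) :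
    1 - 2 * aOf t * ((t + 1) / (t - 1)) = -2 * t / (t ^ 2 + 1) := by
  have n1 := sub_one_ne_zero_of_mem_tDomain ht
  have n3 := sq_add_one_ne_zero_of_mem_tDomain hb hc ht
  rw [aOf]
  field_simp
  ring

/-- This is the origin of the prefactor -(1/32)(t²-1)³/t²: a product of two generating functions
becomes one of two t-derivatives, after division by 1 - 2az = -2t/(t²+1). -/
theorem logDerivA_mul_sq (hb : 0 ≤ b) (hc : 0 < c) {t : ℂ} (ht : t ∈ tDomain b c) :
    logDerivA t * aOf t ^ 2
      = -2 * t / (t ^ 2 + 1) * (-(1 / 32) * ((t ^ 2 - 1) ^ 3 / t ^ 2) * logDerivA t ^ 2) := by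
  have n0 := ne_zero_of_mem_tDomain ht
  have n2 := sq_sub_one_ne_zero_of_mem_tDomain hb hc ht
  have n3 := sq_add_one_ne_zero_of_mem_tDomain hb hc ht
  rw [aOf, logDerivA]
  field_simp
  ring

/-- The j-th divided difference of the loop equation together with the two splittings having annulus
factor `w`. Once `w` is explicit, this is a rational identity in t and s, linear in the unspecified
values V and W. -/
theorem recursion_summand (hb : 0 ≤ b) (hc : 0 < c) {t s V W w : ℂ} (ht : t ∈ tDomain b c)
    (hs : s ∈ tDomain b c) (hne : t ≠ s) (hw : logDerivA t * w = (s + 1) / ((t - 1) * (t + s))) :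
    logDerivA t * (aOf t * aOf s / (aOf t - aOf s) * (aOf t * V - aOf s * W))
        + logDerivA t * (2 * aOf t ^ 2 * (w * V))
      = -2 * t / (t ^ 2 + 1) *
        (-(1 / 16) * (s / (t ^ 2 - s ^ 2) * ((t ^ 2 - 1) ^ 3 / t ^ 2 * (logDerivA t * V)
            - (s ^ 2 - 1) ^ 3 / s ^ 2 * (logDerivA s * W)))
          + -(1 / 16) * ((t ^ 2 - 1) ^ 2 / t ^ 2 * (logDerivA t * V))) := by
  have n0 := ne_zero_of_mem_tDomain ht
  have n1 := sub_one_ne_zero_of_mem_tDomain ht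
  have n2 := add_one_ne_zero_of_mem_tDomain hb hc ht
  have n3 := sq_add_one_ne_zero_of_mem_tDomain hb hc ht
  have m0 := ne_zero_of_mem_tDomain hs
  have m1 := sub_one_ne_zero_of_mem_tDomain hs
  have m2 := add_one_ne_zero_of_mem_tDomain hb hc hs
  have m3 := sq_add_one_ne_zero_of_mem_tDomain hb hc hs
  have n4 := add_ne_zero_of_mem_tDomain ht hs
  have n5 : t - s ≠ 0 := sub_ne_zero.2 hne
  have d1 : aOf t - aOf s = (t - s) * (t + s) / ((t ^ 2 + 1) * (s ^ 2 + 1)) := by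
    rw [aOf, aOf]
    field_simp
    ring
  have d2 : ∀ u : ℂ, logDerivA u = 4 * u / ((u ^ 2 + 1) * ((u - 1) * (u + 1))) := by
    intro u
    rw [logDerivA]
    congr 2
    ring
  have d3 : ∀ u : ℂ, u ^ 2 - 1 = (u - 1) * (u + 1) := fun u => by ring
  have d4 : logDerivA t * (2 * aOf t ^ 2 * (w * V))
      = 2 * aOf t ^ 2 * ((s + 1) / ((t - 1) * (t + s)) * V) := by
    rw [← hw]
    ring
  rw [d4, d1, d2, d2, aOf, aOf, d3, d3, show t ^ 2 - s ^ 2 = (t - s) * (t + s) by ring]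
  field_simp
  ring

/-- The differential recursion, with the correction for unstable terms that are counted twice. -/
theorem partialDeriv_laplaceT_eq_recursionRHS (hb : 0 ≤ b) (hc : 0 < c) (ℓ : ℂ → ℂ) {g n : ℕ}
    (h01 : ¬(g = 0 ∧ n = 0)) (h02 : (g, n) ≠ (0, 1)) {t : Fin (n + 1) → ℂ}
    (ht : ∀ i, t i ∈ tDomain b c) (hne : ∀ j : Fin n, t 0 ≠ t j.succ) :
    partialDeriv 0 (laplaceT ℓ b c g) t = recursionRHS ℓ b c g t
      + (1 / 32) * ((t 0 ^ 2 - 1) ^ 3 / t 0 ^ 2) * if g = 0 then ∑ I : Finset (Fin n),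
          if I.card ≤ 1 ∧ Iᶜ.card ≤ 1 then
            logDerivA (t 0) * catalanGF 0 (aOf (t 0)) (aOf ∘ subseq I (Fin.tail t))
              * (logDerivA (t 0) * catalanGF 0 (aOf (t 0)) (aOf ∘ subseq Iᶜ (Fin.tail t)))
          else 0 else 0 := by
  have ht₀ := ht 0
  have htt : ∀ j, Fin.tail t j ∈ tDomain b c := fun j => ht j.succ
  have hU : partialDeriv 0 (laplaceT ℓ b c g) t
      = logDerivA (t 0) * catalanGF g (aOf (t 0)) (aOf ∘ Fin.tail t) := by
    conv_lhs => rw [← Fin.cons_self_tail t]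
    exact partialDeriv_laplaceT_cons hb hc ℓ h01 ht₀ htt
  have hV : ∀ j : Fin n, partialDeriv 0 (laplaceT ℓ b c g)
        (Fin.cons (t 0) (subseq {j}ᶜ (Fin.tail t)))
      = logDerivA (t 0) * catalanGF g (aOf (t 0)) (aOf ∘ subseq {j}ᶜ (Fin.tail t)) := by
    intro j
    refine partialDeriv_laplaceT_cons hb hc ℓ ?_ ht₀ fun i => htt _
    rw [Finset.card_compl, Finset.card_singleton, Fintype.card_fin]
    rintro ⟨rfl, h⟩
    have := j.pos
    exact h02 (Prod.ext rfl (by simp only; omega))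
  have hW : ∀ j : Fin n, partialDeriv j (laplaceT ℓ b c g) (Fin.tail t)
      = logDerivA (t j.succ) * catalanGF g (aOf (t j.succ)) (aOf ∘ subseq {j}ᶜ (Fin.tail t)) :=
    fun j => partialDeriv_laplaceT_eq hb hc ℓ h02 htt j
  have hP : (if g = 0 then 0 else partialDeriv 0 (partialDeriv 1 (laplaceT ℓ b c (g - 1)))
        (Fin.cons (t 0) t : Fin (n + 2) → ℂ))
      = logDerivA (t 0) ^ 2 *
        predOrZero g fun g' => catalanGF₂ g' (aOf (t 0)) (aOf (t 0)) (aOf ∘ Fin.tail t) := by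
    rw [predOrZero]
    split_ifs
    · rw [mul_zero]
    · conv_lhs => rw [← Fin.cons_self_tail t]
      rw [Fin.cons_zero, partialDeriv_partialDeriv_laplaceT_cons hb hc ℓ (g - 1) ht₀ ht₀ htt, sq]
  have hS : ∀ (p : ℕ × ℕ) (I : Finset (Fin n)),
      (if 0 < 2 * (p.1 : ℤ) + (I.card : ℤ) - 1 ∧ 0 < 2 * (p.2 : ℤ) + (Iᶜ.card : ℤ) - 1 then
          partialDeriv 0 (laplaceT ℓ b c p.1) (Fin.cons (t 0) (subseq I (Fin.tail t)))
            * partialDeriv 0 (laplaceT ℓ b c p.2) (Fin.cons (t 0) (subseq Iᶜ (Fin.tail t)))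
        else 0)
      = logDerivA (t 0) ^ 2 *
        if 0 < 2 * (p.1 : ℤ) + (I.card : ℤ) - 1 ∧ 0 < 2 * (p.2 : ℤ) + (Iᶜ.card : ℤ) - 1 then
          catalanGF p.1 (aOf (t 0)) (aOf ∘ subseq I (Fin.tail t))
            * catalanGF p.2 (aOf (t 0)) (aOf ∘ subseq Iᶜ (Fin.tail t)) else 0 := by
    intro p I
    split_ifs with h
    · have hT : ∀ J : Finset (Fin n), ∀ i, subseq J (Fin.tail t) i ∈ tDomain b c :=
        fun J i => htt _
      rw [partialDeriv_laplaceT_cons hb hc ℓ (by omega) ht₀ (hT I),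
        partialDeriv_laplaceT_cons hb hc ℓ (by omega) ht₀ (hT Iᶜ)]
      ring
    · rw [mul_zero]
  have hC : (if g = 0 then ∑ I : Finset (Fin n), if I.card ≤ 1 ∧ Iᶜ.card ≤ 1 then
        logDerivA (t 0) * catalanGF 0 (aOf (t 0)) (aOf ∘ subseq I (Fin.tail t))
          * (logDerivA (t 0) * catalanGF 0 (aOf (t 0)) (aOf ∘ subseq Iᶜ (Fin.tail t)))
        else 0 else 0)
      = logDerivA (t 0) ^ 2 * if g = 0 then ∑ I : Finset (Fin n), if I.card ≤ 1 ∧ Iᶜ.card ≤ 1 then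
        catalanGF 0 (aOf (t 0)) (aOf ∘ subseq I (Fin.tail t))
          * catalanGF 0 (aOf (t 0)) (aOf ∘ subseq Iᶜ (Fin.tail t)) else 0 else 0 := by
    split_ifs
    · rw [Finset.mul_sum]
      refine Finset.sum_congr rfl fun I _ => ?_
      split_ifs
      · ring
      · rw [mul_zero]
    · rw [mul_zero]
  have hsub : ∀ I : Finset (Fin n),
      subseq I (aOf ∘ Fin.tail t) = aOf ∘ subseq I (Fin.tail t) := fun _ => rfl
  have loop := catalanGF_eq (norm_aOf_comp_lt hb hc htt) g (norm_aOf_lt hb hc ht₀)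
    fun j h => hne j (eq_of_aOf_eq hb hc ht₀ (htt j) h)
  have hz := aOf_mul_catalanGF_zero hb hc ht₀ (Finset.card_empty (α := Fin n))
    (subseq ∅ (aOf ∘ Fin.tail t))
  have hw : ∀ j : Fin n, logDerivA (t 0) * catalanGF 0 (aOf (t 0))
      (aOf ∘ subseq {j} (Fin.tail t)) = (t j.succ + 1) / ((t 0 - 1) * (t 0 + t j.succ)) := by
    intro j
    refine Eq.trans ?_ (logDerivA_mul_catalanGF_one hb hc ht₀ (htt j) (hne j))
    exact congrArg _
      (apply_subseq_singleton (fun _ x => catalanGF 0 (aOf (t 0)) x) (aOf ∘ Fin.tail t) j)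
  have hu : catalanGF g (aOf (t 0)) (subseq Finset.univ (aOf ∘ Fin.tail t))
      = catalanGF g (aOf (t 0)) (aOf ∘ Fin.tail t) :=
    apply_subseq_univ (fun _ x => catalanGF g (aOf (t 0)) x) (aOf ∘ Fin.tail t)
  rw [if_neg h01, zero_add, sum_splittings g fun p I =>
    catalanGF p (aOf (t 0)) (subseq I (aOf ∘ Fin.tail t)), hu] at loop
  simp only [hsub, Function.comp_apply, Fin.tail] at loop hz
  have hD := one_sub_mul_aOf hb hc ht₀
  have hK := logDerivA_mul_sq hb hc ht₀
  have hD0 : -2 * t 0 / (t 0 ^ 2 + 1) ≠ 0 :=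
    div_ne_zero (mul_ne_zero (by norm_num) (ne_zero_of_mem_tDomain ht₀))
      (sq_add_one_ne_zero_of_mem_tDomain hb hc ht₀)
  -- The algebra of the separation: `U` is the unknown, `A` the disc function, `S₁` the divided
  -- differences, `S₂` the annulus terms, `S` the stable splittings and `C` the doubly unstable
  -- ones. Moving 2x²AU to the left leaves the factor `D`, which is nonzero as t ≠ 0.
  have key : ∀ {κ U x A z D K S₁ S₂ S₃ S₄ P S C : ℂ},
      U = S₁ + x ^ 2 * P + x ^ 2 * (S + 2 * (A * U + S₂) - C) → x * A = z → 1 - 2 * x * z = D →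
      κ * x ^ 2 = D * (-(1 / 32) * K * κ ^ 2) →
      κ * S₁ + κ * (2 * x ^ 2 * S₂) = D * (-(1 / 16) * S₃ + -(1 / 16) * S₄) →
      D * (κ * U) = D * (-(1 / 16) * S₃ - 1 / 16 * S₄ - 1 / 32 * K * (κ ^ 2 * P)
        - 1 / 32 * K * (κ ^ 2 * S) + 1 / 32 * K * (κ ^ 2 * C)) := by
    intro κ U x A z D K S₁ S₂ S₃ S₄ P S C h₁ h₂ h₃ h₄ h₅
    linear_combination κ * h₁ + 2 * κ * x * U * h₂ - κ * U * h₃ + (P + S - C) * h₄ + h₅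
  rw [recursionRHS]
  simp only [hV, hW, hP, hS, hC]
  simp_rw [← Finset.mul_sum (a := logDerivA (t 0) ^ 2)]
  rw [hU]
  refine mul_left_cancel₀ hD0 (key loop hz hD hK ?_)
  simp only [Finset.mul_sum, ← Finset.sum_add_distrib]
  exact Finset.sum_congr rfl fun j _ => recursion_summand hb hc ht₀ (htt j) (hne j) (hw j)

/-- For g = 0, a splitting into two sets of at most one element forces n ≤ 2, and these cases are
excluded; so the correction is an empty sum. -/
theorem partialDeriv_laplaceT_eq_recursionRHS_of_ne (hb : 0 ≤ b) (hc : 0 < c) (ℓ : ℂ → ℂ)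
    {g n : ℕ} (h01 : (g, n + 1) ≠ (0, 1)) (h02 : (g, n + 1) ≠ (0, 2)) (h03 : (g, n + 1) ≠ (0, 3))
    {t : Fin (n + 1) → ℂ} (ht : ∀ i, t i ∈ tDomain b c) (hne : ∀ j : Fin n, t 0 ≠ t j.succ) :
    partialDeriv 0 (laplaceT ℓ b c g) t = recursionRHS ℓ b c g t := by
  simp only [ne_eq, Prod.mk.injEq, not_and] at h01 h02 h03
  rw [partialDeriv_laplaceT_eq_recursionRHS hb hc ℓ (by omega) (by simpa using h02) ht hne,
    add_eq_left, mul_eq_zero]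
  right
  split_ifs with hg
  · refine Finset.sum_eq_zero fun I _ => if_neg ?_
    have h1 := h01 hg
    have h2 := h02 hg
    have h3 := h03 hg
    have h4 := Finset.card_add_card_compl I
    rw [Fintype.card_fin] at h4
    omega
  · rfl

/-- The doubly unstable splittings are I = {0} and I = {1}; they give the same product, so 2 · 1/32
= 1/16. -/
theorem partialDeriv_laplaceT_zero_three (hb : 0 ≤ b) (hc : 0 < c) (ℓ : ℂ → ℂ) {t : Fin 3 → ℂ}
    (ht : ∀ i, t i ∈ tDomain b c) (h1 : t 0 ≠ t 1) (h2 : t 0 ≠ t 2) :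
    partialDeriv 0 (laplaceT ℓ b c 0) t = recursionRHS ℓ b c 0 t
      + (1 / 16) * ((t 0 ^ 2 - 1) ^ 3 / t 0 ^ 2)
        * partialDeriv 0 (laplaceT ℓ b c 0) ![t 0, t 1]
        * partialDeriv 0 (laplaceT ℓ b c 0) ![t 0, t 2] := by
  have hne : ∀ j : Fin 2, t 0 ≠ t j.succ := by
    intro j
    fin_cases j
    · exact h1
    · exact h2
  have hpair : ∀ j : Fin 2, partialDeriv 0 (laplaceT ℓ b c 0) ![t 0, t j.succ]
      = logDerivA (t 0) * catalanGF 0 (aOf (t 0)) (aOf ∘ subseq {j} (Fin.tail t)) := by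
    intro j
    have h := partialDeriv_laplaceT_cons hb hc ℓ (g := 0) (by simp) (ht 0)
      (t := fun _ : Fin 1 => t j.succ) fun _ => ht j.succ
    have e : (![t 0, t j.succ] : Fin 2 → ℂ) = Fin.cons (t 0) fun _ : Fin 1 => t j.succ := by
      funext i
      fin_cases i <;> rfl
    rw [e, h]
    exact congrArg _
      (apply_subseq_singleton (fun _ x => catalanGF 0 (aOf (t 0)) (aOf ∘ x)) (Fin.tail t) j).symm
  have hsum : ∀ F : Finset (Fin 2) → ℂ,
      (∑ I : Finset (Fin 2), if I.card ≤ 1 ∧ Iᶜ.card ≤ 1 then F I else 0) = F {0} + F {1} := by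
    intro F
    rw [← Finset.sum_filter, show (Finset.univ.filter fun I : Finset (Fin 2) =>
      I.card ≤ 1 ∧ Iᶜ.card ≤ 1) = {{0}, {1}} by decide, Finset.sum_pair (by decide)]
  have c0 : ({0}ᶜ : Finset (Fin 2)) = {1} := by decide
  have c1 : ({1}ᶜ : Finset (Fin 2)) = {0} := by decide
  have e0 := hpair 0
  have e1 := hpair 1
  rw [show (0 : Fin 2).succ = 1 from rfl] at e0
  rw [show (1 : Fin 2).succ = 2 from rfl] at e1
  rw [partialDeriv_laplaceT_eq_recursionRHS hb hc ℓ (by simp) (by simp) ht hne, if_pos rfl, hsum,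
    c0, c1, e0, e1]
  ring

end recursion

theorem theorem5p1 (b c : ℝ) (hb : 0 ≤ b) (hc : 0 < c) (ℓ : ℂ → ℂ) :
    -- the series defining `F_{g,v}` converge absolutely
    (∀ (g v : ℕ) (x : Fin v → ℂ), (∀ i, b + 2 * c < ‖x i‖) →
      Summable (fun n : Fin v → ℕ+ => laplaceTerm b c g x n)) ∧
    -- `F_{g,v}(t_1, …, t_v)` is holomorphic
    (∀ g v : ℕ, (g, v) ≠ (0, 1) →
      DifferentiableOn ℂ (fun t : Fin v → ℂ => laplaceT ℓ b c g t)
        {t | ∀ i, t i ∈ tDomain b c}) ∧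
    -- the differential recursion, with `v = n + 1`
    (∀ (g n : ℕ) (t : Fin (n + 1) → ℂ),
      (g, n + 1) ≠ (0, 1) → (g, n + 1) ≠ (0, 2) → (g, n + 1) ≠ (0, 3) →
      (∀ i, t i ∈ tDomain b c) → (∀ j : Fin n, t 0 ≠ t j.succ) →
      partialDeriv 0 (laplaceT ℓ b c g) t = recursionRHS ℓ b c g t) ∧
    -- for `(g,v) = (0,3)` there is one more term
    (∀ t : Fin 3 → ℂ, (∀ i, t i ∈ tDomain b c) → t 0 ≠ t 1 → t 0 ≠ t 2 →
      partialDeriv 0 (laplaceT ℓ b c 0) t = recursionRHS ℓ b c 0 t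
        + (1 / 16) * ((t 0 ^ 2 - 1) ^ 3 / t 0 ^ 2)
          * partialDeriv 0 (laplaceT ℓ b c 0) ![t 0, t 1]
          * partialDeriv 0 (laplaceT ℓ b c 0) ![t 0, t 2]) ∧
    -- the initial data for `(g,v) = (0,1)`
    (∀ t ∈ tDomain b c, IsLogBranchNear ℓ (xOf b c t) →
      HasDerivAt (fun s => laplaceT ℓ b c 0 ![s])
        (8 * t / ((t + 1) * (t - 1) ^ 3)) t) ∧
    -- the initial data for `(g,v) = (0,2)`
    (∀ t₁ ∈ tDomain b c, ∀ t₂ ∈ tDomain b c,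
      HasDerivAt (fun s => laplaceT ℓ b c 0 ![s, t₂])
        ((t₂ + 1) / ((t₁ - 1) * (t₁ + t₂))) t₁) := by
  refine ⟨fun g v x hx => summable_laplaceTerm hb hc g hx,
    fun g v hgv => differentiableOn_laplaceT hb hc ℓ hgv,
    fun g n t h01 h02 h03 ht hne =>
      partialDeriv_laplaceT_eq_recursionRHS_of_ne hb hc ℓ h01 h02 h03 ht hne,
    fun t ht h1 h2 => partialDeriv_laplaceT_zero_three hb hc ℓ ht h1 h2,
    fun t ht hℓ => hasDerivAt_laplaceT_zero_one hb hc ht hℓ,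
    fun t₁ ht₁ t₂ ht₂ => hasDerivAt_laplaceT_zero_two hb hc ℓ ht₁ ht₂⟩
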